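/- **Conventions.** A *structure* $M$ for a first-order vocabulary $S$ (an $S$-structure) is a nonempty metric space with metric $d\le 1$, together with a uniformly continuous operation $f^M\colon M^n\to M$ for each $n$-ary operation symbol and a uniformly continuous predicate $P^M\colon M^n\to[0,1]$ for each $n$-ary predicate symbol of $S$ (nullary operation symbols are constants). A *signature* $\mathbf S=(S,\mathcal U)$ is a vocabulary $S$ with, for each symbol, a modulus $\delta\colon\mathbb Q\cap(0,1)\to\mathbb Q\cap(0,1)$; an $\mathbf S$-structure is an $S$-structure in which $\sup_i d(a_i,b_i)<\delta(\epsilon)$ implies $d(f^M(\bar a),f^M(\bar b))\le\epsilon$ (respectively $|P^M(\bar a)-P^M(\bar b)|\le\epsilon$), where $\delta$ is the modulus of the symbol concerned. A *$[0,1]$-valued logic* $\mathcal L$ assigns to each vocabulary $S$ a set of $S$-sentences, increasing with $S$, and to each $S$-sentence $\varphi$ and $S$-structure $M$ a truth value $\varphi^M\in[0,1]$, such that $\varphi^M$ is invariant under isometric isomorphism of $M$, depends only on the reduct of $M$ to $S$ when $\varphi$ is an $S$-sentence, and is preserved by renaming of symbols. Write $M\models_{\mathcal L}\varphi$ if $\varphi^M=1$.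 An $S$-formula $\varphi(\bar x)$ is a sentence of $S\cup\{\bar x\}$ with $\bar x$ a finite tuple of new constants, and $\varphi^M[\bar a]=\varphi^{(M,\bar a)}$. The atomic sentences $P(t_1,\dots,t_n)$ and $d(t_1,t_2)$, with closed terms $t_i$ and their usual values, are understood to belong to $\mathcal L$. *Basic continuous logic* $\mathsf{CL}$ has as formulas those built from the atomic formulas $P(t_1,\dots,t_n)$, $d(t_1,t_2)$ by the Łukasiewicz implication $x\to y=\min\{1-x+y,1\}$, the rational constants in $[0,1]$, and $\exists$ (interpreted as supremum). The *logical topology* $\tau_{\mathcal L}(\mathbf S)$ on the class of $\mathbf S$-structures has as closed classes the classes of all $\mathbf S$-models of sets of $S$-sentences of $\mathcal L$. $\mathcal L$ *extends* $\mathsf{CL}$ if $\tau_{\mathsf{CL}}(\mathbf S)\subseteq\tau_{\mathcal L}(\mathbf S)$ for every signature $\mathbf S$, and is *equivalent* to $\mathsf{CL}$ for a signature $\mathbf S$ if $\tau_{\mathcal L}(\mathbf S)=\tau_{\mathsf{CL}}(\mathbf S)$. Let $\kappa$ be an uncountable cardinal and $T$ a set of $S$-sentences that has an $\mathbf S$-model.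 A set $\Sigma(\bar x)$ of $S$-formulas is a *type* of $T$ if it is realized in some $\mathbf S$-model of $T$; it is *$\kappa$-principal* over $T$ if there is a set $\Phi(\bar x)$ of fewer than $\kappa$ $S$-formulas which is realized in some $\mathbf S$-model of $T$ and such that in every $\mathbf S$-model of $T$ each realization of $\Phi$ realizes $\Sigma$. $\mathcal L$ has the *$\kappa$-Omitting Types Property* if for every signature $\mathbf S$, every set $T$ of at most $\kappa$ $S$-sentences that has an $\mathbf S$-model, and every family of at most $\kappa$ types $\Sigma_j(\bar x)$ of $T$ (in a common finite tuple $\bar x$) that are not $\kappa$-principal over $T$, there is an $\mathbf S$-model of $T$ in which no $\Sigma_j$ is realized. **Theorem.** Let $\mathcal L$ be a $[0,1]$-valued logic that extends $\mathsf{CL}$ and satisfies: 1. *(Connectives and $\exists$.)* For $S$-sentences $\varphi,\psi$ there is an $S$-sentence with value $\varphi^M\to\psi^M$ in every $S$-structure $M$; for every vocabulary $S$ and every rational $r\in[0,1]$ there is an $S$-sentence with constant value $r$; for every $S$-formula $\varphi(x)$ there is an $S$-sentence with value $\sup_{a\in M}\varphi^M[a]$ in every $S$-structure $M$. 2. *(Finite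 occurrence.)* Every $S$-sentence is an $S_0$-sentence for some finite $S_0\subseteq S$. 3. *(Relativization to definable families of predicates.)* For every $S$-sentence $\varphi$ and binary predicate symbol $R\notin S$ there is an $S\cup\{R\}$-formula $\psi(x)$ such that, whenever $M$ is an $S\cup\{R\}$-structure in which $R^M$ takes only the values $0,1$ and, for every $a\in M$, the set $\{y\in M: R^M(a,y)=1\}$ is nonempty and closed under the operations in $S$, then for every $a\in M$ the value $\psi^M[a]$ equals the value of $\varphi$ in the $S$-substructure of $M$ with universe $\{y: R^M(a,y)=1\}$. 4. *(Completions.)* Every structure satisfies the same $\mathcal L$-sentences as its metric completion. If $\mathcal L$ has the $\kappa$-Omitting Types Property for some uncountable regular cardinal $\kappa$, then $\mathcal L$ is equivalent to $\mathsf{CL}$ for every signature $\mathbf S=(S,\mathcal U)$ with $|S|<\kappa$: $\tau_{\mathcal L}(\mathbf S)=\tau_{\mathsf{CL}}(\mathbf S)$. Consequently, for every signature $\mathbf S$, every $S$-sentence $\varphi$ of $\mathcal L$ is a uniform limit of sentences of $\mathsf{CL}$ over the class of $\mathbf S$-structures: for every $\epsilon>0$ there is an $S$-sentence $\psi$ of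 $\mathsf{CL}$ with $|\varphi^M-\psi^M|\le\epsilon$ for every $\mathbf S$-structure $M$. -/

import Mathlib

universe u

noncomputable section

namespace MetricLogic

open FirstOrder FirstOrder.Language Topology

/-! ## Metric structures -/

/-- A (one-sorted, `[0,1]`-valued) continuous metric structure for the vocabulary `S`: a nonempty
metric space of diameter at most one, with uniformly continuous operations and uniformly
continuous `[0,1]`-valued predicates (finite powers carry the supremum metric). -/
structure MetStr (S : FirstOrder.Language.{u, u}) : Type (u + 1) where
  carrier : Type u
  [metric : MetricSpace carrier]
  [nonempty : Nonempty carrier]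
  dist_le_one : ∀ a b : carrier, dist a b ≤ 1
  op : ∀ {n : ℕ}, S.Functions n → (Fin n → carrier) → carrier
  pred : ∀ {n : ℕ}, S.Relations n → (Fin n → carrier) → ℝ
  pred_mem : ∀ {n : ℕ} (R : S.Relations n) (a : Fin n → carrier), pred R a ∈ Set.Icc (0 : ℝ) 1
  uniformContinuous_op : ∀ {n : ℕ} (f : S.Functions n), UniformContinuous (op f)
  uniformContinuous_pred : ∀ {n : ℕ} (R : S.Relations n), UniformContinuous (pred R)

attribute [instance] MetStr.metric MetStr.nonempty

instance (S : FirstOrder.Language.{u, u}) : CoeSort (MetStr S) (Type u) := ⟨MetStr.carrier⟩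

variable {S S' : FirstOrder.Language.{u, u}}

namespace MetStr

/-- The reduct of an `S'`-structure along a map of vocabularies. For an injective map this is the
usual reduct to a subvocabulary, up to renaming of the symbols. -/
def reduct (M : MetStr S') (i : S →ᴸ S') : MetStr S where
  carrier := M
  dist_le_one := M.dist_le_one
  op f := M.op (i.onFunction f)
  pred R := M.pred (i.onRelation R)
  pred_mem R := M.pred_mem (i.onRelation R)
  uniformContinuous_op f := M.uniformContinuous_op (i.onFunction f)
  uniformContinuous_pred R := M.uniformContinuous_pred (i.onRelation R)

/-- Interpretation of the new constant symbols `α` by the elements `a`. -/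
def constOp {X α : Type*} (a : α → X) : ∀ {n : ℕ}, (constantsOn α).Functions n → (Fin n → X) → X
  | 0, c, _ => a c
  | _ + 1, c, _ => PEmpty.elim c

/-- The expansion `(M, a)` of `M` to the vocabulary `S ∪ {x̄}`, where the new constant symbols `x̄`
(indexed by `α`) are interpreted by the tuple `a`. -/
def expand (M : MetStr S) {α : Type} (a : α → M) : MetStr (S[[α]]) where
  carrier := M
  dist_le_one := M.dist_le_one
  op f v := Sum.elim (fun g => M.op g v) (fun c => constOp a c v) f
  pred R v := Sum.elim (fun Q => M.pred Q v) (fun e => Empty.elim e) R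
  pred_mem R v := by
    rcases R with R | e
    · exact M.pred_mem R v
    · exact Empty.elim e
  uniformContinuous_op {n} f := by
    rcases f with f | c
    · exact M.uniformContinuous_op f
    · cases n with
      | zero => exact uniformContinuous_const
      | succ n => exact PEmpty.elim c
  uniformContinuous_pred R := by
    rcases R with R | e
    · exact M.uniformContinuous_pred R
    · exact Empty.elim e

/-- `A` is closed under the operations of `M`. -/
def ClosedUnderOps (M : MetStr S) (A : Set M) : Prop :=
  ∀ {n : ℕ} (f : S.Functions n) (a : Fin n → M), (∀ i, a i ∈ A) → M.op f a ∈ A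

/-- The substructure of `M` with universe `A`. -/
def restrict (M : MetStr S) (A : Set M) (hne : A.Nonempty) (hA : M.ClosedUnderOps A) :
    MetStr S where
  carrier := A
  nonempty := hne.to_subtype
  dist_le_one a b := M.dist_le_one a b
  op f a := ⟨M.op f (fun i => (a i : M)), hA f _ (fun i => (a i).2)⟩
  pred R a := M.pred R (fun i => (a i : M))
  pred_mem R a := M.pred_mem R _
  uniformContinuous_op f := by
    refine UniformContinuous.subtype_mk ?_ _
    exact (M.uniformContinuous_op f).comp
      (uniformContinuous_pi.2 fun i => uniformContinuous_subtype_val.comp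
        (Pi.uniformContinuous_proj (fun _ => A) i))
  uniformContinuous_pred R := by
    exact (M.uniformContinuous_pred R).comp
      (uniformContinuous_pi.2 fun i => uniformContinuous_subtype_val.comp
        (Pi.uniformContinuous_proj (fun _ => A) i))

/-- `M` and `N` are metrically isomorphic. -/
def Isomorphic (M N : MetStr S) : Prop :=
  ∃ T : M ≃ᵢ N,
    (∀ {n : ℕ} (f : S.Functions n) (a : Fin n → M), T (M.op f a) = N.op f (fun i => T (a i))) ∧
    (∀ {n : ℕ} (R : S.Relations n) (a : Fin n → M), M.pred R a = N.pred R (fun i => T (a i)))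

/-- `N` is (a copy of) the metric completion of `M`: a complete structure in which `M` embeds
isometrically as a dense substructure. -/
def IsCompletion (M N : MetStr S) : Prop :=
  CompleteSpace N ∧ ∃ e : M → N, Isometry e ∧ DenseRange e ∧
    (∀ {n : ℕ} (f : S.Functions n) (a : Fin n → M), e (M.op f a) = N.op f (fun i => e (a i))) ∧
    (∀ {n : ℕ} (R : S.Relations n) (a : Fin n → M), M.pred R a = N.pred R (fun i => e (a i)))

/-- Interpretation of terms, with the variables interpreted by `v`. -/
def termVal (M : MetStr S) {α : Type} (v : α → M) : S.Term α → M
  | .var x => v x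
  | .func f ts => M.op f (fun i => M.termVal v (ts i))

end MetStr

/-! ## Abstract `[0,1]`-valued logics -/

/-- A `[0,1]`-valued logic. Monotonicity in the vocabulary with the reduct property, and the
renaming property, are together expressed by `map` and `val_map`: an injective map of vocabularies
is a renaming followed by an inclusion. -/
structure ValuedLogic : Type (u + 1) where
  /-- the set of `S`-sentences -/
  Sent : FirstOrder.Language.{u, u} → Type u
  /-- the truth value of a sentence in a structure -/
  val : ∀ {S : FirstOrder.Language.{u, u}}, Sent S → MetStr S → ℝ
  val_mem : ∀ {S : FirstOrder.Language.{u, u}} (φ : Sent S) (M : MetStr S), val φ M ∈ Set.Icc (0 : ℝ) 1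
  val_iso : ∀ {S : FirstOrder.Language.{u, u}} (φ : Sent S) (M N : MetStr S),
    M.Isomorphic N → val φ M = val φ N
  map : ∀ {S S' : FirstOrder.Language.{u, u}} (i : S →ᴸ S'), i.Injective → Sent S → Sent S'
  val_map : ∀ {S S' : FirstOrder.Language.{u, u}} (i : S →ᴸ S') (hi : i.Injective) (φ : Sent S)
    (M : MetStr S'), val (map i hi φ) M = val φ (M.reduct i)

/-- The Łukasiewicz implication. -/
def lukImp (x y : ℝ) : ℝ := min (1 - x + y) 1

/-- A vocabulary consisting of a single binary predicate symbol. -/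
inductive BinRelSymb : ℕ → Type
  | rel : BinRelSymb 2

/-- A vocabulary consisting of a single binary predicate symbol. -/
def binRel : FirstOrder.Language.{0, 0} := ⟨fun _ => Empty, BinRelSymb⟩

/-- The interpretation of the new binary predicate symbol `R` in an `S ∪ {R}`-structure. -/
def binVal (M : MetStr (S.sum binRel)) (a b : M) : ℝ :=
  M.pred (n := 2) (Sum.inr BinRelSymb.rel) ![a, b]

/-- The set `{y | R(a, y)}`. -/
def fiber (M : MetStr (S.sum binRel)) (a : M) : Set M := {b | binVal M a b = 1}

namespace ValuedLogic

variable (L : ValuedLogic.{u})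

/-- `M` satisfies `φ`. -/
def Holds (M : MetStr S) (φ : L.Sent S) : Prop := L.val φ M = 1

/-- `M` is a model of the theory `T`. -/
def Models (M : MetStr S) (T : Set (L.Sent S)) : Prop := ∀ φ ∈ T, L.Holds M φ

/-- `M` and `N` satisfy the same sentences. -/
def Equivalent (M N : MetStr S) : Prop := ∀ φ : L.Sent S, L.Holds M φ ↔ L.Holds N φ

/-- The atomic sentences `R(t₁, …, tₙ)` and `d(t₁, t₂)`, for closed terms `tᵢ`, belong to the
logic. Since formulas `φ(x̄)` are sentences in a vocabulary with new constant symbols `x̄`, this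
covers all atomic formulas. -/
def HasAtomicSentences : Prop :=
  ∀ S : FirstOrder.Language.{u, u},
    (∀ {n : ℕ} (R : S.Relations n) (t : Fin n → S.Term Empty), ∃ φ : L.Sent S,
      ∀ M : MetStr S, L.val φ M = M.pred R (fun i => M.termVal Empty.elim (t i))) ∧
    (∀ t₁ t₂ : S.Term Empty, ∃ φ : L.Sent S,
      ∀ M : MetStr S, L.val φ M = dist (M.termVal Empty.elim t₁) (M.termVal Empty.elim t₂))

/-- Closure under the Łukasiewicz implication and the rational constants. -/
def ClosedUnderBasicConnectives : Prop :=
  ∀ S : FirstOrder.Language.{u, u},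
    (∀ φ ψ : L.Sent S, ∃ χ : L.Sent S,
      ∀ M : MetStr S, L.val χ M = lukImp (L.val φ M) (L.val ψ M)) ∧
    (∀ r : ℚ, 0 ≤ r → r ≤ 1 → ∃ χ : L.Sent S, ∀ M : MetStr S, L.val χ M = (r : ℝ))

/-- Closure under the existential quantifier. -/
def ClosedUnderExists : Prop :=
  ∀ (S : FirstOrder.Language.{u, u}) (φ : L.Sent (S[[Fin 1]])), ∃ ψ : L.Sent S, ∀ M : MetStr S,
    IsLUB (Set.range fun a : M => L.val φ (M.expand fun _ : Fin 1 => a)) (L.val ψ M)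

/-- The finite occurrence property: every sentence is a sentence of a finite subvocabulary. -/
def FiniteOccurrence : Prop :=
  ∀ (S : FirstOrder.Language.{u, u}) (φ : L.Sent S), ∃ (S₀ : FirstOrder.Language.{u, u}) (i : S₀ →ᴸ S) (φ₀ : L.Sent S₀),
    Finite S₀.Symbols ∧ i.Injective ∧ ∀ M : MetStr S, L.val φ M = L.val φ₀ (M.reduct i)

/-- Relativization to definable families of (discrete) predicates: for every `S`-sentence `φ` there
is an `S ∪ {R}`-formula `ψ(x)` which, in every structure where the sets `{y | R(a, y)}` are given by
discrete predicates and are universes of `S`-structures, has at `a` the truth value of `φ` in the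
`S`-structure with universe `{y | R(a, y)}`. -/
def PermitsRelativization : Prop :=
  ∀ (S : FirstOrder.Language.{u, u}) (φ : L.Sent S), ∃ ψ : L.Sent ((S.sum binRel)[[Fin 1]]),
    ∀ M : MetStr (S.sum binRel), (∀ a b : M, binVal M a b = 0 ∨ binVal M a b = 1) →
      ∀ (hne : ∀ a : M, (fiber M a).Nonempty)
        (hcl : ∀ a : M, (M.reduct (LHom.sumInl : S →ᴸ S.sum binRel)).ClosedUnderOps (fiber M a)),
        ∀ a : M, L.val ψ (M.expand fun _ : Fin 1 => a) =
          L.val φ ((M.reduct (LHom.sumInl : S →ᴸ S.sum binRel)).restrict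
            (fiber M a) (hne a) (hcl a))

/-- Every structure is equivalent to its metric completion. -/
def EquivalentToCompletions : Prop :=
  ∀ (S : FirstOrder.Language.{u, u}) (M N : MetStr S), M.IsCompletion N → L.Equivalent M N

end ValuedLogic

/-! ## Signatures -/

/-- A signature: a vocabulary with a modulus of uniform continuity for each symbol. -/
structure Signature : Type (u + 1) where
  lang : FirstOrder.Language.{u, u}
  opMod : ∀ {n : ℕ}, lang.Functions n → Set.Ioo (0 : ℚ) 1 → Set.Ioo (0 : ℚ) 1
  predMod : ∀ {n : ℕ}, lang.Relations n → Set.Ioo (0 : ℚ) 1 → Set.Ioo (0 : ℚ) 1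

/-- The structure `M` respects the moduli of the signature `Sg`. -/
def Signature.IsStr (Sg : Signature.{u}) (M : MetStr Sg.lang) : Prop :=
  (∀ {n : ℕ} (f : Sg.lang.Functions n) (ε : Set.Ioo (0 : ℚ) 1) (a b : Fin n → M),
    (∀ i, dist (a i) (b i) < ((Sg.opMod f ε : ℚ) : ℝ)) →
      dist (M.op f a) (M.op f b) ≤ ((ε : ℚ) : ℝ)) ∧
  (∀ {n : ℕ} (R : Sg.lang.Relations n) (ε : Set.Ioo (0 : ℚ) 1) (a b : Fin n → M),
    (∀ i, dist (a i) (b i) < ((Sg.predMod R ε : ℚ) : ℝ)) →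
      |M.pred R a - M.pred R b| ≤ ((ε : ℚ) : ℝ))

/-- The class of structures of the signature `Sg`. -/
def Signature.Str (Sg : Signature.{u}) : Type (u + 1) := {M : MetStr Sg.lang // Sg.IsStr M}

namespace ValuedLogic

variable (L : ValuedLogic.{u})

/-! ## Types and the omitting types property -/

/-- The tuple `a` realizes the set of formulas `Γ(x̄)` in `M`. -/
def Realizes {n : ℕ} (M : MetStr S) (a : Fin n → M) (Γ : Set (L.Sent (S[[Fin n]]))) : Prop :=
  ∀ γ ∈ Γ, L.Holds (M.expand a) γ

/-- `Γ(x̄)` is realized in some `Sg`-structure that is a model of `T`. -/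
def Consistent (Sg : Signature.{u}) {n : ℕ} (T : Set (L.Sent Sg.lang))
    (Γ : Set (L.Sent (Sg.lang[[Fin n]]))) : Prop :=
  ∃ M : Sg.Str, L.Models M.1 T ∧ ∃ a : Fin n → M.1, L.Realizes M.1 a Γ

/-- `Φ(x̄)` generates `Γ(x̄)` over `T`. -/
def Generates (Sg : Signature.{u}) {n : ℕ} (T : Set (L.Sent Sg.lang))
    (Φ Γ : Set (L.Sent (Sg.lang[[Fin n]]))) : Prop :=
  L.Consistent Sg T Φ ∧
    ∀ M : Sg.Str, L.Models M.1 T → ∀ a : Fin n → M.1, L.Realizes M.1 a Φ → L.Realizes M.1 a Γ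

/-- `Γ(x̄)` is `κ`-principal over `T` (for uncountable `κ`). -/
def IsPrincipal (κ : Cardinal.{u}) (Sg : Signature.{u}) {n : ℕ} (T : Set (L.Sent Sg.lang))
    (Γ : Set (L.Sent (Sg.lang[[Fin n]]))) : Prop :=
  ∃ Φ : Set (L.Sent (Sg.lang[[Fin n]])), Cardinal.mk Φ < κ ∧ L.Generates Sg T Φ Γ

/-- The `κ`-Omitting Types Property (for uncountable `κ`). -/
def OmittingTypesProperty (κ : Cardinal.{u}) : Prop :=
  ∀ (Sg : Signature.{u}) (T : Set (L.Sent Sg.lang)), Cardinal.mk T ≤ κ →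
    (∃ M : Sg.Str, L.Models M.1 T) →
    ∀ (n : ℕ) (J : Type u) (Γ : J → Set (L.Sent (Sg.lang[[Fin n]]))), Cardinal.mk J ≤ κ →
      (∀ j, L.Consistent Sg T (Γ j)) → (∀ j, ¬ L.IsPrincipal κ Sg T (Γ j)) →
        ∃ M : Sg.Str, L.Models M.1 T ∧ ∀ j, ¬ ∃ a : Fin n → M.1, L.Realizes M.1 a (Γ j)

/-! ## The logical topology -/

/-- The class of models of `T` among the `Sg`-structures. -/
def Mod (Sg : Signature.{u}) (T : Set (L.Sent Sg.lang)) : Set Sg.Str := {M | L.Models M.1 T}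

/-- The logical topology on the class of `Sg`-structures: the coarsest topology in which the classes
of models of theories are closed. For a logic closed under the basic connectives there are no other
closed classes, see `isClosed_iff`. -/
@[reducible]
def logicalTopology (Sg : Signature.{u}) : TopologicalSpace Sg.Str :=
  TopologicalSpace.generateFrom {U | ∃ T : Set (L.Sent Sg.lang), U = (L.Mod Sg T)ᶜ}

variable {L}

theorem lukImp_or {x y : ℝ} (hx : x ≤ 1) (hy : y ≤ 1) : lukImp (lukImp x y) y = max x y := by
  unfold lukImp
  rcases le_total x y with h | h
  · rw [max_eq_right h, min_eq_right (by linarith : (1 : ℝ) ≤ 1 - x + y)]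
    rw [min_eq_left (by linarith)]; ring
  · rw [max_eq_left h, min_eq_left (by linarith : 1 - x + y ≤ 1)]
    rw [min_eq_left (by linarith)]; ring

theorem isClosed_iff (h : L.ClosedUnderBasicConnectives) (Sg : Signature.{u}) (K : Set Sg.Str) :
    IsClosed[L.logicalTopology Sg] K ↔ ∃ T : Set (L.Sent Sg.lang), K = L.Mod Sg T := by
  let := L.logicalTopology Sg
  constructor
  · intro hK
    have key : ∀ U : Set Sg.Str, TopologicalSpace.GenerateOpen
        {U | ∃ T : Set (L.Sent Sg.lang), U = (L.Mod Sg T)ᶜ} U →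
        ∃ T : Set (L.Sent Sg.lang), Uᶜ = L.Mod Sg T := by
      intro U hU
      induction hU with
      | basic U hU =>
        obtain ⟨T, rfl⟩ := hU
        exact ⟨T, compl_compl _⟩
      | univ =>
        obtain ⟨χ, hχ⟩ := (h Sg.lang).2 0 le_rfl zero_le_one
        refine ⟨{χ}, ?_⟩
        ext M
        simp [Mod, Models, Holds, hχ]
      | inter U V _ _ ihU ihV =>
        obtain ⟨T₁, h₁⟩ := ihU
        obtain ⟨T₂, h₂⟩ := ihV
        refine ⟨{χ | ∃ φ ∈ T₁, ∃ ψ ∈ T₂, ∀ M : MetStr Sg.lang,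
          L.val χ M = max (L.val φ M) (L.val ψ M)}, ?_⟩
        rw [Set.compl_inter, h₁, h₂]
        ext M
        constructor
        · rintro (hM | hM) χ ⟨φ, hφ, ψ, hψ, hχ⟩
          · have h1 : L.val φ M.1 = 1 := hM φ hφ
            change L.val χ M.1 = 1
            rw [hχ, h1, max_eq_left (L.val_mem ψ M.1).2]
          · have h1 : L.val ψ M.1 = 1 := hM ψ hψ
            change L.val χ M.1 = 1
            rw [hχ, h1, max_eq_right (L.val_mem φ M.1).2]
        · intro hM
          by_contra hcon
          simp only [Set.mem_union, not_or, Mod, Models, Set.mem_ofPred_eq] at hcon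
          obtain ⟨hc₁, hc₂⟩ := hcon
          push Not at hc₁ hc₂
          obtain ⟨φ, hφ, hφM⟩ := hc₁
          obtain ⟨ψ, hψ, hψM⟩ := hc₂
          obtain ⟨χ₁, hχ₁⟩ := (h Sg.lang).1 φ ψ
          obtain ⟨χ, hχ⟩ := (h Sg.lang).1 χ₁ ψ
          have hmax : ∀ N : MetStr Sg.lang, L.val χ N = max (L.val φ N) (L.val ψ N) := by
            intro N
            rw [hχ, hχ₁, lukImp_or (L.val_mem φ N).2 (L.val_mem ψ N).2]
          have h1 : L.val χ M.1 = 1 := hM χ ⟨φ, hφ, ψ, hψ, hmax⟩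
          rw [hmax] at h1
          rcases max_choice (L.val φ M.1) (L.val ψ M.1) with h2 | h2
          · exact hφM (h2.symm.trans h1)
          · exact hψM (h2.symm.trans h1)
      | sUnion A _ ih =>
        choose T hT using ih
        refine ⟨{φ | ∃ (U : Set Sg.Str) (hU : U ∈ A), φ ∈ T U hU}, ?_⟩
        ext M
        constructor
        · rintro hM φ ⟨U, hU, hφ⟩
          have : M ∈ Uᶜ := fun hMU => hM ⟨U, hU, hMU⟩
          rw [hT U hU] at this
          exact this φ hφ
        · rintro hM ⟨U, hU, hMU⟩
          have : M ∈ Uᶜ := by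
            rw [hT U hU]
            exact fun φ hφ => hM φ ⟨U, hU, hφ⟩
          exact this hMU
    obtain ⟨T, hT⟩ := key Kᶜ hK.isOpen_compl
    exact ⟨T, by rw [← hT, compl_compl]⟩
  · rintro ⟨T, rfl⟩
    exact ⟨TopologicalSpace.GenerateOpen.basic _ ⟨T, rfl⟩⟩

/-- `L'` extends `L`: for every signature, the logical topology of `L` is contained in that
of `L'`. -/
def Extends (L' L : ValuedLogic.{u}) : Prop :=
  ∀ (Sg : Signature.{u}) (U : Set Sg.Str),
    IsOpen[L.logicalTopology Sg] U → IsOpen[L'.logicalTopology Sg] U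

end ValuedLogic

/-! ## Basic continuous logic -/

/-- Formulas of basic continuous logic with free variables among `x₀, …, xₙ₋₁`; `ex` binds the
variable `xₙ`. -/
inductive Formula (S : FirstOrder.Language.{u, u}) : ℕ → Type u
  | rel {n k : ℕ} (R : S.Relations k) (t : Fin k → S.Term (Fin n)) : Formula S n
  | eqd {n : ℕ} (t₁ t₂ : S.Term (Fin n)) : Formula S n
  | const {n : ℕ} (r : ℚ) (h₀ : 0 ≤ r) (h₁ : r ≤ 1) : Formula S n
  | imp {n : ℕ} (φ ψ : Formula S n) : Formula S n
  | ex {n : ℕ} (φ : Formula S (n + 1)) : Formula S n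

namespace Formula

/-- The truth value of a formula at a tuple. -/
def val (M : MetStr S) : ∀ {n : ℕ}, Formula S n → (Fin n → M) → ℝ
  | _, .rel R t, v => M.pred R (fun i => M.termVal v (t i))
  | _, .eqd t₁ t₂, v => dist (M.termVal v t₁) (M.termVal v t₂)
  | _, .const r _ _, _ => (r : ℝ)
  | _, .imp φ ψ, v => lukImp (φ.val M v) (ψ.val M v)
  | _, .ex φ, v => ⨆ a : M, φ.val M (Fin.snoc v a)

/-- Translation of formulas along a map of vocabularies. -/
def map (i : S →ᴸ S') : ∀ {n : ℕ}, Formula S n → Formula S' n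
  | _, .rel R t => .rel (i.onRelation R) (fun j => i.onTerm (t j))
  | _, .eqd t₁ t₂ => .eqd (i.onTerm t₁) (i.onTerm t₂)
  | _, .const r h₀ h₁ => .const r h₀ h₁
  | _, .imp φ ψ => .imp (φ.map i) (ψ.map i)
  | _, .ex φ => .ex (φ.map i)

theorem val_mem (M : MetStr S) {n : ℕ} (φ : Formula S n) (v : Fin n → M) :
    φ.val M v ∈ Set.Icc (0 : ℝ) 1 := by
  induction φ with
  | rel R t => exact M.pred_mem _ _
  | eqd t₁ t₂ => exact ⟨dist_nonneg, M.dist_le_one _ _⟩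
  | const r h₀ h₁ =>
    change (r : ℝ) ∈ Set.Icc (0 : ℝ) 1
    exact ⟨by exact_mod_cast h₀, by exact_mod_cast h₁⟩
  | imp φ ψ ih₁ ih₂ =>
    have h1 := ih₁ v
    have h2 := ih₂ v
    exact ⟨le_min (by linarith [h1.2, h2.1]) zero_le_one, min_le_right _ _⟩
  | ex φ ih =>
    exact ⟨Real.iSup_nonneg fun a => (ih _).1, ciSup_le fun a => (ih _).2⟩

theorem termVal_onTerm (i : S →ᴸ S') (M : MetStr S') {α : Type} (v : α → M) (t : S.Term α) :
    M.termVal v (i.onTerm t) = (M.reduct i).termVal v t := by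
  induction t with
  | var x => rfl
  | func f ts ih =>
    change M.op _ _ = M.op _ _
    congr 1
    funext j
    exact ih j

theorem val_map (i : S →ᴸ S') (M : MetStr S') {n : ℕ} (φ : Formula S n) (v : Fin n → M) :
    (φ.map i).val M v = φ.val (M.reduct i) v := by
  induction φ with
  | rel R t =>
    change M.pred _ _ = M.pred _ _
    congr 1
    funext j
    exact termVal_onTerm i M v (t j)
  | eqd t₁ t₂ =>
    change dist _ _ = dist (α := M) _ _
    rw [termVal_onTerm, termVal_onTerm]
  | const r h₀ h₁ => rfl
  | imp φ ψ ih₁ ih₂ =>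
    change lukImp _ _ = lukImp _ _
    rw [ih₁, ih₂]
  | ex φ ih =>
    change (⨆ a : M, _) = ⨆ a : M, _
    exact congrArg _ (funext fun a => ih _)

theorem val_iso {M N : MetStr S} (T : M ≃ᵢ N)
    (hop : ∀ {n : ℕ} (f : S.Functions n) (a : Fin n → M),
      T (M.op f a) = N.op f (fun i => T (a i)))
    (hpred : ∀ {n : ℕ} (R : S.Relations n) (a : Fin n → M),
      M.pred R a = N.pred R (fun i => T (a i)))
    {n : ℕ} (φ : Formula S n) (v : Fin n → M) :
    φ.val M v = φ.val N (fun i => T (v i)) := by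
  have hterm : ∀ {n : ℕ} (v : Fin n → M) (t : S.Term (Fin n)),
      T (M.termVal v t) = N.termVal (fun i => T (v i)) t := by
    intro n v t
    induction t with
    | var x => rfl
    | func f ts ih =>
      change T (M.op _ _) = N.op _ _
      rw [hop]
      congr 1
      funext j
      exact ih j
  induction φ with
  | rel R t =>
    change M.pred _ _ = N.pred _ _
    rw [hpred]
    congr 1
    funext j
    exact hterm v (t j)
  | eqd t₁ t₂ =>
    change dist _ _ = dist _ _
    rw [← hterm, ← hterm, T.dist_eq]
  | const r h₀ h₁ => rfl
  | imp φ ψ ih₁ ih₂ =>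
    change lukImp _ _ = lukImp _ _
    rw [ih₁, ih₂]
  | ex φ ih =>
    change (⨆ a : M, _) = ⨆ a : N, _
    refine T.surjective.iSup_congr T fun a => ?_
    rw [ih]
    congr 1
    funext j
    refine Fin.lastCases ?_ (fun j => ?_) j
    · simp
    · simp

end Formula

/-- Basic continuous logic. -/
def cl : ValuedLogic.{u} where
  Sent S := Formula S 0
  val φ M := φ.val M Fin.elim0
  val_mem φ M := φ.val_mem M _
  val_iso φ M N h := by
    obtain ⟨T, hop, hpred⟩ := h
    refine (Formula.val_iso T hop hpred φ _).trans ?_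
    congr 1
    exact Subsingleton.elim _ _
  map i _ φ := φ.map i
  val_map i _ φ M := φ.val_map i M _

end MetricLogic

end

/-!
The theorem comes down to uniform approximation: if every sentence `φ` of the logic is a uniform
limit of sentences of basic continuous logic over the structures of any signature, then the models
of `φ` are the models of a theory of basic continuous logic (`OmittingLogic.logicalTopology_eq`). By
finite occurrence one may assume that the vocabulary `S` is finite (`OmittingLogic.exists_approx`),
and then it suffices to separate `φ ≥ s` from `φ ≤ r`, for rationals `r < s`, by the values of
finitely many sentences of basic continuous logic (`OmittingLogic.exists_finite_separation`).

Suppose that this is impossible. Structures that almost agree on finitely many suitable sentences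
are indistinguishable in the back-and-forth game of a given finite length and precision
(`Formula.exists_finite_win`). Hence for each `k` there are structures `M_k`, `N_k` with
`φ ≥ s` in `M_k` and `φ ≤ r` in `N_k` such that the second player survives `k + 1` rounds with
precision `1 / (k + 1)`. All these structures together with the positions of the games form a single
structure `𝔐` (`exists_isSystem`), in which relativization of sentences to definable families allows
one to speak about truth in the `M_k` and `N_k`.

The omitting types property serves twice as a substitute for compactness and for the construction of
generic objects, by way of `exists_generic_chain_null`: if in every model of a countable theory the
elements of a definable ordering have extensions that meet countably many requirements, for all
parameters, then there is a model with a chain of length `κ` that meets all of them. As `κ` is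
regular and uncountable, countably many requirements are met below a single element of the chain.
One application gives a structure like `𝔐` in which infinitely many rounds can be played from some
position (`exists_infinite_rank`). In another one, the chain is a generic play of the game: it
consists of positions for the same two structures `A`, `B`, with `φ ≥ s` in `A` and `φ ≤ r` in `B`,
and the moves before them are dense in `A` and in `B`. Since the precision is now infinite, these
dense subsets agree on all atomic formulas, so `A` and `B` have the same completion
(`IsSystem.exists_common_completion`). But every structure is equivalent to its completion,
which yields the contradictory values `φ ≥ s` and `φ ≤ r` in a single structure
(`OmittingLogic.exists_common_model`).

Constants and nullary predicates have to be treated separately, as they cannot vary within a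
family of substructures of one structure. Constants are replaced by unary operations that are
constant on each substructure; to recover the sentence about the constants, one needs that the
condition `φ[x̄] = 1` is closed under limits of the tuple `x̄`, which is again a consequence of
the omitting types property (`OmittingLogic.eq_one_of_approx`). The truth values of nullary
predicates are part of the entries of the first chain.
-/

noncomputable section

namespace MetricLogic

open FirstOrder FirstOrder.Language Topology

/-! ### Families of truth functions closed under the Łukasiewicz connectives -/

/-- A family of `[0,1]`-valued functions on `X` closed under the basic connectives. -/
structure LukClosed {X : Type*} (𝓕 : (X → ℝ) → Prop) : Prop where
  mem_Icc : ∀ {F}, 𝓕 F → ∀ x, F x ∈ Set.Icc (0 : ℝ) 1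
  const : ∀ r : ℚ, 0 ≤ r → r ≤ 1 → 𝓕 fun _ => (r : ℝ)
  imp : ∀ {F G}, 𝓕 F → 𝓕 G → 𝓕 fun x => lukImp (F x) (G x)

namespace LukClosed

variable {X : Type*} {𝓕 : (X → ℝ) → Prop} {F G : X → ℝ}

theorem zero (h : LukClosed 𝓕) : 𝓕 fun _ => 0 := by simpa using h.const 0 le_rfl zero_le_one

theorem one (h : LukClosed 𝓕) : 𝓕 fun _ => 1 := by simpa using h.const 1 zero_le_one le_rfl

theorem compl (h : LukClosed 𝓕) (hF : 𝓕 F) : 𝓕 fun x => 1 - F x := by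
  convert h.imp hF h.zero using 2 with x
  have := h.mem_Icc hF x
  rw [lukImp, min_eq_left] <;> linarith [this.1]

theorem sup (h : LukClosed 𝓕) (hF : 𝓕 F) (hG : 𝓕 G) : 𝓕 fun x => max (F x) (G x) := by
  convert h.imp (h.imp hF hG) hG using 2 with x
  exact (ValuedLogic.lukImp_or (h.mem_Icc hF x).2 (h.mem_Icc hG x).2).symm

theorem inf (h : LukClosed 𝓕) (hF : 𝓕 F) (hG : 𝓕 G) : 𝓕 fun x => min (F x) (G x) := by
  convert h.compl (h.sup (h.compl hF) (h.compl hG)) using 2 with x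
  rcases le_total (F x) (G x) with h' | h'
  · rw [min_eq_left h', max_eq_left (by linarith)]; ring
  · rw [min_eq_right h', max_eq_right (by linarith)]; ring

theorem truncAdd (h : LukClosed 𝓕) (hF : 𝓕 F) (hG : 𝓕 G) : 𝓕 fun x => min (F x + G x) 1 := by
  convert h.imp (h.compl hF) hG using 2 with x
  rw [lukImp]; congr 1; ring

theorem truncSub (h : LukClosed 𝓕) (hF : 𝓕 F) (hG : 𝓕 G) : 𝓕 fun x => max (F x - G x) 0 := by
  convert h.compl (h.imp hF hG) using 2 with x
  rw [lukImp]
  rcases le_total (F x) (G x) with h' | h'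
  · rw [max_eq_right (by linarith), min_eq_right (by linarith)]; ring
  · rw [max_eq_left (by linarith), min_eq_left (by linarith)]; ring

theorem absSub (h : LukClosed 𝓕) (hF : 𝓕 F) (hG : 𝓕 G) : 𝓕 fun x => |F x - G x| := by
  convert h.sup (h.truncSub hF hG) (h.truncSub hG hF) using 2 with x
  rcases le_total (F x) (G x) with h' | h'
  · rw [abs_of_nonpos (by linarith), max_eq_right (a := F x - G x) (by linarith),
      max_eq_left (a := G x - F x) (by linarith), max_eq_right (by linarith)]; ring
  · rw [abs_of_nonneg (by linarith), max_eq_left (a := F x - G x) (by linarith),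
      max_eq_right (a := G x - F x) (by linarith), max_eq_left (by linarith)]

theorem truncMul (h : LukClosed 𝓕) (hF : 𝓕 F) (n : ℕ) : 𝓕 fun x => min (n * F x) 1 := by
  induction n with
  | zero => simpa using h.zero
  | succ n ih =>
    convert h.truncAdd ih hF using 2 with x
    have := (h.mem_Icc hF x).1
    push_cast
    rcases le_total ((n : ℝ) * F x) 1 with h' | h'
    · rw [min_eq_left h']; congr 1; ring
    · rw [min_eq_right h', min_eq_right (by linarith), min_eq_right (by linarith)]

/-- A finite maximum, characterized by its upper bounds (it is `0` for the empty family). -/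
theorem exists_finite_max (h : LukClosed 𝓕) {ι : Type*} [Finite ι] (F : ι → X → ℝ)
    (hF : ∀ i, 𝓕 (F i)) :
    ∃ G, 𝓕 G ∧ ∀ x (r : ℝ), 0 ≤ r → (G x ≤ r ↔ ∀ i, F i x ≤ r) := by
  classical
  have key : ∀ s : Set ι, s.Finite →
      ∃ G, 𝓕 G ∧ ∀ x (r : ℝ), 0 ≤ r → (G x ≤ r ↔ ∀ i ∈ s, F i x ≤ r) := by
    intro s hs
    induction s, hs using Set.Finite.induction_on with
    | empty => exact ⟨_, h.zero, fun x r hr => by simpa using hr⟩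
    | insert _ _ ih =>
      rename_i i t _ _
      obtain ⟨G, hG, hGr⟩ := ih
      refine ⟨_, h.sup (hF i) hG, fun x r hr => ?_⟩
      rw [Set.forall_mem_insert, max_le_iff, hGr x r hr]
  obtain ⟨G, hG, hGr⟩ := key Set.univ Set.finite_univ
  exact ⟨G, hG, fun x r hr => by simpa using hGr x r hr⟩

end LukClosed

theorem lukImp_eq_one_iff {x y : ℝ} : lukImp x y = 1 ↔ x ≤ y := by
  rw [lukImp, min_eq_right_iff]
  constructor <;> intro h <;> linarith

/-! ### Expansions by constants and changes of vocabulary -/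

variable {S S' : FirstOrder.Language.{u, u}}

theorem ValuedLogic.val_congr (L : ValuedLogic.{u}) (φ : L.Sent S) {M N : MetStr S} (e : M ≃ᵢ N)
    (hop : ∀ {n : ℕ} (f : S.Functions n) (a : Fin n → M), e (M.op f a) = N.op f fun i => e (a i))
    (hpred : ∀ {n : ℕ} (R : S.Relations n) (a : Fin n → M),
      M.pred R a = N.pred R fun i => e (a i)) : L.val φ M = L.val φ N :=
  L.val_iso φ M N ⟨e, hop, hpred⟩

theorem injective_id : (LHom.id S).Injective where
  onFunction h := h
  onRelation h := h

theorem injective_comp {S'' : FirstOrder.Language.{u, u}} {j : S' →ᴸ S''} {i : S →ᴸ S'}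
    (hj : j.Injective) (hi : i.Injective) : (j.comp i).Injective where
  onFunction h := hi.onFunction (hj.onFunction h)
  onRelation h := hi.onRelation (hj.onRelation h)

/-- The map of vocabularies on `S ∪ {x̄}` which is `i` on `S` and sends the new constants to
constants of the target. -/
def constLHom {α : Type*} (i : S →ᴸ S') (g : α → S'.Functions 0) : S[[α]] →ᴸ S' :=
  i.sumElim
    { onFunction := fun n => match n with
        | 0 => g
        | _ + 1 => PEmpty.elim
      onRelation := fun _ => Empty.elim }

theorem constLHom_injective {α : Type*} {i : S →ᴸ S'} {g : α → S'.Functions 0} (hi : i.Injective)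
    (hg : Function.Injective g) (hd : ∀ (f : S.Functions 0) a, i.onFunction f ≠ g a) :
    (constLHom i g).Injective where
  onFunction {n} := by
    rintro (f | f) (f' | f') h
    · exact congrArg Sum.inl (hi.onFunction h)
    · cases n with
      | zero => exact absurd h (hd f f')
      | succ n => exact PEmpty.elim f'
    · cases n with
      | zero => exact absurd h.symm (hd f' f)
      | succ n => exact PEmpty.elim f
    · cases n with
      | zero => exact congrArg Sum.inr (hg h)
      | succ n => exact PEmpty.elim f
  onRelation := by
    rintro n (f | f) (f' | f') h
    · exact congrArg Sum.inl (hi.onRelation h)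
    all_goals first | exact Empty.elim f | exact Empty.elim f'

/-- The constant symbol of `S ∪ {x̄}` for `a`. -/
abbrev newConst (S : FirstOrder.Language.{u, u}) {α : Type*} (a : α) : (S[[α]]).Functions 0 :=
  Sum.inr a

theorem newConst_injective {α : Type*} : Function.Injective (newConst S (α := α)) :=
  Sum.inr_injective

namespace MetStr

/-- The element named by a constant symbol. -/
def constVal (M : MetStr S) (c : S.Functions 0) : M := M.op c Fin.elim0

theorem op_eq_constVal (M : MetStr S) (c : S.Functions 0) (v : Fin 0 → M) :
    M.op c v = M.constVal c := congrArg _ (Subsingleton.elim _ _)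

end MetStr

theorem ValuedLogic.val_reduct_constLHom (L : ValuedLogic.{u}) {α : Type} (i : S →ᴸ S')
    (g : α → S'.Functions 0) (χ : L.Sent (S[[α]])) (N : MetStr S') :
    L.val χ (N.reduct (constLHom i g)) =
      L.val χ ((N.reduct i).expand fun a => N.constVal (g a)) := by
  refine L.val_congr χ (IsometryEquiv.refl N) ?_ ?_
  · rintro n (f | f) a
    · rfl
    · cases n with
      | zero => exact N.op_eq_constVal _ _
      | succ n => exact PEmpty.elim f
  · rintro n (f | f) a
    · rfl
    · exact Empty.elim f

/-! ### Definable truth functions -/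

/-- A pointed structure: a structure together with an assignment of the variables `α`. -/
abbrev Pt (S : FirstOrder.Language.{u, u}) (α : Type) : Type (u + 1) := Σ M : MetStr S, α → M

namespace ValuedLogic

/-- The closure properties of a logic that give it all the formulas of basic continuous logic. -/
structure HasBasic (L : ValuedLogic.{u}) : Prop where
  atom : L.HasAtomicSentences
  conn : L.ClosedUnderBasicConnectives
  ex : L.ClosedUnderExists

variable (L : ValuedLogic.{u})

/-- The truth functions `(M, v) ↦ φ^M[v]` of the formulas `φ(x̄)` of `L`. -/
def Definable {α : Type} (F : Pt S α → ℝ) : Prop :=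
  ∃ χ : L.Sent (S[[α]]), ∀ p : Pt S α, L.val χ (p.1.expand p.2) = F p

variable {L}

theorem HasBasic.lukClosed (hL : L.HasBasic) {α : Type} :
    LukClosed (L.Definable (S := S) (α := α)) where
  mem_Icc := by
    rintro F ⟨χ, hχ⟩ x
    exact hχ x ▸ L.val_mem _ _
  const r h0 h1 := by
    obtain ⟨χ, hχ⟩ := (hL.conn (S[[α]])).2 r h0 h1
    exact ⟨χ, fun p => hχ _⟩
  imp := by
    rintro F G ⟨χ, hχ⟩ ⟨χ', hχ'⟩
    obtain ⟨χ'', h⟩ := (hL.conn (S[[α]])).1 χ χ'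
    exact ⟨χ'', fun p => by rw [h, hχ, hχ']⟩

theorem Definable.congr {α : Type} {F G : Pt S α → ℝ} (hF : L.Definable F) (h : ∀ p, F p = G p) :
    L.Definable G := by rwa [← funext h]

/-- Variables may be renamed and the vocabulary enlarged. -/
theorem Definable.pullback {α β : Type} {F : Pt S α → ℝ} (hF : L.Definable F) (i : S →ᴸ S')
    (hi : i.Injective) (σ : α → β) (hσ : Function.Injective σ) :
    L.Definable fun p : Pt S' β => F ⟨p.1.reduct i, fun a => p.2 (σ a)⟩ := by
  obtain ⟨χ, hχ⟩ := hF
  have hinj : (constLHom ((S'.lhomWithConstants β).comp i)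
      fun a => newConst S' (σ a)).Injective := by
    refine constLHom_injective (injective_comp (S'.lhomWithConstants_injective β) hi)
      (newConst_injective.comp hσ) ?_
    intro f a h
    cases h
  refine ⟨L.map _ hinj χ, fun p => ?_⟩
  rw [L.val_map, val_reduct_constLHom]
  exact hχ ⟨p.1.reduct i, fun a => p.2 (σ a)⟩

theorem Definable.rename {α β : Type} {F : Pt S α → ℝ} (hF : L.Definable F) (σ : α → β)
    (hσ : Function.Injective σ) : L.Definable fun p : Pt S β => F ⟨p.1, fun a => p.2 (σ a)⟩ :=
  hF.pullback (LHom.id S) injective_id σ hσ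

/-- Variables may be replaced by constants of the vocabulary that do not occur in `S`. -/
theorem Definable.subst {α : Type} {F : Pt S α → ℝ} (hF : L.Definable F) (i : S →ᴸ S')
    (g : α → S'.Functions 0) (h : (constLHom i g).Injective) :
    ∃ χ : L.Sent S', ∀ N : MetStr S', L.val χ N = F ⟨N.reduct i, fun a => N.constVal (g a)⟩ := by
  obtain ⟨χ, hχ⟩ := hF
  exact ⟨L.map _ h χ, fun N => by
    rw [L.val_map, val_reduct_constLHom]; exact hχ ⟨N.reduct i, fun a => N.constVal (g a)⟩⟩

theorem Definable.toSent {F : Pt S Empty → ℝ} (hF : L.Definable F) :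
    ∃ χ : L.Sent S, ∀ M : MetStr S, L.val χ M = F ⟨M, Empty.elim⟩ := by
  obtain ⟨χ, hχ⟩ := hF.subst (LHom.id S) Empty.elim (constLHom_injective
    injective_id (fun a => a.elim) fun _ a => a.elim)
  refine ⟨χ, fun M => ?_⟩
  rw [hχ]
  congr 2
  exact funext fun a => a.elim

/-- A formula as a sentence: the vocabulary may contain constants for its variables. -/
theorem definable_expand {α : Type} (χ : L.Sent (S[[α]])) :
    L.Definable fun p : Pt S α => L.val χ (p.1.expand p.2) := ⟨χ, fun _ => rfl⟩

/-- Terms with variables as closed terms in the vocabulary with new constants. -/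
def closeTerm {α : Type} : S.Term α → (S[[α]]).Term Empty
  | .var a => .func (newConst S a) Fin.elim0
  | .func f ts => .func (Sum.inl f) fun i => closeTerm (ts i)

theorem termVal_closeTerm {α : Type} (M : MetStr S) (v : α → M) (t : S.Term α) :
    (M.expand v).termVal Empty.elim (closeTerm t) = M.termVal v t := by
  induction t with
  | var a => rfl
  | func f ts ih =>
    change M.op f _ = M.op f _
    exact congrArg _ (funext ih)

theorem HasBasic.pred (hL : L.HasBasic) {α : Type} {n : ℕ} (R : S.Relations n)
    (t : Fin n → S.Term α) :
    L.Definable fun p : Pt S α => p.1.pred R fun i => p.1.termVal p.2 (t i) := by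
  obtain ⟨χ, hχ⟩ := (hL.atom (S[[α]])).1 (Sum.inl R : (S[[α]]).Relations n)
    fun i => closeTerm (t i)
  refine ⟨χ, fun p => ?_⟩
  rw [hχ]
  change p.1.pred R _ = _
  exact congrArg _ (funext fun i => termVal_closeTerm _ _ _)

theorem HasBasic.dist (hL : L.HasBasic) {α : Type} (t t' : S.Term α) :
    L.Definable fun p : Pt S α => dist (p.1.termVal p.2 t) (p.1.termVal p.2 t') := by
  obtain ⟨χ, hχ⟩ := (hL.atom (S[[α]])).2 (closeTerm t) (closeTerm t')
  refine ⟨χ, fun p => ?_⟩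
  rw [hχ, termVal_closeTerm, termVal_closeTerm]
  rfl

/-- Quantification over one variable, the one with index `none`. -/
theorem HasBasic.iSup_option (hL : L.HasBasic) {α : Type} {F : Pt S (Option α) → ℝ}
    (hF : L.Definable F) :
    L.Definable fun p : Pt S α => ⨆ a : p.1, F ⟨p.1, fun o => o.elim a p.2⟩ := by
  obtain ⟨χ, hχ⟩ := hF.subst (S' := (S[[α]])[[Fin 1]])
    (((S[[α]]).lhomWithConstants (Fin 1)).comp (S.lhomWithConstants α))
    (fun o => o.elim (Sum.inr (0 : Fin 1)) fun a => Sum.inl (newConst S a)) (by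
      refine constLHom_injective (injective_comp (lhomWithConstants_injective _ _)
        (lhomWithConstants_injective _ _)) ?_ ?_
      · rintro (_ | a) (_ | b) h
        · rfl
        · cases h
        · cases h
        · exact congrArg some (newConst_injective (Sum.inl_injective h))
      · rintro f (_ | a) h
        · cases h
        · cases Sum.inl_injective h)
  obtain ⟨ψ, hψ⟩ := hL.ex (S[[α]]) χ
  refine ⟨ψ, fun p => ?_⟩
  have h := hψ (p.1.expand p.2)
  rw [← h.ciSup_eq]
  refine iSup_congr fun a => ?_
  rw [hχ]
  change F ⟨p.1, _⟩ = _
  congr 2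
  funext o
  cases o <;> rfl

end ValuedLogic

namespace ValuedLogic

variable {L : ValuedLogic.{u}}

/-- Quantification over the finite tuple of variables indexed by `β`. -/
theorem HasBasic.exists_isLUB (hL : L.HasBasic) {α : Type} (β : Type) [Finite β] :
    ∀ F : Pt S (α ⊕ β) → ℝ, L.Definable F → ∃ G : Pt S α → ℝ, L.Definable G ∧
      ∀ p, IsLUB (Set.range fun w : β → p.1 => F ⟨p.1, Sum.elim p.2 w⟩) (G p) := by
  induction β using Finite.induction_empty_option with
  | of_equiv e ih =>
    intro F hF
    obtain ⟨G, hG, h⟩ := ih _ (hF.rename (Sum.map id e.symm)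
      (Function.Injective.sumMap Function.injective_id e.symm.injective))
    refine ⟨G, hG, fun p => ?_⟩
    convert h p using 1
    ext y
    constructor
    · rintro ⟨w, rfl⟩
      refine ⟨fun b => w (e b), ?_⟩
      change F _ = F _
      congr 2
      funext x
      rcases x with x | x <;> simp
    · rintro ⟨w, rfl⟩
      refine ⟨fun b => w (e.symm b), ?_⟩
      change F _ = F _
      congr 2
      funext x
      rcases x with x | x <;> simp
  | h_empty =>
    intro F hF
    have hinj : Function.Injective (Sum.elim id PEmpty.elim : α ⊕ PEmpty → α) := by
      rintro (a | a) (b | b) h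
      · exact congrArg _ h
      · exact b.elim
      all_goals exact a.elim
    refine ⟨_, hF.rename _ hinj, fun p => ?_⟩
    have hw : ∀ w : PEmpty → p.1, F ⟨p.1, Sum.elim p.2 w⟩ =
        F ⟨p.1, fun a => p.2 (Sum.elim id PEmpty.elim a)⟩ := by
      intro w
      congr 2
      funext x
      rcases x with x | x
      · rfl
      · exact x.elim
    simp only [hw, Set.range_const]
    exact isLUB_singleton
  | h_option ih =>
    rename_i β _
    intro F hF
    let σ : α ⊕ Option β → Option (α ⊕ β) :=
      Sum.elim (fun a => some (Sum.inl a)) fun o => o.map Sum.inr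
    have hσ : Function.Injective σ := by
      rintro (a | _ | a) (b | _ | b) h <;> simp_all [σ]
    obtain ⟨G, hG, h⟩ := ih _ (hL.iSup_option (hF.rename σ hσ))
    refine ⟨G, hG, fun p => ?_⟩
    have hval : ∀ (a : p.1) (w : β → p.1),
        F ⟨p.1, fun x => Option.elim (σ x) a (Sum.elim p.2 w)⟩ =
          F ⟨p.1, Sum.elim p.2 fun o => o.elim a w⟩ := by
      intro a w
      congr 2
      funext x
      rcases x with x | _ | x <;> rfl
    have hb : ∀ w : β → p.1, BddAbove (Set.range fun a : p.1 =>
        F ⟨p.1, fun x => Option.elim (σ x) a (Sum.elim p.2 w)⟩) := fun w =>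
      ⟨1, by rintro _ ⟨i, rfl⟩; exact (hL.lukClosed.mem_Icc hF _).2⟩
    constructor
    · rintro _ ⟨w, rfl⟩
      refine le_trans ?_ ((h p).1 ⟨fun b => w (some b), rfl⟩)
      refine le_trans (le_of_eq ?_) (le_ciSup (hb _) (w none))
      rw [hval]
      congr 3
      funext o
      cases o <;> rfl
    · intro r hr
      refine (h p).2 ?_
      rintro _ ⟨w, rfl⟩
      refine ciSup_le fun a => ?_
      rw [hval]
      exact hr ⟨_, rfl⟩

theorem HasBasic.exists_isGLB (hL : L.HasBasic) {α : Type} (β : Type) [Finite β]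
    (F : Pt S (α ⊕ β) → ℝ) (hF : L.Definable F) : ∃ G : Pt S α → ℝ, L.Definable G ∧
      ∀ p, IsGLB (Set.range fun w : β → p.1 => F ⟨p.1, Sum.elim p.2 w⟩) (G p) := by
  obtain ⟨G, hG, h⟩ := hL.exists_isLUB β _ (hL.lukClosed.compl hF)
  refine ⟨_, hL.lukClosed.compl hG, fun p => ⟨?_, fun r hr => ?_⟩⟩
  · rintro _ ⟨w, rfl⟩
    have := (h p).1 ⟨w, rfl⟩
    dsimp only at this ⊢
    linarith
  · have : G p ≤ 1 - r := (h p).2 (by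
      rintro _ ⟨w, rfl⟩
      have := hr ⟨w, rfl⟩
      dsimp only at this ⊢
      linarith)
    linarith

/-! ### Axiomatizable relations -/

variable (L) in
/-- The relation `P(x̄)` is defined, over all structures, by a countable set of formulas. -/
def Axiomatizable {α : Type} (P : Pt S α → Prop) : Prop :=
  ∃ F : ℕ → Pt S α → ℝ, (∀ n, L.Definable (F n)) ∧ ∀ p, P p ↔ ∀ n, F n p = 1

variable (L) in
/-- The class `T` of structures is the class of models of a countable set of sentences. -/
def AxiomatizableClass (T : MetStr S → Prop) : Prop :=
  ∃ Γ : Set (L.Sent S), Γ.Countable ∧ ∀ M, T M ↔ L.Models M Γ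

section

variable {α : Type} {P Q : Pt S α → Prop} {F G : Pt S α → ℝ}

theorem Axiomatizable.congr (hP : L.Axiomatizable P) (h : ∀ p, P p ↔ Q p) :
    L.Axiomatizable Q := by
  rwa [← funext fun p => propext (h p)]

theorem Definable.eq_one (hF : L.Definable F) : L.Axiomatizable fun p => F p = 1 :=
  ⟨fun _ => F, fun _ => hF, fun _ => by simp⟩

theorem HasBasic.le (hL : L.HasBasic) (hF : L.Definable F) (hG : L.Definable G) :
    L.Axiomatizable fun p => F p ≤ G p :=
  (hL.lukClosed.imp hF hG).eq_one.congr fun _ => lukImp_eq_one_iff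

theorem HasBasic.le_rat (hL : L.HasBasic) (hF : L.Definable F) {r : ℚ} (h0 : 0 ≤ r) (h1 : r ≤ 1) :
    L.Axiomatizable fun p => F p ≤ r := hL.le hF (hL.lukClosed.const r h0 h1)

theorem HasBasic.rat_le (hL : L.HasBasic) (hF : L.Definable F) {r : ℚ} (h0 : 0 ≤ r) (h1 : r ≤ 1) :
    L.Axiomatizable fun p => r ≤ F p := hL.le (hL.lukClosed.const r h0 h1) hF

theorem HasBasic.eq_zero (hL : L.HasBasic) (hF : L.Definable F) :
    L.Axiomatizable fun p => F p = 0 :=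
  (hL.le hF hL.lukClosed.zero).congr fun p =>
    ⟨fun h => le_antisymm h (hL.lukClosed.mem_Icc hF p).1, fun h => h.le⟩

theorem Axiomatizable.forall {ι : Type*} [Countable ι] {P : ι → Pt S α → Prop}
    (h : ∀ i, L.Axiomatizable (P i)) (hL : L.HasBasic) : L.Axiomatizable fun p => ∀ i, P i p := by
  choose F hF hP using h
  cases isEmpty_or_nonempty ι with
  | inl _ => exact ⟨fun _ _ => 1, fun _ => hL.lukClosed.one, fun p => by simp⟩
  | inr _ =>
    obtain ⟨e, he⟩ := exists_surjective_nat ι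
    refine ⟨fun n => F (e n.unpair.1) n.unpair.2, fun n => hF _ _, fun p => ?_⟩
    constructor
    · intro h n
      exact (hP _ p).1 (h _) _
    · intro h i
      obtain ⟨m, rfl⟩ := he i
      refine (hP _ p).2 fun n => ?_
      simpa using h (Nat.pair m n)

theorem Axiomatizable.and (hP : L.Axiomatizable P) (hQ : L.Axiomatizable Q) (hL : L.HasBasic) :
    L.Axiomatizable fun p => P p ∧ Q p := by
  refine (Axiomatizable.forall (P := fun b : Bool => bif b then P else Q) ?_ hL).congr fun p => ?_
  · rintro (_ | _)
    · exact hQ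
    · exact hP
  · simp [and_comm]

theorem Axiomatizable.or (hP : L.Axiomatizable P) (hQ : L.Axiomatizable Q) (hL : L.HasBasic) :
    L.Axiomatizable fun p => P p ∨ Q p := by
  obtain ⟨F, hF, hP⟩ := hP
  obtain ⟨G, hG, hQ⟩ := hQ
  refine (Axiomatizable.forall (P := fun (i : ℕ × ℕ) p => max (F i.1 p) (G i.2 p) = 1)
    (fun i => (hL.lukClosed.sup (hF i.1) (hG i.2)).eq_one) hL).congr fun p => ?_
  rw [hP, hQ]
  constructor
  · intro h
    by_contra! hcon
    obtain ⟨⟨m, hm⟩, n, hn⟩ := hcon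
    rcases max_choice (F m p) (G n p) with h' | h'
    · exact hm (h' ▸ h (m, n))
    · exact hn (h' ▸ h (m, n))
  · rintro (h | h) ⟨m, n⟩
    · dsimp only
      rw [h m, max_eq_left (hL.lukClosed.mem_Icc (hG n) p).2]
    · dsimp only
      rw [h n, max_eq_right (hL.lukClosed.mem_Icc (hF m) p).2]

theorem Axiomatizable.forall_tuple {β : Type} [Finite β] {P : Pt S (α ⊕ β) → Prop}
    (hP : L.Axiomatizable P) (hL : L.HasBasic) :
    L.Axiomatizable fun p : Pt S α => ∀ w : β → p.1, P ⟨p.1, Sum.elim p.2 w⟩ := by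
  obtain ⟨F, hF, hP⟩ := hP
  choose G hG h using fun n => hL.exists_isGLB β (F n) (hF n)
  refine ⟨G, hG, fun p => ?_⟩
  simp only [hP]
  constructor
  · intro hw n
    refine le_antisymm (hL.lukClosed.mem_Icc (hG n) p).2 ((h n p).2 ?_)
    rintro _ ⟨w, rfl⟩
    exact (hw w n).ge
  · intro hn w n
    exact le_antisymm (hL.lukClosed.mem_Icc (hF n) _).2 (hn n ▸ (h n p).1 ⟨w, rfl⟩)

theorem Axiomatizable.pullback {β : Type} (hP : L.Axiomatizable P) (i : S →ᴸ S')
    (hi : i.Injective) (σ : α → β) (hσ : Function.Injective σ) :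
    L.Axiomatizable fun p : Pt S' β => P ⟨p.1.reduct i, fun a => p.2 (σ a)⟩ := by
  obtain ⟨F, hF, hP⟩ := hP
  exact ⟨_, fun n => (hF n).pullback i hi σ hσ, fun p => hP _⟩

theorem Axiomatizable.rename {β : Type} (hP : L.Axiomatizable P) (σ : α → β)
    (hσ : Function.Injective σ) : L.Axiomatizable fun p : Pt S β => P ⟨p.1, fun a => p.2 (σ a)⟩ :=
  hP.pullback (LHom.id S) injective_id σ hσ

theorem Axiomatizable.subst (hP : L.Axiomatizable P) (i : S →ᴸ S') (g : α → S'.Functions 0)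
    (h : (constLHom i g).Injective) :
    L.AxiomatizableClass fun N => P ⟨N.reduct i, fun a => N.constVal (g a)⟩ := by
  obtain ⟨F, hF, hP⟩ := hP
  choose χ hχ using fun n => (hF n).subst i g h
  refine ⟨Set.range χ, Set.countable_range χ, fun N => (hP _).trans ?_⟩
  simp [Models, Holds, hχ]

theorem Axiomatizable.toClass [Finite α] (hP : L.Axiomatizable P) (hL : L.HasBasic) :
    L.AxiomatizableClass fun M => ∀ v : α → M, P ⟨M, v⟩ := by
  obtain ⟨F, hF, h⟩ := (hP.rename Sum.inr Sum.inr_injective).forall_tuple (α := Empty) hL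
  choose χ hχ using fun n => (hF n).toSent
  refine ⟨Set.range χ, Set.countable_range χ, fun N => ?_⟩
  have := h ⟨N, Empty.elim⟩
  simp only [Models, Holds, Set.forall_mem_range, hχ]
  exact this

end

theorem AxiomatizableClass.congr {T T' : MetStr S → Prop} (hT : L.AxiomatizableClass T)
    (h : ∀ M, T M ↔ T' M) : L.AxiomatizableClass T' := by
  rwa [← funext fun p => propext (h p)]

theorem AxiomatizableClass.forall {ι : Type*} [Countable ι] {T : ι → MetStr S → Prop}
    (h : ∀ i, L.AxiomatizableClass (T i)) : L.AxiomatizableClass fun M => ∀ i, T i M := by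
  choose Γ hΓ hT using h
  refine ⟨⋃ i, Γ i, Set.countable_iUnion hΓ, fun M => ?_⟩
  simp only [hT, Models, Set.mem_iUnion]
  exact ⟨fun h φ ⟨i, hi⟩ => h i φ hi, fun h i φ hi => h φ ⟨i, hi⟩⟩

theorem AxiomatizableClass.and {T T' : MetStr S → Prop} (h : L.AxiomatizableClass T)
    (h' : L.AxiomatizableClass T') : L.AxiomatizableClass fun M => T M ∧ T' M := by
  refine (AxiomatizableClass.forall (T := fun b : Bool => bif b then T else T') ?_).congr
    fun p => ?_
  · rintro (_ | _)
    · exact h'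
    · exact h
  · simp [and_comm]

theorem AxiomatizableClass.pullback {T : MetStr S → Prop} (h : L.AxiomatizableClass T)
    (i : S →ᴸ S') (hi : i.Injective) : L.AxiomatizableClass fun M => T (M.reduct i) := by
  obtain ⟨Γ, hΓ, hT⟩ := h
  refine ⟨L.map i hi '' Γ, hΓ.image _, fun M => ?_⟩
  simp [hT, Models, Holds, L.val_map]

end ValuedLogic

/-! ### Generic chains of length `κ` -/

namespace MetStr

/-- The expansion of `M` by constants indexed by a type in an arbitrary universe. -/
def expandConsts (M : MetStr S) {C : Type u} (a : C → M) : MetStr (S[[C]]) where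
  carrier := M
  dist_le_one := M.dist_le_one
  op f v := Sum.elim (fun g => M.op g v) (fun c => constOp a c v) f
  pred R v := Sum.elim (fun Q => M.pred Q v) (fun e => Empty.elim e) R
  pred_mem R v := by
    rcases R with R | e
    · exact M.pred_mem R v
    · exact Empty.elim e
  uniformContinuous_op {n} f := by
    rcases f with f | c
    · exact M.uniformContinuous_op f
    · cases n with
      | zero => exact uniformContinuous_const
      | succ n => exact PEmpty.elim c
  uniformContinuous_pred R := by
    rcases R with R | e
    · exact M.uniformContinuous_pred R
    · exact Empty.elim e

end MetStr

/-- The symbols of a vocabulary of nullary predicates. -/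
def nullRel (ν : Type u) : ℕ → Type u
  | 0 => ν
  | _ + 1 => PEmpty

/-- A vocabulary of nullary predicates. -/
def nullLang (ν : Type u) : FirstOrder.Language.{u, u} := ⟨fun _ => PEmpty, nullRel ν⟩

/-- Interpretation of nullary predicates by given truth values. -/
def nullPred {ν : Type u} (q : ν → Set.Icc (0 : ℝ) 1) : ∀ {n : ℕ}, nullRel ν n → Set.Icc (0 : ℝ) 1
  | 0, r => q r
  | _ + 1, r => PEmpty.elim r

namespace MetStr

/-- The expansion of `M` by nullary predicates with the truth values `q`. -/
def expandNull (M : MetStr S) {ν : Type u} (q : ν → Set.Icc (0 : ℝ) 1) :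
    MetStr (S.sum (nullLang ν)) where
  carrier := M
  dist_le_one := M.dist_le_one
  op f v := Sum.elim (fun g => M.op g v) (fun e => PEmpty.elim e) f
  pred R v := Sum.elim (fun Q => M.pred Q v) (fun r => (nullPred q r : ℝ)) R
  pred_mem R v := by
    rcases R with R | r
    · exact M.pred_mem R v
    · exact (nullPred q r).2
  uniformContinuous_op f := by
    rcases f with f | e
    · exact M.uniformContinuous_op f
    · exact PEmpty.elim e
  uniformContinuous_pred R := by
    rcases R with R | r
    · exact M.uniformContinuous_pred R
    · exact uniformContinuous_const

/-- The truth value of a nullary predicate. -/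
def nullVal (M : MetStr S) (R : S.Relations 0) : Set.Icc (0 : ℝ) 1 :=
  ⟨M.pred R Fin.elim0, M.pred_mem _ _⟩

theorem pred_eq_nullVal (M : MetStr S) (R : S.Relations 0) (v : Fin 0 → M) :
    M.pred R v = M.nullVal R := congrArg (M.pred R) (Subsingleton.elim _ _)

end MetStr

/-- The map of vocabularies which is `i` on `S` and sends the new nullary predicates to nullary
predicates of the target. -/
def nullHom {ν : Type u} (i : S →ᴸ S') (g : ν → S'.Relations 0) : S.sum (nullLang ν) →ᴸ S' :=
  i.sumElim
    { onFunction := fun _ => PEmpty.elim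
      onRelation := fun n => match n with
        | 0 => g
        | _ + 1 => PEmpty.elim }

theorem nullHom_injective {ν : Type u} {i : S →ᴸ S'} {g : ν → S'.Relations 0} (hi : i.Injective)
    (hg : Function.Injective g) (hd : ∀ (R : S.Relations 0) a, i.onRelation R ≠ g a) :
    (nullHom i g).Injective where
  onFunction := by
    rintro n (f | f) (f' | f') h
    · exact congrArg Sum.inl (hi.onFunction h)
    all_goals first | exact PEmpty.elim f | exact PEmpty.elim f'
  onRelation {n} := by
    rintro (f | f) (f' | f') h
    · exact congrArg Sum.inl (hi.onRelation h)
    · cases n with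
      | zero => exact absurd h (hd f f')
      | succ n => exact PEmpty.elim f'
    · cases n with
      | zero => exact absurd h.symm (hd f' f)
      | succ n => exact PEmpty.elim f
    · cases n with
      | zero => exact congrArg Sum.inr (hg h)
      | succ n => exact PEmpty.elim f

/-- The new nullary predicate symbol for `r`. -/
abbrev newNull (S : FirstOrder.Language.{u, u}) {ν : Type u} (r : ν) :
    (S.sum (nullLang ν)).Relations 0 := Sum.inr r

theorem newNull_injective {ν : Type u} : Function.Injective (newNull S (ν := ν)) :=
  Sum.inr_injective

namespace ValuedLogic

variable {L : ValuedLogic.{u}}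

theorem Definable.eq_of_iso {α : Type} {F : Pt S α → ℝ} (hF : L.Definable F) {M N : MetStr S}
    (e : M ≃ᵢ N)
    (hop : ∀ {n : ℕ} (f : S.Functions n) (a : Fin n → M), e (M.op f a) = N.op f fun i => e (a i))
    (hpred : ∀ {n : ℕ} (R : S.Relations n) (a : Fin n → M),
      M.pred R a = N.pred R fun i => e (a i)) (v : α → M) :
    F ⟨M, v⟩ = F ⟨N, fun a => e (v a)⟩ := by
  obtain ⟨χ, hχ⟩ := hF
  rw [← hχ, ← hχ]
  refine L.val_congr χ (M := M.expand v) (N := N.expand fun a => e (v a)) e ?_ ?_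
  · rintro n (f | c) a
    · exact hop f a
    · cases n with
      | zero => rfl
      | succ n => exact PEmpty.elim c
  · rintro n (R | r) a
    · exact hpred R a
    · exact Empty.elim r

theorem Definable.reduct_nullHom {α : Type} {ν : Type u} {F : Pt (S.sum (nullLang ν)) α → ℝ}
    (hF : L.Definable F) (i : S →ᴸ S') (g : ν → S'.Relations 0) (N : MetStr S') (v : α → N) :
    F ⟨N.reduct (nullHom i g), v⟩ =
      F ⟨(N.reduct i).expandNull fun r => N.nullVal (g r), v⟩ := by
  refine hF.eq_of_iso (M := N.reduct (nullHom i g))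
    (N := (N.reduct i).expandNull fun r => N.nullVal (g r))
    (IsometryEquiv.refl N) ?_ ?_ v
  · rintro n (f | e) a
    · rfl
    · exact PEmpty.elim e
  · rintro n (R | r) a
    · rfl
    · cases n with
      | zero => exact N.pred_eq_nullVal (g r) a
      | succ n => exact PEmpty.elim r

theorem Axiomatizable.reduct_nullHom {α : Type} {ν : Type u}
    {P : Pt (S.sum (nullLang ν)) α → Prop} (hP : L.Axiomatizable P) (i : S →ᴸ S')
    (g : ν → S'.Relations 0) (N : MetStr S') (v : α → N) :
    P ⟨N.reduct (nullHom i g), v⟩ ↔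
      P ⟨(N.reduct i).expandNull fun r => N.nullVal (g r), v⟩ := by
  obtain ⟨F, hF, hP⟩ := hP
  rw [hP, hP]
  exact forall_congr' fun n => by rw [(hF n).reduct_nullHom]

/-- Nullary predicates may be replaced by other nullary predicates, and variables by constants, that
do not occur in `S`. -/
theorem Axiomatizable.subst_null {α : Type} {ν : Type u} {P : Pt (S.sum (nullLang ν)) α → Prop}
    (hP : L.Axiomatizable P) (i : S →ᴸ S') (g : ν → S'.Relations 0) (c : α → S'.Functions 0)
    (hg : (nullHom i g).Injective) (hc : Function.Injective c)
    (hd : ∀ (f : S.Functions 0) a, i.onFunction f ≠ c a) :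
    L.AxiomatizableClass fun N => P ⟨(N.reduct i).expandNull fun r => N.nullVal (g r),
      fun a => N.constVal (c a)⟩ := by
  refine (hP.subst (nullHom i g) c (constLHom_injective hg hc ?_)).congr
    fun N => hP.reduct_nullHom i g N fun a => N.constVal (c a)
  rintro (f | e) a h
  · exact hd f a h
  · exact PEmpty.elim e

end ValuedLogic

/-- The signature obtained by adding nullary predicates. -/
def Signature.withNull (Sg : Signature.{u}) (ν : Type u) : Signature.{u} where
  lang := Sg.lang.sum (nullLang ν)
  opMod f := Sum.elim (fun g => Sg.opMod g) (fun e => PEmpty.elim e) f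
  predMod R := Sum.elim (fun Q => Sg.predMod Q) (fun _ => id) R

theorem Signature.isStr_withNull {Sg : Signature.{u}} {ν : Type u}
    {N : MetStr (Sg.lang.sum (nullLang ν))} :
    (Sg.withNull ν).IsStr N ↔ Sg.IsStr (N.reduct LHom.sumInl) := by
  constructor
  · rintro ⟨h₁, h₂⟩
    exact ⟨fun f => h₁ (Sum.inl f), fun R => h₂ (Sum.inl R)⟩
  · rintro ⟨h₁, h₂⟩
    refine ⟨?_, ?_⟩
    · rintro n (f | e)
      · exact h₁ f
      · exact PEmpty.elim e
    · rintro n (R | r)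
      · exact h₂ R
      · intro ε a b _
        cases n with
        | zero =>
          rw [Subsingleton.elim a b, sub_self, abs_zero]
          exact_mod_cast ε.2.1.le
        | succ n => exact PEmpty.elim r

/-- The signature obtained by adding constants. -/
def Signature.withConsts (Sg : Signature.{u}) (C : Type u) : Signature.{u} where
  lang := Sg.lang[[C]]
  opMod f := Sum.elim (fun g => Sg.opMod g) (fun _ => id) f
  predMod R := Sum.elim (fun Q => Sg.predMod Q) (fun e => Empty.elim e) R

theorem Signature.isStr_withConsts {Sg : Signature.{u}} {C : Type u} {N : MetStr (Sg.lang[[C]])} :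
    (Sg.withConsts C).IsStr N ↔ Sg.IsStr (N.reduct (Sg.lang.lhomWithConstants C)) := by
  constructor
  · rintro ⟨h₁, h₂⟩
    exact ⟨fun f => h₁ (Sum.inl f), fun R => h₂ (Sum.inl R)⟩
  · rintro ⟨h₁, h₂⟩
    refine ⟨?_, ?_⟩
    · rintro n (f | c)
      · exact h₁ f
      · intro ε a b _
        cases n with
        | zero =>
          rw [Subsingleton.elim a b, dist_self]
          exact_mod_cast ε.2.1.le
        | succ n => exact PEmpty.elim c
    · rintro n (R | e)
      · exact h₂ R
      · exact Empty.elim e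

section Regular

open Cardinal

variable {κ : Cardinal.{u}}

theorem exists_gt_of_mk_lt (hreg : κ.IsRegular) (X : Set κ.ord.ToType) (hX : #X < κ) :
    ∃ β₀, ∀ β ∈ X, β < β₀ := by
  rw [← not_isCofinal_iff]
  intro h
  have := Order.cof_le h
  rw [Ordinal.cof_toType, hreg.cof_ord] at this
  exact absurd hX this.not_gt

theorem exists_gt_of_countable (hreg : κ.IsRegular) (hunc : ℵ₀ < κ) {X : Set κ.ord.ToType}
    (hX : X.Countable) : ∃ β₀, ∀ β ∈ X, β < β₀ :=
  exists_gt_of_mk_lt hreg X ((le_aleph0_iff_set_countable.2 hX).trans_lt hunc)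

theorem mk_iUnion_countable_le (hunc : ℵ₀ < κ) {ι α : Type u} (hι : #ι ≤ κ) (f : ι → Set α)
    (hf : ∀ i, (f i).Countable) : #(⋃ i, f i) ≤ κ := by
  refine (mk_iUnion_le_sum_mk).trans ?_
  refine (sum_le_sum _ (fun _ => ℵ₀) fun i => le_aleph0_iff_set_countable.2 (hf i)).trans ?_
  rw [sum_const, lift_id, lift_id]
  exact (mul_le_mul' hι hunc.le).trans (mul_eq_self hunc.le).le

end Regular

/-- The vocabulary of a chain: for each `β : K`, there are `p` constants and nullary predicates
indexed by `ν`. -/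
abbrev chainLang (S : FirstOrder.Language.{u, u}) (K ν : Type u) (p : ℕ) :
    FirstOrder.Language.{u, u} := (S.sum (nullLang (K × ν)))[[K × Fin p]]

/-- The inclusion of `S` into the vocabulary of a chain. -/
def chainHom (S : FirstOrder.Language.{u, u}) (K ν : Type u) (p : ℕ) : S →ᴸ chainLang S K ν p :=
  ((S.sum (nullLang (K × ν))).lhomWithConstants (K × Fin p)).comp LHom.sumInl

theorem chainHom_injective (S : FirstOrder.Language.{u, u}) (K ν : Type u) (p : ℕ) :
    (chainHom S K ν p).Injective :=
  injective_comp (lhomWithConstants_injective _ _) LHom.sumInl_injective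

/-- The nullary predicate symbol `r` with index `β`. -/
abbrev chainNullSymb (S : FirstOrder.Language.{u, u}) {K ν : Type u} (p : ℕ) (β : K) (r : ν) :
    (chainLang S K ν p).Relations 0 := Sum.inl (newNull S (β, r))

/-- The constant symbol `k` with index `β`. -/
abbrev chainConst (S : FirstOrder.Language.{u, u}) {K : Type u} (ν : Type u) {p : ℕ} (β : K)
    (k : Fin p) : (chainLang S K ν p).Functions 0 := newConst _ (β, k)

section Chain

variable {K ν : Type u} {p : ℕ}

/-- The elements of the chain with index `β`. -/
def chainVal (N : MetStr (chainLang S K ν p)) (β : K) (k : Fin p) : N :=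
  N.constVal (chainConst S ν β k)

/-- The truth values of the chain with index `β`. -/
def chainNull (N : MetStr (chainLang S K ν p)) (β : K) (r : ν) : Set.Icc (0 : ℝ) 1 :=
  N.nullVal (chainNullSymb S p β r)

/-- The expansion of `M` by a chain. -/
def MetStr.expandChain (M : MetStr S) (c : K → Fin p → M) (q : K → ν → Set.Icc (0 : ℝ) 1) :
    MetStr (chainLang S K ν p) :=
  (M.expandNull fun r : K × ν => q r.1 r.2).expandConsts fun k : K × Fin p => c k.1 k.2

/-- A formula depends on finitely many entries of the chain only. -/
theorem ValuedLogic.FiniteOccurrence.exists_finite_support {L : ValuedLogic.{u}}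
    (hfin : L.FiniteOccurrence) {n : ℕ} (φ : L.Sent ((chainLang S K ν p)[[Fin n]])) :
    ∃ X : Set K, X.Finite ∧ ∀ (N : MetStr (chainLang S K ν p)) (c : K → Fin p → N)
      (q : K → ν → Set.Icc (0 : ℝ) 1),
      (∀ β ∈ X, c β = chainVal N β ∧ q β = chainNull N β) → ∀ a : Fin n → N, L.val φ (N.expand a) =
        L.val φ (((N.reduct (chainHom S K ν p)).expandChain c q).expand a) := by
  obtain ⟨S₀, i, φ₀, hS₀, -, hφ⟩ := hfin _ φ
  have hF : Finite (S₀.Functions 0) :=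
    Finite.of_injective (fun f => (Sum.inl ⟨0, f⟩ : S₀.Symbols)) fun f g h => by
      simpa using h
  have hR : Finite (S₀.Relations 0) :=
    Finite.of_injective (fun f => (Sum.inr ⟨0, f⟩ : S₀.Symbols)) fun f g h => by
      simpa using h
  refine ⟨(⋃ f : S₀.Functions 0, {β | ∃ k : Fin p, i.onFunction f = Sum.inl (chainConst S ν β k)}) ∪
    ⋃ R : S₀.Relations 0, {β | ∃ r : ν, i.onRelation R = Sum.inl (chainNullSymb S p β r)}, ?_, ?_⟩
  · refine (Set.finite_iUnion fun f => Set.Subsingleton.finite ?_).union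
      (Set.finite_iUnion fun R => Set.Subsingleton.finite ?_)
    · rintro β ⟨k, h⟩ β' ⟨k', h'⟩
      have := newConst_injective (Sum.inl_injective (h.symm.trans h'))
      exact congrArg Prod.fst this
    · rintro β ⟨k, h⟩ β' ⟨k', h'⟩
      have := newNull_injective (Sum.inl_injective (Sum.inl_injective (h.symm.trans h')))
      exact congrArg Prod.fst this
  · intro N c q hcq a
    rw [hφ, hφ]
    refine L.val_congr φ₀ (IsometryEquiv.refl N) ?_ ?_
    · intro n f v
      change (N.expand a).op (i.onFunction f) v =
        (((N.reduct (chainHom S K ν p)).expandChain c q).expand a).op (i.onFunction f) v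
      rcases hf : i.onFunction f with ((g | e) | k) | x
      · rfl
      · exact PEmpty.elim e
      · cases n with
        | zero =>
          have h := (hcq k.1 (Or.inl (Set.mem_iUnion.2 ⟨f, k.2, hf⟩))).1
          exact (N.op_eq_constVal (newConst _ k) v).trans (congrFun h k.2).symm
        | succ n => exact PEmpty.elim k
      · rfl
    · intro n R v
      change (N.expand a).pred (i.onRelation R) v =
        (((N.reduct (chainHom S K ν p)).expandChain c q).expand a).pred (i.onRelation R) v
      rcases hr : i.onRelation R with ((g | r) | e) | x
      · rfl
      · cases n with
        | zero =>
          have h := (hcq r.1 (Or.inr (Set.mem_iUnion.2 ⟨R, r.2, hr⟩))).2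
          exact (N.pred_eq_nullVal (Sum.inl (newNull S r)) v).trans
            (congrArg Subtype.val (congrFun h r.2).symm)
        | succ n => exact PEmpty.elim r
      · exact Empty.elim e
      · exact Empty.elim x

open Cardinal in
/-- From the omitting types property: suppose that in every model of `T` every entry of a `le`-chain
has an extension that is in no `avoid j` relation to a given tuple. Then some model of `T` has a
`le`-chain of length `κ` that meets all these requirements. Here the entries of a chain consist of
`p` elements and of truth values indexed by `ν`. The types to be omitted say of `x̄` that
`avoid j (x̄, c_β)` holds for all entries `c_β` of the chain. A set of fewer than `κ` formulas
mentions only entries `c_β` with `β < β₀`, so the others may be reinterpreted by an extension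
of `c_{β₀}`; therefore these types are not `κ`-principal. -/
theorem exists_generic_chain_null {L : ValuedLogic.{u}} (hfin : L.FiniteOccurrence)
    {κ : Cardinal.{u}} (hreg : κ.IsRegular) (hunc : ℵ₀ < κ) (hOTP : L.OmittingTypesProperty κ)
    (Sg : Signature.{u}) {n p : ℕ} {ν : Type u}
    {T : MetStr Sg.lang → Prop} (hT : L.AxiomatizableClass T)
    {le : Pt (Sg.lang.sum (nullLang (ν ⊕ ν))) (Fin p ⊕ Fin p) → Prop} (hle : L.Axiomatizable le)
    {avoid : ℕ → Pt (Sg.lang.sum (nullLang ν)) (Fin n ⊕ Fin p) → Prop}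
    (havoid : ∀ j, L.Axiomatizable (avoid j))
    (hmodel : ∃ M : Sg.Str, T M.1 ∧ ∃ (x : Fin p → M.1) (q : ν → Set.Icc (0 : ℝ) 1),
      le ⟨M.1.expandNull (Sum.elim q q), Sum.elim x x⟩)
    (hext : ∀ M : Sg.Str, T M.1 → ∀ (x x' : Fin p → M.1) (q q' : ν → Set.Icc (0 : ℝ) 1),
      le ⟨M.1.expandNull (Sum.elim q q'), Sum.elim x x'⟩ →
      ∀ (j : ℕ) (a : Fin n → M.1), ∃ (y : Fin p → M.1) (s : ν → Set.Icc (0 : ℝ) 1),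
        le ⟨M.1.expandNull (Sum.elim s s), Sum.elim y y⟩ ∧
        (∀ (z : Fin p → M.1) (t : ν → Set.Icc (0 : ℝ) 1),
          le ⟨M.1.expandNull (Sum.elim t q), Sum.elim z x⟩ →
          le ⟨M.1.expandNull (Sum.elim t s), Sum.elim z y⟩) ∧
        ¬ avoid j ⟨M.1.expandNull s, Sum.elim a y⟩) :
    ∃ M : Sg.Str, T M.1 ∧ ∃ (c : κ.ord.ToType → Fin p → M.1)
      (q : κ.ord.ToType → ν → Set.Icc (0 : ℝ) 1),
      (∀ β γ, β < γ → le ⟨M.1.expandNull (Sum.elim (q β) (q γ)), Sum.elim (c β) (c γ)⟩) ∧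
      ∀ (j : ℕ) (a : Fin n → M.1), ∃ β, ¬ avoid j ⟨M.1.expandNull (q β), Sum.elim a (c β)⟩ := by
  set K := κ.ord.ToType with hK
  have hKcard : #K = κ := by rw [hK, mk_toType, card_ord]
  let W := chainLang Sg.lang K ν p
  let SgW : Signature.{u} := (Sg.withNull (K × ν)).withConsts (K × Fin p)
  let i₀ : Sg.lang →ᴸ W := chainHom Sg.lang K ν p
  have hi₀ : i₀.Injective := chainHom_injective _ _ _ _
  have hSgW : ∀ N : MetStr W, SgW.IsStr N ↔ Sg.IsStr (N.reduct i₀) := fun N =>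
    Signature.isStr_withConsts.trans Signature.isStr_withNull
  -- the theory of the chain
  obtain ⟨Θ, hΘ, hTΘ⟩ := hT.pullback i₀ hi₀
  have hpair : ∀ q : {q : K × K // q.1 < q.2}, L.AxiomatizableClass fun N : MetStr W =>
      le ⟨(N.reduct i₀).expandNull (Sum.elim (chainNull N q.1.1) (chainNull N q.1.2)),
        Sum.elim (chainVal N q.1.1) (chainVal N q.1.2)⟩ := by
    intro q
    have hne := q.2.ne
    refine (hle.subst_null i₀ (Sum.elim (chainNullSymb Sg.lang p q.1.1)
        (chainNullSymb Sg.lang p q.1.2)) (Sum.elim (chainConst Sg.lang ν q.1.1)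
        (chainConst Sg.lang ν q.1.2)) (nullHom_injective hi₀ ?_ ?_) ?_ ?_).congr
        fun N => iff_of_eq ?_
    · rintro (k | k) (k' | k') h
      · exact congrArg Sum.inl (congrArg Prod.snd (newNull_injective (Sum.inl_injective h)))
      · exact absurd (congrArg Prod.fst (newNull_injective (Sum.inl_injective h))) hne
      · exact absurd (congrArg Prod.fst (newNull_injective (Sum.inl_injective h))).symm hne
      · exact congrArg Sum.inr (congrArg Prod.snd (newNull_injective (Sum.inl_injective h)))
    · rintro R (k | k) h
      · cases Sum.inl_injective h
      · cases Sum.inl_injective h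
    · rintro (k | k) (k' | k') h
      · exact congrArg Sum.inl (congrArg Prod.snd (newConst_injective h))
      · exact absurd (congrArg Prod.fst (newConst_injective h)) hne
      · exact absurd (congrArg Prod.fst (newConst_injective h)).symm hne
      · exact congrArg Sum.inr (congrArg Prod.snd (newConst_injective h))
    · rintro f (k | k) h
      · cases h
      · cases h
    · have h1 : (fun r => N.nullVal (Sum.elim (chainNullSymb Sg.lang p q.1.1)
          (chainNullSymb Sg.lang p q.1.2) r)) =
          Sum.elim (chainNull N q.1.1) (chainNull N q.1.2) := by
        funext r
        rcases r with r | r <;> rfl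
      have h2 : (fun k => N.constVal (Sum.elim (chainConst Sg.lang ν q.1.1)
          (chainConst Sg.lang ν q.1.2) k)) = Sum.elim (chainVal N q.1.1) (chainVal N q.1.2) := by
        funext r
        rcases r with r | r <;> rfl
      rw [h1]
      exact congrArg (fun v => le ⟨_, v⟩) h2
  choose Λ hΛc hΛ using hpair
  let Ψ : Set (L.Sent SgW.lang) := Θ ∪ ⋃ q, Λ q
  have hΨ : ∀ N : MetStr W, L.Models N Ψ ↔ T (N.reduct i₀) ∧ ∀ β γ, β < γ →
      le ⟨(N.reduct i₀).expandNull (Sum.elim (chainNull N β) (chainNull N γ)),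
        Sum.elim (chainVal N β) (chainVal N γ)⟩ := by
    intro N
    refine Iff.trans ?_ (and_congr_left' (hTΘ N).symm)
    constructor
    · intro h
      exact ⟨fun φ hφ => h φ (Or.inl hφ), fun β γ hβγ => (hΛ ⟨(β, γ), hβγ⟩ N).2
        fun φ hφ => h φ (Or.inr (Set.mem_iUnion.2 ⟨_, hφ⟩))⟩
    · rintro ⟨h₁, h₂⟩ φ (hφ | hφ)
      · exact h₁ φ hφ
      · obtain ⟨q, hφ⟩ := Set.mem_iUnion.1 hφ
        exact (hΛ q N).1 (h₂ _ _ q.2) φ hφ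
  have hΨcard : #Ψ ≤ κ := by
    refine (mk_union_le _ _).trans ?_
    refine (add_le_add ((le_aleph0_iff_set_countable.2 hΘ).trans hunc.le)
      (mk_iUnion_countable_le hunc ?_ _ hΛc)).trans (add_eq_self hunc.le).le
    refine (mk_subtype_le _).trans ?_
    rw [mk_prod, lift_id, hKcard]
    exact (mul_eq_self hunc.le).le
  -- the types to be omitted
  have htype : ∀ (j : ℕ) (β : K), L.AxiomatizableClass fun N : MetStr (W[[Fin n]]) =>
      avoid j ⟨(N.reduct ((W.lhomWithConstants (Fin n)).comp i₀)).expandNull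
        fun r => N.nullVal (Sum.inl (chainNullSymb Sg.lang p β r)),
        fun x => N.constVal (Sum.elim (fun k => newConst W k)
          (fun k => Sum.inl (chainConst Sg.lang ν β k)) x)⟩ := by
    intro j β
    refine (havoid j).subst_null _ _ _ (nullHom_injective
      (injective_comp (lhomWithConstants_injective _ _) hi₀) ?_ ?_) ?_ ?_
    · intro r r' h
      exact congrArg Prod.snd (newNull_injective (Sum.inl_injective (Sum.inl_injective h)))
    · intro R r h
      cases Sum.inl_injective (Sum.inl_injective h)
    · rintro (k | k) (k' | k') h
      · exact congrArg Sum.inl (newConst_injective h)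
      · cases h
      · cases h
      · exact congrArg Sum.inr (congrArg Prod.snd (newConst_injective (Sum.inl_injective h)))
    · rintro f (k | k) h
      · cases h
      · cases Sum.inl_injective h
  choose Δ hΔc hΔ using htype
  let Γ : ℕ → Set (L.Sent (SgW.lang[[Fin n]])) := fun j => ⋃ β, Δ j β
  have hΓ : ∀ (j : ℕ) (N : MetStr W) (a : Fin n → N), L.Realizes N a (Γ j) ↔
      ∀ β, avoid j ⟨(N.reduct i₀).expandNull (chainNull N β), Sum.elim a (chainVal N β)⟩ := by
    intro j N a
    have key : ∀ β, avoid j ⟨(N.reduct i₀).expandNull (chainNull N β),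
        Sum.elim a (chainVal N β)⟩ ↔ L.Models (N.expand a) (Δ j β) := by
      intro β
      refine Iff.trans (iff_of_eq ?_) (hΔ j β (N.expand a))
      refine congrArg (fun v => avoid j ⟨(N.reduct i₀).expandNull (chainNull N β), v⟩) ?_
      funext k
      rcases k with k | k <;> rfl
    simp only [key]
    constructor
    · intro h β φ hφ
      exact h φ (Set.mem_iUnion.2 ⟨β, hφ⟩)
    · intro h φ hφ
      obtain ⟨β, hφ⟩ := Set.mem_iUnion.1 hφ
      exact h β φ hφ
  have hprinc : ∀ j, ¬ L.IsPrincipal κ SgW Ψ (Γ j) := by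
    rintro j ⟨Φ, hΦcard, ⟨⟨N, hNstr⟩, hN, a, ha⟩, hgen⟩
    choose X hXfin hX using fun φ : L.Sent (W[[Fin n]]) => hfin.exists_finite_support φ
    obtain ⟨β₀, hβ₀⟩ := exists_gt_of_mk_lt hreg (⋃ φ : Φ, X φ.1) (by
      refine (card_iUnion_lt_iff_forall_of_isRegular hreg hΦcard).2 fun φ => ?_
      exact (lt_aleph0_iff_set_finite.2 (hXfin _)).trans hunc)
    obtain ⟨β₁, hβ₁⟩ := exists_gt_of_countable hreg hunc (Set.countable_singleton β₀)
    obtain ⟨hTN, hleN⟩ := (hΨ N).1 hN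
    let M : MetStr Sg.lang := N.reduct i₀
    have hMstr : Sg.IsStr M := (hSgW N).1 hNstr
    obtain ⟨y, s, hyy, hy, hyj⟩ := hext ⟨M, hMstr⟩ hTN (chainVal N β₀) (chainVal N β₁)
      (chainNull N β₀) (chainNull N β₁) (hleN _ _ (hβ₁ _ rfl)) j a
    -- reinterpret the entries of the chain from `β₀` on by `y` and `s`
    let c : K → Fin p → M := fun β => if β < β₀ then chainVal N β else y
    let q : K → ν → Set.Icc (0 : ℝ) 1 := fun β => if β < β₀ then chainNull N β else s
    have hc₁ : ∀ β, β < β₀ → c β = chainVal N β := fun β h => if_pos h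
    have hc₂ : ∀ β, ¬ β < β₀ → c β = y := fun β h => if_neg h
    have hq₁ : ∀ β, β < β₀ → q β = chainNull N β := fun β h => if_pos h
    have hq₂ : ∀ β, ¬ β < β₀ → q β = s := fun β h => if_neg h
    let N' : MetStr W := M.expandChain c q
    have hN' : L.Models N' Ψ := by
      refine (hΨ N').2 ⟨hTN, fun β γ hβγ => ?_⟩
      change le ⟨M.expandNull (Sum.elim (q β) (q γ)), Sum.elim (c β) (c γ)⟩
      by_cases hγ : γ < β₀
      · rw [hc₁ γ hγ, hc₁ β (hβγ.trans hγ), hq₁ γ hγ, hq₁ β (hβγ.trans hγ)]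
        exact hleN _ _ hβγ
      · rw [hc₂ γ hγ, hq₂ γ hγ]
        by_cases hβ : β < β₀
        · rw [hc₁ β hβ, hq₁ β hβ]
          exact hy _ _ (hleN _ _ hβ)
        · rw [hc₂ β hβ, hq₂ β hβ]
          exact hyy
    have hN'str : SgW.IsStr N' := (hSgW N').2 hMstr
    have hreal : L.Realizes N' a Φ := by
      intro φ hφ
      have h := hX φ N c q (fun β hβ => by
        have := hβ₀ β (Set.mem_iUnion.2 ⟨⟨φ, hφ⟩, hβ⟩)
        exact ⟨hc₁ β this, hq₁ β this⟩) a
      exact h.symm.trans (ha φ hφ)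
    have h : avoid j ⟨M.expandNull (q β₀), Sum.elim a (c β₀)⟩ :=
      (hΓ j N' a).1 (hgen ⟨N', hN'str⟩ hN' a hreal) β₀
    rw [hc₂ β₀ (lt_irrefl _), hq₂ β₀ (lt_irrefl _)] at h
    exact hyj h
  have hcons : ∃ M : SgW.Str, L.Models M.1 Ψ := by
    obtain ⟨M, hM, x, q, hx⟩ := hmodel
    exact ⟨⟨M.1.expandChain (fun _ => x) fun _ => q, (hSgW _).2 M.2⟩,
      (hΨ _).2 ⟨hM, fun β γ _ => hx⟩⟩
  obtain ⟨⟨N, hNstr⟩, hN, hom⟩ := hOTP SgW Ψ hΨcard hcons n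
    (ULift.{u} {j : ℕ // L.Consistent SgW Ψ (Γ j)}) (fun j => Γ j.down.1)
    ((mk_le_aleph0 (α := ULift.{u} {j : ℕ // _})).trans hunc.le) (fun j => j.down.2)
    (fun j => hprinc _)
  obtain ⟨hTN, hleN⟩ := (hΨ N).1 hN
  refine ⟨⟨N.reduct i₀, (hSgW N).1 hNstr⟩, hTN, chainVal N, chainNull N, hleN, ?_⟩
  intro j a
  by_contra! hcon
  have hr : L.Realizes N a (Γ j) := (hΓ j N a).2 hcon
  exact hom ⟨⟨j, ⟨N, hNstr⟩, hN, a, hr⟩⟩ ⟨a, hr⟩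

open Cardinal in
/-- Generic chains whose entries are tuples of elements. -/
theorem exists_generic_chain {L : ValuedLogic.{u}} (hfin : L.FiniteOccurrence)
    {κ : Cardinal.{u}} (hreg : κ.IsRegular) (hunc : ℵ₀ < κ) (hOTP : L.OmittingTypesProperty κ)
    (Sg : Signature.{u}) {n p : ℕ} {T : MetStr Sg.lang → Prop} (hT : L.AxiomatizableClass T)
    {le : Pt Sg.lang (Fin p ⊕ Fin p) → Prop} (hle : L.Axiomatizable le)
    {avoid : ℕ → Pt Sg.lang (Fin n ⊕ Fin p) → Prop} (havoid : ∀ j, L.Axiomatizable (avoid j))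
    (hmodel : ∃ M : Sg.Str, T M.1 ∧ ∃ x : Fin p → M.1, le ⟨M.1, Sum.elim x x⟩)
    (hext : ∀ M : Sg.Str, T M.1 → ∀ x x' : Fin p → M.1, le ⟨M.1, Sum.elim x x'⟩ →
      ∀ (j : ℕ) (a : Fin n → M.1), ∃ y : Fin p → M.1, le ⟨M.1, Sum.elim y y⟩ ∧
        (∀ z : Fin p → M.1, le ⟨M.1, Sum.elim z x⟩ → le ⟨M.1, Sum.elim z y⟩) ∧
        ¬ avoid j ⟨M.1, Sum.elim a y⟩) :
    ∃ M : Sg.Str, T M.1 ∧ ∃ c : κ.ord.ToType → Fin p → M.1,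
      (∀ β γ, β < γ → le ⟨M.1, Sum.elim (c β) (c γ)⟩) ∧
      ∀ (j : ℕ) (a : Fin n → M.1), ∃ β, ¬ avoid j ⟨M.1, Sum.elim a (c β)⟩ := by
  obtain ⟨M, hTM, c, _, h₁, h₂⟩ := exists_generic_chain_null hfin hreg hunc hOTP Sg
    (ν := PEmpty) hT (hle.pullback LHom.sumInl LHom.sumInl_injective id Function.injective_id)
    (fun j => (havoid j).pullback LHom.sumInl LHom.sumInl_injective id Function.injective_id)
    (by
      obtain ⟨M, hM, x, hx⟩ := hmodel
      exact ⟨M, hM, x, PEmpty.elim, hx⟩)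
    (by
      intro M hM x x' _ _ hx j a
      obtain ⟨y, h₁, h₂, h₃⟩ := hext M hM x x' hx j a
      exact ⟨y, PEmpty.elim, h₁, fun z _ => h₂ z, h₃⟩)
  exact ⟨M, hTM, c, h₁, h₂⟩

end Chain

/-! ### Upper semicontinuity of definable functions -/

section Pointed

theorem exists_modulus {X Y : Type*} [PseudoMetricSpace X] [PseudoMetricSpace Y] {n : ℕ}
    {f : (Fin n → X) → Y} (hf : UniformContinuous f) (ε : Set.Ioo (0 : ℚ) 1) :
    ∃ δ : Set.Ioo (0 : ℚ) 1, ∀ a b : Fin n → X,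
      (∀ i, dist (a i) (b i) < ((δ : ℚ) : ℝ)) → dist (f a) (f b) ≤ ((ε : ℚ) : ℝ) := by
  have hε : (0 : ℝ) < ((ε : ℚ) : ℝ) := by exact_mod_cast ε.2.1
  obtain ⟨δ, hδ, h⟩ := Metric.uniformContinuous_iff.1 hf _ hε
  obtain ⟨q, hq₀, hq⟩ := exists_rat_btwn (lt_min hδ (zero_lt_one' ℝ))
  have hq₀' : (0 : ℚ) < q := by exact_mod_cast hq₀
  have hq₁ : q < 1 := by exact_mod_cast hq.trans_le (min_le_right _ _)
  refine ⟨⟨q, hq₀', hq₁⟩, fun a b hab => (h ?_).le⟩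
  exact ((dist_pi_lt_iff hq₀).2 hab).trans (hq.trans_le (min_le_left _ _))

/-- A signature for which a given structure has the right moduli of uniform continuity. -/
def Signature.of (M : MetStr S) : Signature.{u} where
  lang := S
  opMod f ε := (exists_modulus (M.uniformContinuous_op f) ε).choose
  predMod R ε := (exists_modulus (M.uniformContinuous_pred R) ε).choose

theorem Signature.isStr_of (M : MetStr S) : (Signature.of M).IsStr M :=
  ⟨fun f ε => (exists_modulus (M.uniformContinuous_op f) ε).choose_spec,
    fun R ε => (exists_modulus (M.uniformContinuous_pred R) ε).choose_spec⟩

/-- The hypotheses on a logic from which its equivalence with basic continuous logic follows. -/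
structure OmittingLogic (L : ValuedLogic.{u}) (κ : Cardinal.{u}) : Prop where
  basic : L.HasBasic
  fin : L.FiniteOccurrence
  rel : L.PermitsRelativization
  comp : L.EquivalentToCompletions
  reg : κ.IsRegular
  unc : Cardinal.aleph0 < κ
  otp : L.OmittingTypesProperty κ

variable {L : ValuedLogic.{u}} {κ : Cardinal.{u}}

open ValuedLogic

/-- If `F[y]` comes arbitrarily close to `1` for tuples `y` arbitrarily close to `c`, then
`F[c] = 1`. Otherwise, a generic chain of tuples `y` with `F[y]` close to `1` and decreasing
distance to `c` would reach `c` after countably many steps, though its length is `κ`. -/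
theorem OmittingLogic.eq_one_of_approx (H : OmittingLogic L κ) {m : ℕ} {F : Pt S (Fin m) → ℝ}
    (hF : L.Definable F) (M : MetStr S) (c : Fin m → M)
    (h : ∀ ε > 0, ∃ y : Fin m → M, (∀ i, dist (y i) (c i) ≤ ε) ∧ 1 - ε ≤ F ⟨M, y⟩) :
    F ⟨M, c⟩ = 1 := by
  have hL := H.basic
  have hFI := hL.lukClosed.mem_Icc hF
  by_contra hne
  have hlt : F ⟨M, c⟩ < 1 := lt_of_le_of_ne (hFI _).2 hne
  obtain ⟨r, hr, hr1⟩ := exists_rat_btwn hlt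
  obtain ⟨s, hrs, hs1⟩ := exists_rat_btwn hr1
  have hr0 : (0 : ℝ) < r := (hFI _).1.trans_lt hr
  have hr0' : (0 : ℚ) ≤ r := by exact_mod_cast hr0.le
  have hr1' : r ≤ 1 := by exact_mod_cast hr1.le
  have hs0' : (0 : ℚ) ≤ s := hr0'.trans (by exact_mod_cast hrs.le)
  have hs1' : s ≤ 1 := by exact_mod_cast hs1.le
  let i₀ := S.lhomWithConstants (Fin m)
  have hi₀ : i₀.Injective := lhomWithConstants_injective _ _
  -- the values of the constants for `c`
  let cv : ∀ N : MetStr (S[[Fin m]]), Fin m → N := fun N i => N.constVal (newConst S i)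
  -- the distance to the constants
  obtain ⟨D, hD, hDle⟩ := (hL.lukClosed (S := S[[Fin m]]) (α := Fin m)).exists_finite_max
    (fun (i : Fin m) p => dist (p.1.termVal p.2 (.var i))
      (p.1.termVal p.2 (.func (newConst S i) Fin.elim0))) (fun i => hL.dist _ _)
  replace hDle : ∀ (N : MetStr (S[[Fin m]])) (y : Fin m → N) (ρ : ℝ), 0 ≤ ρ →
      (D ⟨N, y⟩ ≤ ρ ↔ ∀ i, dist (y i) (cv N i) ≤ ρ) := by
    intro N y ρ hρ
    rw [hDle _ _ hρ]
    refine forall_congr' fun i => ?_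
    change dist (y i) (N.op (newConst S i) _) ≤ ρ ↔ _
    rw [N.op_eq_constVal]
  let F' : Pt (S[[Fin m]]) (Fin m) → ℝ := fun p => F ⟨p.1.reduct i₀, p.2⟩
  have hF' : L.Definable F' := hF.pullback i₀ hi₀ id Function.injective_id
  have hF'c : ∀ (N : MetStr (S[[Fin m]])) (y : Fin m → N), D ⟨N, y⟩ ≤ 0 →
      F' ⟨N, y⟩ = F ⟨N.reduct i₀, cv N⟩ := by
    intro N y hy
    have : y = cv N := funext fun i => dist_le_zero.1 ((hDle N y 0 le_rfl).1 hy i)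
    rw [this]
  obtain ⟨G, hG, hGlub⟩ := hL.exists_isLUB (α := Empty) (Fin m) _
    ((hL.lukClosed.inf hF' (hL.lukClosed.compl hD)).rename Sum.inr Sum.inr_injective)
  let T : MetStr (S[[Fin m]]) → Prop := fun N =>
    F ⟨N.reduct i₀, cv N⟩ ≤ r ∧ ∀ v : Empty → N, G ⟨N, v⟩ = 1
  have hT : L.AxiomatizableClass T := by
    refine ((hL.le_rat hF hr0' hr1').subst i₀ (fun i => newConst S i)
      (constLHom_injective hi₀ newConst_injective ?_)).and (hG.eq_one.toClass hL)
    intro f a h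
    cases h
  have hTapprox : ∀ N, T N → ∀ ε > 0, ∃ y : Fin m → N, D ⟨N, y⟩ < ε ∧ 1 - ε < F' ⟨N, y⟩ := by
    intro N hN ε hε
    have h1 := hGlub ⟨N, Empty.elim⟩
    rw [hN.2 Empty.elim] at h1
    obtain ⟨_, ⟨y, rfl⟩, hy, -⟩ := h1.exists_between (show 1 - ε < 1 by linarith)
    obtain ⟨h2, h3⟩ := lt_min_iff.1 hy
    refine ⟨y, ?_, h2⟩
    have : 1 - ε < 1 - D ⟨N, y⟩ := h3
    linarith
  let le : Pt (S[[Fin m]]) (Fin m ⊕ Fin m) → Prop := fun p =>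
    ((s : ℝ) ≤ F' ⟨p.1, fun i => p.2 (Sum.inl i)⟩ ∧ (s : ℝ) ≤ F' ⟨p.1, fun i => p.2 (Sum.inr i)⟩) ∧
      D ⟨p.1, fun i => p.2 (Sum.inr i)⟩ ≤ D ⟨p.1, fun i => p.2 (Sum.inl i)⟩
  have hle : L.Axiomatizable le :=
    ((hL.rat_le (hF'.rename Sum.inl Sum.inl_injective) hs0' hs1').and
      (hL.rat_le (hF'.rename Sum.inr Sum.inr_injective) hs0' hs1') hL).and
      (hL.le (hD.rename Sum.inr Sum.inr_injective) (hD.rename Sum.inl Sum.inl_injective)) hL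
  let avoid : ℕ → Pt (S[[Fin m]]) (Fin 0 ⊕ Fin m) → Prop := fun j p =>
    ((1 / (j + 1) : ℚ) : ℝ) ≤ D ⟨p.1, fun i => p.2 (Sum.inr i)⟩
  have hjpos : ∀ j : ℕ, (0 : ℝ) < ((1 / (j + 1) : ℚ) : ℝ) := fun j => by positivity
  have havoid : ∀ j, L.Axiomatizable (avoid j) := by
    intro j
    refine hL.rat_le (hD.rename Sum.inr Sum.inr_injective) (by positivity) ?_
    rw [div_le_one (by positivity)]
    linarith [(Nat.cast_nonneg j : (0 : ℚ) ≤ j)]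
  have hs : (0 : ℝ) < 1 - s := by linarith
  have hmodel : ∃ N : (Signature.of (M.expand c)).Str, T N.1 ∧
      ∃ x : Fin m → N.1, le ⟨N.1, Sum.elim x x⟩ := by
    refine ⟨⟨M.expand c, Signature.isStr_of _⟩, ⟨hr.le, fun v => ?_⟩, ?_⟩
    · refine le_antisymm (hL.lukClosed.mem_Icc hG _).2 (le_of_forall_pos_le_add fun ε hε => ?_)
      obtain ⟨y, hy, hyF⟩ := h ε hε
      have h1 : D ⟨M.expand c, y⟩ ≤ ε := (hDle (M.expand c) y ε hε.le).2 hy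
      have h2 := (hGlub ⟨M.expand c, v⟩).1 ⟨y, rfl⟩
      have h3 : 1 - ε ≤ min (F' ⟨M.expand c, y⟩) (1 - D ⟨M.expand c, y⟩) :=
        le_min hyF (by linarith)
      have h4 := h3.trans h2
      linarith
    · obtain ⟨x, -, hx⟩ := h _ hs
      have hx' : (s : ℝ) ≤ F ⟨M, x⟩ := by linarith
      exact ⟨x, ⟨hx', hx'⟩, le_rfl⟩
  have hext : ∀ N : (Signature.of (M.expand c)).Str, T N.1 → ∀ x x' : Fin m → N.1,
      le ⟨N.1, Sum.elim x x'⟩ → ∀ (j : ℕ) (a : Fin 0 → N.1), ∃ y : Fin m → N.1,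
        le ⟨N.1, Sum.elim y y⟩ ∧
        (∀ z : Fin m → N.1, le ⟨N.1, Sum.elim z x⟩ → le ⟨N.1, Sum.elim z y⟩) ∧
        ¬ avoid j ⟨N.1, Sum.elim a y⟩ := by
    rintro ⟨N, hN⟩ hTN x x' ⟨⟨hx, -⟩, -⟩ j a
    replace hx : (s : ℝ) ≤ F' ⟨N, x⟩ := hx
    have hDx : 0 < D ⟨N, x⟩ := by
      by_contra hcon
      rw [hF'c N x (not_lt.1 hcon)] at hx
      linarith [hTN.1]
    obtain ⟨y, hyD, hyF⟩ := hTapprox N hTN (min (D ⟨N, x⟩) (min ((1 / (j + 1) : ℚ) : ℝ) (1 - s)))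
      (lt_min hDx (lt_min (hjpos j) hs))
    obtain ⟨h1, h2⟩ := lt_min_iff.1 hyD
    have hy : (s : ℝ) ≤ F' ⟨N, y⟩ := by
      have := (min_le_right (D ⟨N, x⟩) _).trans (min_le_right ((1 / (j + 1) : ℚ) : ℝ) (1 - (s : ℝ)))
      linarith
    refine ⟨y, ⟨⟨hy, hy⟩, le_rfl⟩, ?_, ?_⟩
    · rintro z ⟨⟨hz, -⟩, hzx⟩
      exact ⟨⟨hz, hy⟩, h1.le.trans hzx⟩
    · exact fun hcon => absurd (h2.trans_le (min_le_left _ _)) (not_lt.2 hcon)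
  obtain ⟨⟨N, _⟩, hTN, ch, hch, hch'⟩ := exists_generic_chain H.fin H.reg H.unc H.otp
    (Signature.of (M.expand c)) hT hle havoid hmodel hext
  choose β hβ using fun j => hch' j Fin.elim0
  obtain ⟨γ, hγ⟩ := exists_gt_of_countable H.reg H.unc (Set.countable_range β)
  have hDγ : ∀ j : ℕ, D ⟨N, ch γ⟩ ≤ ((1 / (j + 1) : ℚ) : ℝ) := by
    intro j
    have h1 : D ⟨N, ch γ⟩ ≤ D ⟨N, ch (β j)⟩ := (hch _ _ (hγ _ ⟨j, rfl⟩)).2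
    exact h1.trans (not_le.1 (hβ j)).le
  have hD0 : D ⟨N, ch γ⟩ ≤ 0 := by
    refine le_of_forall_pos_le_add fun ε hε => ?_
    obtain ⟨j, hj⟩ := exists_nat_one_div_lt hε
    refine (hDγ j).trans ?_
    push_cast
    linarith
  have h1 : (s : ℝ) ≤ F' ⟨N, ch γ⟩ := (hch _ _ (hγ _ ⟨0, rfl⟩)).1.2
  rw [hF'c _ _ hD0] at h1
  linarith [hTN.1]

/-! ### Making constants and nullary predicates vary -/

/-- The operation symbols of `S`, where constants have become unary. -/
inductive PointedFun (S : FirstOrder.Language.{u, u}) : ℕ → Type u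
  | fn {n : ℕ} (f : S.Functions (n + 1)) : PointedFun S (n + 1)
  | cst (c : S.Functions 0) : PointedFun S 1

/-- The predicate symbols of `S` of positive arity. -/
inductive PointedRel (S : FirstOrder.Language.{u, u}) : ℕ → Type u
  | rel {n : ℕ} (R : S.Relations (n + 1)) : PointedRel S (n + 1)

/-- The vocabulary `S` without its nullary predicates and with each constant replaced by a unary
operation symbol. In this vocabulary any family of structures has a disjoint union. -/
def pointed (S : FirstOrder.Language.{u, u}) : FirstOrder.Language.{u, u} :=
  ⟨PointedFun S, PointedRel S⟩

/-- The vocabulary `pointed S` together with the nullary predicates of `S`. The sentences in this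
vocabulary are relativized to the members of a family of structures, which have the same nullary
predicates. -/
abbrev pointedNull (S : FirstOrder.Language.{u, u}) : FirstOrder.Language.{u, u} :=
  (pointed S).sum (nullLang (S.Relations 0))

/-- The constant `c` as a unary operation symbol. -/
abbrev cstSymb (c : S.Functions 0) : (pointed S).Functions 1 := PointedFun.cst c

namespace MetStr

/-- The constants of `M` as constant unary operations. -/
def toPointed (M : MetStr S) : MetStr (pointed S) where
  carrier := M
  dist_le_one := M.dist_le_one
  op f v := match f with
    | .fn f => M.op f v
    | .cst c => M.constVal c
  pred R v := match R with
    | .rel R => M.pred R v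
  pred_mem {n} R v := by
    cases (R : PointedRel S n) with
    | rel R => exact M.pred_mem R v
  uniformContinuous_op f := match f with
    | .fn f => M.uniformContinuous_op f
    | .cst _ => uniformContinuous_const
  uniformContinuous_pred R := match R with
    | .rel R => M.uniformContinuous_pred R

/-- The operations of the `S`-structure obtained from `A` by evaluating the unary operations that
stand for constants at an arbitrary point. -/
def ofPointedOp (A : MetStr (pointed S)) : ∀ {n : ℕ}, S.Functions n → (Fin n → A) → A
  | 0, c, _ => A.op (cstSymb c) fun _ => Classical.arbitrary A
  | _ + 1, f, v => A.op (PointedFun.fn f : (pointed S).Functions _) v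

/-- The predicates of the `S`-structure obtained from `A` by giving the nullary predicates the truth
values `q`. -/
def ofPointedPred (A : MetStr (pointed S)) (q : S.Relations 0 → Set.Icc (0 : ℝ) 1) :
    ∀ {n : ℕ}, S.Relations n → (Fin n → A) → ℝ
  | 0, R, _ => q R
  | _ + 1, R, v => A.pred (PointedRel.rel R : (pointed S).Relations _) v

/-- The `S`-structure obtained from `A` by evaluating the unary operations that stand for constants
at an arbitrary point, and giving the nullary predicates the truth values `q`. -/
def ofPointed (A : MetStr (pointed S)) (q : S.Relations 0 → Set.Icc (0 : ℝ) 1) : MetStr S where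
  carrier := A
  dist_le_one := A.dist_le_one
  op f := A.ofPointedOp f
  pred R := A.ofPointedPred q R
  pred_mem {n} R v := by
    cases n with
    | zero => exact (q R).2
    | succ n => exact A.pred_mem (PointedRel.rel R : (pointed S).Relations _) v
  uniformContinuous_op {n} f := by
    cases n with
    | zero => exact uniformContinuous_const
    | succ n => exact A.uniformContinuous_op (PointedFun.fn f : (pointed S).Functions _)
  uniformContinuous_pred {n} R := by
    cases n with
    | zero => exact uniformContinuous_const
    | succ n => exact A.uniformContinuous_pred (PointedRel.rel R : (pointed S).Relations _)

end MetStr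

/-- The interpretation of `S` in `pointedNull S` with new constants for the constants of `S`. -/
def unpointHom {m : ℕ} (e : S.Functions 0 ≃ Fin m) : S →ᴸ (pointedNull S)[[Fin m]] where
  onFunction n f := match n, f with
    | 0, c => newConst (pointedNull S) (e c)
    | _ + 1, f => Sum.inl (Sum.inl (PointedFun.fn f))
  onRelation n R := match n, R with
    | 0, R => Sum.inl (newNull (pointed S) R)
    | _ + 1, R => Sum.inl (Sum.inl (PointedRel.rel R))

theorem unpointHom_injective {m : ℕ} (e : S.Functions 0 ≃ Fin m) : (unpointHom e).Injective where
  onFunction := by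
    rintro (_ | n) f g h
    · exact e.injective (newConst_injective h)
    · have : PointedFun.fn f = PointedFun.fn g := Sum.inl_injective (Sum.inl_injective h)
      cases this
      rfl
  onRelation := by
    rintro (_ | n) f g h
    · exact newNull_injective (Sum.inl_injective h)
    · have : PointedRel.rel f = PointedRel.rel g := Sum.inl_injective (Sum.inl_injective h)
      cases this
      rfl

/-- Whether `χ` has value `1` can be expressed, by countably many sentences, after turning the
constants into unary operations. The `n`-th sentence says that `χ[y]` comes arbitrarily close to `1`
for tuples `y` whose `n`-fold distance to the constants is arbitrarily small; semicontinuity takes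
care of the limit. -/
theorem OmittingLogic.exists_pointed_sentences (H : OmittingLogic L κ) [Finite (S.Functions 0)]
    (χ : L.Sent S) : ∃ Θ : ℕ → L.Sent (pointedNull S),
      (∀ M : MetStr S, L.Holds M χ → ∀ n, L.Holds (M.toPointed.expandNull M.nullVal) (Θ n)) ∧
      ∀ (A : MetStr (pointed S)) (q : S.Relations 0 → Set.Icc (0 : ℝ) 1),
        (∀ (c : S.Functions 0) a b, A.op (cstSymb c) a = A.op (cstSymb c) b) →
        (∀ n, L.Holds (A.expandNull q) (Θ n)) → L.Holds (A.ofPointed q) χ := by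
  have hL := H.basic
  obtain ⟨m, ⟨e⟩⟩ := Finite.exists_equiv_fin (S.Functions 0)
  let F : Pt (pointedNull S) (Fin m) → ℝ := fun p =>
    L.val χ ((p.1.expand p.2).reduct (unpointHom e))
  have hF : L.Definable F := ⟨L.map _ (unpointHom_injective e) χ, fun p => L.val_map _ _ _ _⟩
  let cs : Fin m → (pointedNull S).Functions 1 := fun i => Sum.inl (cstSymb (e.symm i))
  obtain ⟨D, hD, hDle⟩ := (hL.lukClosed (S := pointedNull S) (α := Fin m)).exists_finite_max
    (fun (i : Fin m) p => dist (p.1.termVal p.2 (.var i))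
      (p.1.termVal p.2 (.func (cs i) fun _ => .var i)))
      (fun i => hL.dist _ _)
  replace hDle : ∀ (A : MetStr (pointedNull S)) (y : Fin m → A) (ρ : ℝ), 0 ≤ ρ →
      (D ⟨A, y⟩ ≤ ρ ↔ ∀ i, dist (y i) (A.op (cs i) fun _ => y i) ≤ ρ) :=
    fun A y ρ hρ => hDle _ _ hρ
  have hDI := hL.lukClosed.mem_Icc hD
  have hG := fun n : ℕ => hL.exists_isLUB (α := Empty) (Fin m) _
    ((hL.lukClosed.inf hF (hL.lukClosed.compl (hL.lukClosed.truncMul hD n))).rename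
      Sum.inr Sum.inr_injective)
  choose G hG hGlub using hG
  choose Θ hΘ using fun n => (hG n).toSent
  refine ⟨Θ, ?_, ?_⟩
  · intro M hM n
    change L.val _ _ = 1
    rw [hΘ]
    refine le_antisymm (hL.lukClosed.mem_Icc (hG n) _).2 ?_
    let M' : MetStr (pointedNull S) := M.toPointed.expandNull M.nullVal
    let y : Fin m → M := fun i => M.constVal (e.symm i)
    refine le_trans ?_ ((hGlub n ⟨M', Empty.elim⟩).1 ⟨y, rfl⟩)
    have hD0 : D ⟨M', y⟩ = 0 := by
      refine le_antisymm ((hDle M' y 0 le_rfl).2 fun i => ?_) (hDI _).1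
      exact (dist_self (M.constVal (e.symm i))).le
    have hF1 : F ⟨M', y⟩ = 1 := by
      rw [← show L.val χ M = 1 from hM]
      refine L.val_congr χ (IsometryEquiv.refl M) ?_ ?_
      · rintro (_ | n) f v
        · refine Eq.trans ?_ (M.op_eq_constVal f v).symm
          exact congrArg M.constVal (e.symm_apply_apply f)
        · rfl
      · rintro (_ | n) R v
        · exact (M.pred_eq_nullVal R v).symm
        · rfl
    change 1 ≤ min (F ⟨M', y⟩) (1 - min (n * D ⟨M', y⟩) 1)
    rw [hD0, hF1]
    simp
  · intro A₀ q hA hΘA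
    let A : MetStr (pointedNull S) := A₀.expandNull q
    let c : Fin m → A := fun i => A₀.op (cstSymb (e.symm i)) fun _ => Classical.arbitrary A₀
    have hc : ∀ i a, A.op (cs i) a = c i := fun i a => hA _ _ _
    have key : F ⟨A, c⟩ = 1 := by
      refine H.eq_one_of_approx hF A c fun ε hε => ?_
      obtain ⟨n, hn⟩ := exists_nat_one_div_lt hε
      have hn0 : (0 : ℝ) < (n + 1 : ℕ) := by positivity
      have h1 := hGlub (n + 1) ⟨A, Empty.elim⟩
      rw [← hΘ, show L.val (Θ (n + 1)) A = 1 from hΘA _] at h1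
      obtain ⟨_, ⟨y, rfl⟩, hy, -⟩ := h1.exists_between (show 1 - min ε 1 < 1 by
        linarith [lt_min hε (zero_lt_one' ℝ)])
      obtain ⟨h2, h3⟩ := lt_min_iff.1 hy
      replace h2 : 1 - min ε 1 < F ⟨A, y⟩ := h2
      replace h3 : 1 - min ε 1 < 1 - min ((n + 1 : ℕ) * D ⟨A, y⟩) 1 := h3
      refine ⟨y, fun i => ?_, by linarith [min_le_left ε 1]⟩
      rw [← hc i fun _ => y i]
      refine (hDle A y ε hε.le).1 ?_ i
      have h4 : min ((n + 1 : ℕ) * D ⟨A, y⟩) 1 < 1 := by linarith [min_le_right ε 1]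
      have h5 : (n + 1 : ℕ) * D ⟨A, y⟩ < 1 := by
        rcases min_lt_iff.1 h4 with h | h
        · exact h
        · exact absurd h (lt_irrefl _)
      have h6 : D ⟨A, y⟩ < 1 / ((n + 1 : ℕ) : ℝ) := by
        rw [lt_div_iff₀ hn0, mul_comm]
        exact h5
      push_cast at h6
      linarith
    rw [Holds, ← key]
    refine L.val_congr χ (IsometryEquiv.refl A) ?_ ?_
    · rintro (_ | n) f v
      · change A₀.op (cstSymb f) _ = A₀.op (cstSymb (e.symm (e f))) _
        rw [e.symm_apply_apply]
      · rfl
    · rintro (_ | n) R v <;> rfl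

end Pointed

/-! ### Back-and-forth games and formulas of basic continuous logic -/

/-- The pairs in `l` agree up to `ε` on all unnested atomic formulas. -/
structure Close (ε : ℝ) (M N : MetStr S) (l : List (M × N)) : Prop where
  dist : ∀ e ∈ l, ∀ e' ∈ l, |dist e.1 e'.1 - dist e.2 e'.2| ≤ ε
  pred : ∀ {n : ℕ} (R : S.Relations n) (e : Fin n → M × N), (∀ i, e i ∈ l) →
    |M.pred R (fun i => (e i).1) - N.pred R (fun i => (e i).2)| ≤ ε
  op : ∀ {n : ℕ} (f : S.Functions n) (e : Fin n → M × N), (∀ i, e i ∈ l) → ∀ e' ∈ l,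
    |Dist.dist (M.op f (fun i => (e i).1)) e'.1 - Dist.dist (N.op f (fun i => (e i).2)) e'.2| ≤ ε

/-- The second player can survive `n` more rounds of the back-and-forth game from the position
`l`, keeping the pairs close up to `ε`. -/
def Win (ε : ℝ) (M N : MetStr S) : ℕ → List (M × N) → Prop
  | 0, l => Close ε M N l
  | n + 1, l => Close ε M N l ∧ (∀ a, ∃ b, Win ε M N n ((a, b) :: l)) ∧
      ∀ b, ∃ a, Win ε M N n ((a, b) :: l)

theorem Win.close {ε : ℝ} {M N : MetStr S} : ∀ {n : ℕ} {l : List (M × N)},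
    Win ε M N n l → Close ε M N l
  | 0, _, h => h
  | _ + 1, _, h => h.1

namespace Formula

/-- The truth functions of the formulas of basic continuous logic. -/
def IsTruthFunction {n : ℕ} (F : Pt S (Fin n) → ℝ) : Prop :=
  ∃ θ : Formula S n, ∀ p : Pt S (Fin n), θ.val p.1 p.2 = F p

theorem lukClosed {n : ℕ} : LukClosed (IsTruthFunction (S := S) (n := n)) where
  mem_Icc := by
    rintro F ⟨θ, hθ⟩ x
    exact hθ x ▸ θ.val_mem _ _
  const r h0 h1 := ⟨.const r h0 h1, fun _ => rfl⟩
  imp := by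
    rintro F G ⟨θ, hθ⟩ ⟨θ', hθ'⟩
    exact ⟨.imp θ θ', fun p => congrArg₂ lukImp (hθ p) (hθ' p)⟩

theorem isTruthFunction_val {n : ℕ} (θ : Formula S n) :
    IsTruthFunction fun p : Pt S (Fin n) => θ.val p.1 p.2 := ⟨θ, fun _ => rfl⟩

theorem exists_grid {m : ℕ} (hm : 0 < m) {x : ℝ} (hx : x ∈ Set.Icc (0 : ℝ) 1) :
    ∃ k : Fin (m + 1), |x - (((k : ℕ) / m : ℚ) : ℝ)| ≤ 1 / m := by
  have hm' : (0 : ℝ) < m := by exact_mod_cast hm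
  have hxm : 0 ≤ x * m := mul_nonneg hx.1 hm'.le
  have h1 := Nat.floor_le hxm
  have h2 := Nat.lt_floor_add_one (x * m)
  have h3 : ⌊x * m⌋₊ ≤ m := by
    refine Nat.floor_le_of_le ?_
    nlinarith [hx.2]
  refine ⟨⟨⌊x * m⌋₊, by omega⟩, ?_⟩
  push_cast
  have : x - (⌊x * m⌋₊ : ℝ) / m = (x * m - ⌊x * m⌋₊) / m := by field_simp
  rw [this, abs_of_nonneg (div_nonneg (by linarith) hm'.le)]
  gcongr
  linarith

/-- Quantification over one variable: for a finite grid of values `p` of the formulas in `Θ`, the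
formula `inf_a max_θ |θ(x̄, a) - p_θ|` tells how close to `p` these values can be made. -/
theorem exists_finite_forth {j : ℕ} {Θ : Set (Formula S (j + 1))} (hΘ : Θ.Finite) {δ : ℝ}
    (hδ : 0 < δ) : ∃ Θ' : Set (Formula S j), Θ'.Finite ∧ ∃ δ' > 0,
      ∀ (M N : MetStr S) (v : Fin j → M) (w : Fin j → N),
        (∀ θ ∈ Θ', |θ.val M v - θ.val N w| ≤ δ') →
          ∀ a : M, ∃ b : N, ∀ θ ∈ Θ, |θ.val M (Fin.snoc v a : Fin (j + 1) → M) -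
            θ.val N (Fin.snoc w b : Fin (j + 1) → N)| ≤ δ := by
  have := hΘ.to_subtype
  obtain ⟨m, hm⟩ := exists_nat_one_div_lt (show 0 < δ / 4 by linarith)
  have hgrid : ∀ (p : Θ → Fin (m + 1 + 1)), ∃ G : Pt S (Fin (j + 1)) → ℝ, IsTruthFunction G ∧
      ∀ x (r : ℝ), 0 ≤ r → (G x ≤ r ↔
        ∀ θ : Θ, |θ.1.val x.1 x.2 - (((p θ : ℕ) / (m + 1 : ℕ) : ℚ) : ℝ)| ≤ r) := fun p =>
    lukClosed.exists_finite_max _ fun θ => lukClosed.absSub (isTruthFunction_val θ.1)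
      (lukClosed.const _ (by positivity) (by
        rw [div_le_one (by positivity)]
        exact_mod_cast Nat.lt_succ_iff.1 (p θ).2))
  choose G hG hGle using hgrid
  choose γ hγ using fun p => lukClosed.compl (hG p)
  have hGI := fun p => lukClosed.mem_Icc (hG p)
  refine ⟨Set.range fun p => Formula.ex (γ p), Set.finite_range _, δ / 4, by linarith, ?_⟩
  intro M N v w hvw a
  have hp : ∀ θ : Θ, ∃ k : Fin (m + 1 + 1), |θ.1.val M (Fin.snoc v a : Fin (j + 1) → M) -
      (((k : ℕ) / (m + 1 : ℕ) : ℚ) : ℝ)| ≤ 1 / (m + 1 : ℕ) :=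
    fun θ => exists_grid m.succ_pos (θ.1.val_mem _ _)
  choose p hp using hp
  have hm' : (1 : ℝ) / (m + 1 : ℕ) < δ / 4 := by push_cast; exact hm
  have hval : ∀ (K : MetStr S) (x : Fin j → K), (Formula.ex (γ p)).val K x =
      ⨆ c : K, (1 - G p ⟨K, (Fin.snoc x c : Fin (j + 1) → K)⟩) :=
    fun K x => iSup_congr fun c => hγ p ⟨K, _⟩
  have hbdd : ∀ (K : MetStr S) (x : Fin j → K), BddAbove (Set.range fun c : K =>
      (1 - G p ⟨K, (Fin.snoc x c : Fin (j + 1) → K)⟩)) := fun K x =>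
    ⟨1, by
      rintro _ ⟨c, rfl⟩
      dsimp only
      linarith [(hGI p ⟨K, (Fin.snoc x c : Fin (j + 1) → K)⟩).1]⟩
  have h1 : 1 - δ / 4 ≤ (Formula.ex (γ p)).val M v := by
    rw [hval]
    refine le_trans ?_ (le_ciSup (hbdd M v) a)
    have : G p ⟨M, (Fin.snoc v a : Fin (j + 1) → M)⟩ ≤ 1 / (m + 1 : ℕ) :=
      (hGle p _ _ (by positivity)).2 hp
    linarith
  have h2 : 1 - 3 * δ / 4 < (Formula.ex (γ p)).val N w := by
    have := (abs_le.1 (hvw _ ⟨p, rfl⟩)).2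
    linarith
  rw [hval] at h2
  obtain ⟨b, hb⟩ := exists_lt_of_lt_ciSup h2
  refine ⟨b, fun θ hθ => ?_⟩
  have h3 := (hGle p ⟨N, (Fin.snoc w b : Fin (j + 1) → N)⟩ (3 * δ / 4) (by linarith)).1
    (by linarith) ⟨θ, hθ⟩
  have h4 := hp ⟨θ, hθ⟩
  rw [abs_le] at h3 h4 ⊢
  constructor <;> linarith [h3.1, h3.2, h4.1, h4.2]

theorem exists_finite_close [Finite S.Symbols] (j : ℕ) (ε : ℝ) :
    ∃ Θ : Set (Formula S j), Θ.Finite ∧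
      ∀ (M N : MetStr S) (v : Fin j → M) (w : Fin j → N),
        (∀ θ ∈ Θ, |θ.val M v - θ.val N w| ≤ ε) →
          ∀ l : List (M × N), (∀ e ∈ l, ∃ i, e = (v i, w i)) → Close ε M N l := by
  have hf : Finite (Σ n, S.Functions n) :=
    Finite.of_injective (fun f => (Sum.inl f : S.Symbols)) Sum.inl_injective
  have hr : Finite (Σ n, S.Relations n) :=
    Finite.of_injective (fun f => (Sum.inr f : S.Symbols)) Sum.inr_injective
  refine ⟨(Set.range fun q : Fin j × Fin j => Formula.eqd (.var q.1) (.var q.2)) ∪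
    ((Set.range fun q : Σ R : (Σ n, S.Relations n), Fin R.1 → Fin j =>
      Formula.rel q.1.2 fun i => .var (q.2 i)) ∪
    Set.range fun q : (Σ f : (Σ n, S.Functions n), Fin f.1 → Fin j) × Fin j =>
      Formula.eqd (.func q.1.1.2 fun i => .var (q.1.2 i)) (.var q.2)),
    (Set.finite_range _).union ((Set.finite_range _).union (Set.finite_range _)), ?_⟩
  intro M N v w h l hl
  refine ⟨?_, ?_, ?_⟩
  · intro e he e' he'
    obtain ⟨i, rfl⟩ := hl e he
    obtain ⟨i', rfl⟩ := hl e' he'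
    exact h _ (Or.inl ⟨(i, i'), rfl⟩)
  · intro n R e he
    choose σ hσ using fun i => hl (e i) (he i)
    obtain rfl : e = fun i => (v (σ i), w (σ i)) := funext hσ
    exact h _ (Or.inr (Or.inl ⟨⟨⟨n, R⟩, σ⟩, rfl⟩))
  · intro n f e he e' he'
    choose σ hσ using fun i => hl (e i) (he i)
    obtain rfl : e = fun i => (v (σ i), w (σ i)) := funext hσ
    obtain ⟨i', rfl⟩ := hl e' he'
    exact h _ (Or.inr (Or.inr ⟨⟨⟨⟨n, f⟩, σ⟩, i'⟩, rfl⟩))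

/-- Structures that almost agree on finitely many suitable formulas are indistinguishable in the
back-and-forth game of a given length and precision. -/
theorem exists_finite_win [Finite S.Symbols] {ε : ℝ} (hε : 0 < ε) (n : ℕ) : ∀ j : ℕ,
    ∃ Θ : Set (Formula S j), Θ.Finite ∧ ∃ δ > 0,
      ∀ (M N : MetStr S) (v : Fin j → M) (w : Fin j → N),
        (∀ θ ∈ Θ, |θ.val M v - θ.val N w| ≤ δ) →
          ∀ l : List (M × N), (∀ e ∈ l, ∃ i, e = (v i, w i)) → Win ε M N n l := by
  induction n with
  | zero =>
    intro j
    obtain ⟨Θ, hΘ, h⟩ := exists_finite_close (S := S) j ε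
    exact ⟨Θ, hΘ, ε, hε, h⟩
  | succ n ih =>
    intro j
    obtain ⟨Θ₀, hΘ₀, h₀⟩ := exists_finite_close (S := S) j ε
    obtain ⟨Θ₁, hΘ₁, δ₁, hδ₁, h₁⟩ := ih (j + 1)
    obtain ⟨Θ₂, hΘ₂, δ₂, hδ₂, h₂⟩ := exists_finite_forth hΘ₁ hδ₁
    refine ⟨Θ₀ ∪ Θ₂, hΘ₀.union hΘ₂, min ε δ₂, lt_min hε hδ₂, ?_⟩
    intro M N v w h l hl
    have hcons : ∀ (a : M) (b : N), ∀ e ∈ (a, b) :: l, ∃ i : Fin (j + 1),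
        e = ((Fin.snoc v a : Fin (j + 1) → M) i, (Fin.snoc w b : Fin (j + 1) → N) i) := by
      intro a b e he
      rcases List.mem_cons.1 he with rfl | he
      · exact ⟨Fin.last j, by simp⟩
      · obtain ⟨i, rfl⟩ := hl e he
        exact ⟨i.castSucc, by simp⟩
    refine ⟨h₀ M N v w (fun θ hθ => (h θ (Or.inl hθ)).trans (min_le_left _ _)) l hl, ?_, ?_⟩
    · intro a
      obtain ⟨b, hb⟩ := h₂ M N v w
        (fun θ hθ => (h θ (Or.inr hθ)).trans (min_le_right _ _)) a
      exact ⟨b, h₁ M N _ _ hb _ (hcons a b)⟩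
    · intro b
      obtain ⟨a, ha⟩ := h₂ N M w v
        (fun θ hθ => by rw [abs_sub_comm]; exact (h θ (Or.inr hθ)).trans (min_le_right _ _)) b
      exact ⟨a, h₁ M N _ _ (fun θ hθ => by rw [abs_sub_comm]; exact ha θ hθ) _ (hcons a b)⟩

end Formula

/-! ### Completions -/

theorem exists_uniform_extension {X Y Z : Type*} [UniformSpace X] [UniformSpace Y]
    [UniformSpace Z] [CompleteSpace Z] [T0Space Z] {e : X → Y} (he : IsUniformInducing e)
    (hd : DenseRange e) {f : X → Z} (hf : UniformContinuous f) :
    ∃ g : Y → Z, UniformContinuous g ∧ ∀ x, g (e x) = f x :=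
  ⟨_, uniformContinuous_uniformly_extend he hd hf, uniformly_extend_of_ind he hd hf⟩

theorem isUniformInducing_comp {X Y : Type*} [PseudoMetricSpace X] [PseudoMetricSpace Y] {e : X → Y}
    (he : Isometry e) (n : ℕ) : IsUniformInducing fun (v : Fin n → X) i => e (v i) :=
  (Isometry.piMap (fun _ => e) fun _ => he).isUniformInducing

theorem denseRange_comp {X Y : Type*} [TopologicalSpace Y] {e : X → Y}
    (he : DenseRange e) (n : ℕ) : DenseRange fun (v : Fin n → X) i => e (v i) :=
  DenseRange.piMap fun _ => he

theorem MetStr.exists_isCompletion (M : MetStr S) : ∃ C : MetStr S, M.IsCompletion C := by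
  let C := UniformSpace.Completion M
  let e : M → C := fun x => (x : UniformSpace.Completion M)
  have he : Isometry e := UniformSpace.Completion.coe_isometry
  have hd : DenseRange e := UniformSpace.Completion.denseRange_coe
  have hC : CompleteSpace C := inferInstanceAs (CompleteSpace (UniformSpace.Completion M))
  have hop : ∀ {n : ℕ} (f : S.Functions n), ∃ g : (Fin n → C) → C, UniformContinuous g ∧
      ∀ x : Fin n → M, g (fun i => e (x i)) = e (M.op f x) := fun f =>
    exists_uniform_extension (isUniformInducing_comp he _) (denseRange_comp hd _)
      (he.uniformContinuous.comp (M.uniformContinuous_op f))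
  have hpred : ∀ {n : ℕ} (R : S.Relations n), ∃ g : (Fin n → C) → ℝ, UniformContinuous g ∧
      ∀ x : Fin n → M, g (fun i => e (x i)) = M.pred R x := fun R =>
    exists_uniform_extension (isUniformInducing_comp he _) (denseRange_comp hd _)
      (M.uniformContinuous_pred R)
  choose op hopu hop using @hop
  choose pred hpredu hpred using @hpred
  have hne : Nonempty C := ⟨e (Classical.arbitrary M)⟩
  refine ⟨{ carrier := C
            dist_le_one := fun a b => ?_
            op := op
            pred := pred
            pred_mem := fun R a => ?_
            uniformContinuous_op := hopu
            uniformContinuous_pred := hpredu }, hC, e, he, hd, ?_, ?_⟩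
  · refine hd.induction_on₂ (p := fun a b => dist a b ≤ 1) ?_ (fun x y => ?_) a b
    · exact isClosed_le continuous_dist continuous_const
    · rw [he.dist_eq]
      exact M.dist_le_one x y
  · refine (denseRange_comp hd _).induction_on (p := fun a => pred R a ∈ Set.Icc (0 : ℝ) 1) a ?_ ?_
    · exact isClosed_Icc.preimage (hpredu R).continuous
    · intro x
      rw [hpred]
      exact M.pred_mem R x
  · exact fun f a => (hop f a).symm
  · exact fun R a => (hpred R a).symm

/-- Structures with dense subsets that match under a map preserving the unnested atomic formulas
have a common completion. -/
theorem MetStr.exists_common_completion (M N : MetStr S) {Z : Type*} (a : Z → M) (b : Z → N)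
    (ha : DenseRange a) (hb : DenseRange b)
    (hdist : ∀ z z', dist (a z) (a z') = dist (b z) (b z'))
    (hpred : ∀ {n : ℕ} (R : S.Relations n) (z : Fin n → Z),
      M.pred R (fun i => a (z i)) = N.pred R (fun i => b (z i)))
    (hop : ∀ {n : ℕ} (f : S.Functions n) (z : Fin n → Z) (z' : Z),
      dist (M.op f (fun i => a (z i))) (a z') = dist (N.op f (fun i => b (z i))) (b z')) :
    ∃ C : MetStr S, M.IsCompletion C ∧ N.IsCompletion C := by
  obtain ⟨C, hC, e, he, hde, heop, hepred⟩ := M.exists_isCompletion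
  refine ⟨C, ⟨hC, e, he, hde, heop, hepred⟩, hC, ?_⟩
  let : PseudoMetricSpace Z := PseudoMetricSpace.induced b inferInstance
  have hbi : Isometry b := Isometry.of_dist_eq fun _ _ => rfl
  have hei : Isometry fun z => e (a z) := Isometry.of_dist_eq fun z z' => by
    rw [he.dist_eq, hdist]
    rfl
  obtain ⟨e', he'u, he'⟩ := exists_uniform_extension hbi.isUniformInducing hb hei.uniformContinuous
  have hdea : DenseRange fun z => e (a z) := hde.comp ha he.continuous
  have hiso : Isometry e' := by
    refine Isometry.of_dist_eq fun x y => ?_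
    refine hb.induction_on₂ (p := fun x y => dist (e' x) (e' y) = dist x y) ?_ (fun z z' => ?_) x y
    · exact isClosed_eq ((he'u.continuous.comp continuous_fst).dist
        (he'u.continuous.comp continuous_snd)) continuous_dist
    · rw [he', he', he.dist_eq, hdist]
  refine ⟨e', hiso, ?_, ?_, ?_⟩
  · refine hdea.mono ?_
    rintro _ ⟨z, rfl⟩
    exact ⟨b z, he' z⟩
  · intro n f y
    refine (denseRange_comp hb n).induction_on
      (p := fun y => e' (N.op f y) = C.op f fun i => e' (y i)) y ?_ fun z => ?_
    · refine isClosed_eq (he'u.continuous.comp (N.uniformContinuous_op f).continuous)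
        ((C.uniformContinuous_op f).continuous.comp ?_)
      exact continuous_pi fun i => he'u.continuous.comp (continuous_apply i)
    · simp only [he']
      rw [← heop]
      have key : (fun x => dist (e' (N.op f fun i => b (z i))) x) =
          fun x => dist (e (M.op f fun i => a (z i))) x := by
        refine hdea.equalizer (continuous_const.dist continuous_id)
          (continuous_const.dist continuous_id) (funext fun z' => ?_)
        change dist _ (e (a z')) = dist _ (e (a z'))
        rw [he.dist_eq, hop, ← he', hiso.dist_eq]
      have := congrFun key (e' (N.op f fun i => b (z i)))
      rw [dist_self] at this
      exact (dist_eq_zero.1 this.symm).symm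
  · intro n R y
    refine (denseRange_comp hb n).induction_on
      (p := fun y => N.pred R y = C.pred R fun i => e' (y i)) y ?_ fun z => ?_
    · refine isClosed_eq (N.uniformContinuous_pred R).continuous
        ((C.uniformContinuous_pred R).continuous.comp ?_)
      exact continuous_pi fun i => he'u.continuous.comp (continuous_apply i)
    · simp only [he']
      rw [← hepred, hpred]

/-! ### Systems of back-and-forth positions -/

/-- The operation symbols `g b` of `sysAux`. -/
inductive SysFun : ℕ → Type
  | g (b : Bool) : SysFun 1

/-- The predicate symbols of `sysAux`. -/
inductive SysRel : ℕ → Type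
  | rk (n : ℕ) : SysRel 1
  | fib (b : Bool) : SysRel 2
  | pre : SysRel 2
  | step : SysRel 2

/-- The vocabulary of back-and-forth positions: a position `x` is played on the pair of structures
with universes `fib true x` and `fib false x`, its last move consists of the points `g true x` and
`g false x`, at least `n` further rounds can be played if `rk n x`; moreover `pre x y` says that the
game can proceed from `x` to `y`, and `step x y` that it can do so in a single round. -/
def sysAux : FirstOrder.Language.{0, 0} := ⟨SysFun, SysRel⟩

/-- The vocabulary of a system of back-and-forth positions, where the games are played on pairs of
`S`-structures. The constants of `S` have become unary operations, as they may differ between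
the structures of the system. -/
abbrev sysLang (S : FirstOrder.Language.{u, u}) : FirstOrder.Language.{u, u} :=
  (pointed S).sum sysAux

/-- The predicate symbols of `pointed S` in `sysLang S`. -/
abbrev baseSymb {n : ℕ} (R : (pointed S).Relations n) : (sysLang S).Relations n := Sum.inl R

/-- The auxiliary predicate symbols of `sysLang S`. -/
abbrev sysSymb (S : FirstOrder.Language.{u, u}) {n : ℕ} (R : SysRel n) : (sysLang S).Relations n :=
  Sum.inr R

namespace MetStr

variable (M : MetStr (sysLang S))

/-- The last move at `x` in the structure with index `b`. -/
def g (b : Bool) (x : M) : M := M.op (n := 1) (Sum.inr (SysFun.g b)) fun _ => x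

/-- At least `n` further rounds can be played from `x`. -/
def rk (n : ℕ) (x : M) : ℝ := M.pred (sysSymb S (.rk n)) fun _ => x

/-- `y` belongs to the structure with index `b` that the game with position `x` is played on. -/
def fib (b : Bool) (x y : M) : ℝ := M.pred (sysSymb S (.fib b)) ![x, y]

/-- The game may proceed from `x` to `y`. -/
def pre (x y : M) : ℝ := M.pred (sysSymb S .pre) ![x, y]

/-- The game may proceed from `x` to `y` in one round. -/
def step (x y : M) : ℝ := M.pred (sysSymb S .step) ![x, y]

/-- The operations of `pointed S` in a system. -/
def bop {n : ℕ} (f : (pointed S).Functions n) (v : Fin n → M) : M := M.op (Sum.inl f) v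

/-- The predicates of `pointed S` in a system. -/
def bpred {n : ℕ} (R : (pointed S).Relations n) (v : Fin n → M) : ℝ :=
  M.pred (baseSymb R) v

end MetStr

/-- The sets `fib b x` are universes of `pointed S`-structures. -/
structure HasFibers (M : MetStr (sysLang S)) : Prop where
  zero_or_one : ∀ b x y, M.fib b x y = 0 ∨ M.fib b x y = 1
  nonempty : ∀ b x, ∃ y, M.fib b x y = 1
  closed : ∀ b x {n : ℕ} (f : (pointed S).Functions n) (t : Fin n → M),
    (∀ i, M.fib b x (t i) = 1) → M.fib b x (M.bop f t) = 1

/-- The structure with universe `fib b x`. -/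
def HasFibers.str {M : MetStr (sysLang S)} (h : HasFibers M) (b : Bool) (x : M) :
    MetStr (pointed S) :=
  (M.reduct (LHom.sumInl : pointed S →ᴸ sysLang S)).restrict {y | M.fib b x y = 1}
    (h.nonempty b x) fun f a ha => h.closed b x f a ha

/-- The vocabulary map that interprets the symbol for a family of predicates by `fib b`. -/
def fibHom (S : FirstOrder.Language.{u, u}) (ν : Type u) (b : Bool) :
    ((pointed S).sum (nullLang ν)).sum binRel →ᴸ (sysLang S).sum (nullLang ν) where
  onFunction _ f := match f with
    | Sum.inl (Sum.inl f) => Sum.inl (Sum.inl f)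
    | Sum.inl (Sum.inr e) => PEmpty.elim e
    | Sum.inr e => Empty.elim e
  onRelation _ R := match R with
    | Sum.inl (Sum.inl R) => Sum.inl (Sum.inl R)
    | Sum.inl (Sum.inr r) => Sum.inr r
    | Sum.inr .rel => Sum.inl (Sum.inr (SysRel.fib b))

theorem fibHom_injective (ν : Type u) (b : Bool) : (fibHom S ν b).Injective where
  onFunction := by
    rintro n ((f | f) | f) ((f' | f') | f') h
    · exact congrArg _ (congrArg _ (Sum.inl_injective (Sum.inl_injective h)))
    all_goals first
      | exact PEmpty.elim f
      | exact PEmpty.elim f'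
      | exact Empty.elim f
      | exact Empty.elim f'
  onRelation := by
    rintro n ((f | f) | f) ((f' | f') | f') h
    · exact congrArg _ (congrArg _ (Sum.inl_injective (Sum.inl_injective h)))
    · cases h
    · cases (f' : BinRelSymb n)
      cases Sum.inl_injective h
    · cases h
    · exact congrArg _ (congrArg _ (Sum.inr_injective h))
    · cases (f' : BinRelSymb n)
      cases h
    · cases (f : BinRelSymb n)
      cases Sum.inl_injective h
    · cases (f : BinRelSymb n)
      cases h
    · cases (f : BinRelSymb n)
      cases (f' : BinRelSymb 2)
      rfl

/-- A sentence relativized to the structures with universe `fib b x`, as a function of `x`. -/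
theorem ValuedLogic.PermitsRelativization.exists_definable {L : ValuedLogic.{u}}
    (hrel : L.PermitsRelativization) {ν : Type u} (Θ : L.Sent ((pointed S).sum (nullLang ν)))
    (b : Bool) :
    ∃ F : Pt ((sysLang S).sum (nullLang ν)) (Fin 1) → ℝ, L.Definable F ∧
      ∀ (M : MetStr (sysLang S)) (h : HasFibers M) (q : ν → Set.Icc (0 : ℝ) 1) (x : M),
        F ⟨M.expandNull q, fun _ => x⟩ = L.val Θ ((h.str b x).expandNull q) := by
  obtain ⟨ψ, hψ⟩ := hrel _ Θ
  refine ⟨_, (ValuedLogic.definable_expand ψ).pullback (fibHom S ν b) (fibHom_injective ν b) id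
    Function.injective_id, fun M h q x => ?_⟩
  refine (hψ ((M.expandNull q).reduct (fibHom S ν b)) (h.zero_or_one b) (h.nonempty b) ?_ x).trans
    (L.val_congr Θ (IsometryEquiv.refl _) ?_ ?_)
  · rintro y n (f | e) a ha
    · exact h.closed b y f a ha
    · exact PEmpty.elim e
  · rintro n (f | e) a
    · rfl
    · exact PEmpty.elim e
  · rintro n (R | r) a <;> rfl

/-- The axioms of systems of back-and-forth positions. All of them can be expressed by countably
many sentences of continuous logic: a condition on a relation `P` with values `0` and `1` occurs as
`P = 0 ∨ ⋯`, and existence is expressed by a supremum that equals `1`. The last three axioms say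
that if `n` rounds are left at `x`, then the pairs `(g true z, g false z)`, for the positions `z`
before `x`, agree up to `1 / (n + 1)` on the unnested atomic formulas of positive arity. -/
structure IsSystem (M : MetStr (sysLang S)) : Prop where
  fib_or : ∀ b x y, M.fib b x y = 0 ∨ M.fib b x y = 1
  rk_or : ∀ n x, M.rk n x = 0 ∨ M.rk n x = 1
  pre_or : ∀ x y, M.pre x y = 0 ∨ M.pre x y = 1
  step_or : ∀ x y, M.step x y = 0 ∨ M.step x y = 1
  fib_nonempty : ∀ b x, ⨆ y, M.fib b x y = 1
  fib_op : ∀ b (q : Σ n, (pointed S).Functions n) x (t : Fin q.1 → M),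
    (∃ i, M.fib b x (t i) = 0) ∨ M.fib b x (M.bop q.2 t) = 1
  fib_cst : ∀ b (c : S.Functions 0) x y z, M.fib b x y = 0 ∨ M.fib b x z = 0 ∨
    dist (M.bop (n := 1) (PointedFun.cst c) fun _ => y)
      (M.bop (n := 1) (PointedFun.cst c) fun _ => z) = 0
  pre_fib : ∀ b x y z, M.pre x y = 0 ∨ (M.fib b x z ≤ M.fib b y z ∧ M.fib b y z ≤ M.fib b x z)
  pre_g : ∀ b z x, M.pre z x = 0 ∨ M.fib b x (M.g b z) = 1
  pre_trans : ∀ x y z, M.pre x y = 0 ∨ M.pre y z = 0 ∨ M.pre x z = 1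
  pre_refl : ∀ x, M.rk 0 x = 0 ∨ M.pre x x = 1
  rk_succ : ∀ n x, M.rk (n + 1) x ≤ M.rk n x
  rk_step : ∀ n x y, M.rk (n + 1) x = 0 ∨ M.step x y = 0 ∨ M.rk n y = 1
  step_pre : ∀ x y, M.step x y ≤ M.pre x y
  forth : ∀ b x a, M.rk 1 x = 0 ∨ M.fib b x a = 0 ∨
    ⨆ y, min (M.step x y) (1 - dist (M.g b y) a) = 1
  exists_rk : ∀ n, ∀ _ : Fin 0 → M, ⨆ x, M.rk n x = 1
  close_dist : ∀ (n : ℕ) x z z', M.rk n x = 0 ∨ M.pre z x = 0 ∨ M.pre z' x = 0 ∨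
    |dist (M.g true z) (M.g true z') - dist (M.g false z) (M.g false z')| ≤ ((1 / (n + 1) : ℚ) : ℝ)
  close_pred : ∀ (n : ℕ) (q : Σ n, (pointed S).Relations n) x (z : Fin q.1 → M), M.rk n x = 0 ∨
    (∃ i, M.pre (z i) x = 0) ∨
    |M.bpred q.2 (fun i => M.g true (z i)) - M.bpred q.2 (fun i => M.g false (z i))| ≤
      ((1 / (n + 1) : ℚ) : ℝ)
  close_op : ∀ (n : ℕ) (q : Σ n, (pointed S).Functions n) x z' (z : Fin q.1 → M), M.rk n x = 0 ∨
    (∃ i, M.pre (z i) x = 0) ∨ M.pre z' x = 0 ∨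
    |dist (M.bop q.2 (fun i => M.g true (z i))) (M.g true z') -
      dist (M.bop q.2 (fun i => M.g false (z i))) (M.g false z')| ≤ ((1 / (n + 1) : ℚ) : ℝ)

namespace ValuedLogic

variable {L : ValuedLogic.{u}}

theorem HasBasic.pred₂ (hL : L.HasBasic) {α : Type} (R : S.Relations 2) (t t' : S.Term α) :
    L.Definable fun p : Pt S α => p.1.pred R ![p.1.termVal p.2 t, p.1.termVal p.2 t'] := by
  refine (hL.pred R ![t, t']).congr fun p => ?_
  refine congrArg _ (funext fun i => ?_)
  fin_cases i <;> rfl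

theorem Axiomatizable.exists_finite (hL : L.HasBasic) {α : Type} {ι : Type} [Finite ι] :
    ∀ {P : ι → Pt S α → Prop}, (∀ i, L.Axiomatizable (P i)) →
      L.Axiomatizable fun p => ∃ i, P i p := by
  induction ι using Finite.induction_empty_option with
  | of_equiv e ih => exact fun h => (ih fun i => h (e i)).congr fun p =>
      ⟨fun ⟨i, hi⟩ => ⟨e i, hi⟩, fun ⟨i, hi⟩ => ⟨e.symm i, by rwa [e.apply_symm_apply]⟩⟩
  | h_empty => exact fun h => (hL.lukClosed.zero.eq_one).congr fun p => by simp
  | h_option ih =>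
    exact fun h => ((h none).or (ih fun i => h (some i)) hL).congr fun p => by simp [Option.exists]

theorem HasBasic.le_one_div (hL : L.HasBasic) {α : Type} {F : Pt S α → ℝ} (hF : L.Definable F)
    (n : ℕ) : L.Axiomatizable fun p => F p ≤ ((1 / (n + 1) : ℚ) : ℝ) := by
  refine hL.le_rat hF (by positivity) ?_
  rw [div_le_one (by positivity)]
  linarith [(Nat.cast_nonneg n : (0 : ℚ) ≤ n)]

section Symbols

variable (hL : L.HasBasic) {α : Type}
include hL

theorem HasBasic.rk (n : ℕ) (a : α) :
    L.Definable fun p : Pt (sysLang S) α => p.1.rk n (p.2 a) :=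
  hL.pred (sysSymb S (.rk n)) fun _ => .var a

theorem HasBasic.fib (b : Bool) (t t' : (sysLang S).Term α) :
    L.Definable fun p : Pt (sysLang S) α => p.1.fib b (p.1.termVal p.2 t) (p.1.termVal p.2 t') :=
  hL.pred₂ (sysSymb S (.fib b)) t t'

theorem HasBasic.pre (a a' : α) :
    L.Definable fun p : Pt (sysLang S) α => p.1.pre (p.2 a) (p.2 a') :=
  hL.pred₂ (sysSymb S .pre) (.var a) (.var a')

theorem HasBasic.step (a a' : α) :
    L.Definable fun p : Pt (sysLang S) α => p.1.step (p.2 a) (p.2 a') :=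
  hL.pred₂ (sysSymb S .step) (.var a) (.var a')

end Symbols

/-- The term `g b a`. -/
def gTerm {α : Type} (b : Bool) (a : α) : (sysLang S).Term α :=
  .func (l := 1) (Sum.inr (SysFun.g b)) fun _ => .var a

/-- The term `f t` for an operation symbol `f` of `pointed S`. -/
def opTerm {α : Type} {n : ℕ} (f : (pointed S).Functions n) (t : Fin n → (sysLang S).Term α) :
    (sysLang S).Term α := .func (Sum.inl f : (sysLang S).Functions n) t

end ValuedLogic

open ValuedLogic in
theorem axiomatizableClass_isSystem {L : ValuedLogic.{u}} (hL : L.HasBasic) [Finite S.Symbols] :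
    L.AxiomatizableClass (IsSystem (S := S)) := by
  have hf : Countable (Σ n, (pointed S).Functions n) := by
    have : Finite (Σ n, S.Functions n) :=
      Finite.of_injective (fun f => (Sum.inl f : S.Symbols)) Sum.inl_injective
    have : Function.Surjective fun q : (Σ n, S.Functions n) =>
        (match q with
          | ⟨0, c⟩ => ⟨1, PointedFun.cst c⟩
          | ⟨n + 1, f⟩ => ⟨n + 1, PointedFun.fn f⟩ : Σ n, (pointed S).Functions n) := by
      rintro ⟨_, f | c⟩
      · exact ⟨⟨_, f⟩, rfl⟩
      · exact ⟨⟨0, c⟩, rfl⟩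
    exact this.countable
  have hr : Countable (Σ n, (pointed S).Relations n) := by
    have : Finite (Σ n, S.Relations n) :=
      Finite.of_injective (fun f => (Sum.inr f : S.Symbols)) Sum.inr_injective
    refine Function.Injective.countable (β := Σ n, S.Relations n)
      (f := fun q => match q with | ⟨_, .rel R⟩ => ⟨_, R⟩) ?_
    rintro ⟨_, ⟨R⟩⟩ ⟨_, ⟨R'⟩⟩ h
    cases h
    rfl
  have hc : Finite (S.Functions 0) :=
    Finite.of_injective (fun f => (Sum.inl ⟨0, f⟩ : S.Symbols)) fun f g h => by simpa using h
  have or01 : ∀ {α : Type} {G : Pt (sysLang S) α → ℝ}, L.Definable G →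
      L.Axiomatizable fun p => G p = 0 ∨ G p = 1 := fun h => (hL.eq_zero h).or h.eq_one hL
  have sub := fun {α : Type} {G G' : Pt (sysLang S) α → ℝ} =>
    (hL.lukClosed (S := sysLang S) (α := α)).absSub (F := G) (G := G')
  have h1 : L.AxiomatizableClass fun M : MetStr (sysLang S) =>
      ∀ b x y, M.fib b x y = 0 ∨ M.fib b x y = 1 :=
    .forall fun b => ((or01 (hL.fib b (.var (0 : Fin 2)) (.var 1))).toClass hL).congr
      fun M => ⟨fun h x y => h ![x, y], fun h v => h _ _⟩
  have h2 : L.AxiomatizableClass fun M : MetStr (sysLang S) =>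
      ∀ n x, M.rk n x = 0 ∨ M.rk n x = 1 :=
    .forall fun n => ((or01 (hL.rk n (0 : Fin 1))).toClass hL).congr
      fun M => ⟨fun h x => h ![x], fun h v => h _⟩
  have h3 : L.AxiomatizableClass fun M : MetStr (sysLang S) =>
      ∀ x y, M.pre x y = 0 ∨ M.pre x y = 1 :=
    ((or01 (hL.pre (0 : Fin 2) 1)).toClass hL).congr
      fun M => ⟨fun h x y => h ![x, y], fun h v => h _ _⟩
  have h4 : L.AxiomatizableClass fun M : MetStr (sysLang S) =>
      ∀ x y, M.step x y = 0 ∨ M.step x y = 1 :=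
    ((or01 (hL.step (0 : Fin 2) 1)).toClass hL).congr
      fun M => ⟨fun h x y => h ![x, y], fun h v => h _ _⟩
  have h5 : L.AxiomatizableClass fun M : MetStr (sysLang S) => ∀ b x, ⨆ y, M.fib b x y = 1 :=
    .forall fun b => ((hL.iSup_option
      (hL.fib b (.var (some (0 : Fin 1))) (.var none))).eq_one.toClass hL).congr
      fun M => ⟨fun h x => h ![x], fun h v => h _⟩
  have h6 : L.AxiomatizableClass fun M : MetStr (sysLang S) =>
      ∀ b (q : Σ n, (pointed S).Functions n) x (t : Fin q.1 → M),
        (∃ i, M.fib b x (t i) = 0) ∨ M.fib b x (M.bop q.2 t) = 1 :=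
    .forall fun b => .forall fun q => (((Axiomatizable.exists_finite hL fun i =>
      hL.eq_zero (hL.fib b (.var none) (.var (some i)))).or
      (hL.fib b (.var none) (opTerm q.2 fun i => .var (some i))).eq_one hL).toClass hL).congr
      fun M => ⟨fun h x t => h fun o => o.elim x t, fun h v => h _ _⟩
  have h7 : L.AxiomatizableClass fun M : MetStr (sysLang S) =>
      ∀ b (c : S.Functions 0) x y z, M.fib b x y = 0 ∨ M.fib b x z = 0 ∨
        dist (M.bop (n := 1) (PointedFun.cst c) fun _ => y)
          (M.bop (n := 1) (PointedFun.cst c) fun _ => z) = 0 :=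
    .forall fun b => .forall fun c => (((hL.eq_zero (hL.fib b (.var (0 : Fin 3)) (.var 1))).or
      ((hL.eq_zero (hL.fib b (.var (0 : Fin 3)) (.var 2))).or
        (hL.eq_zero (hL.dist (opTerm (n := 1) (PointedFun.cst c) fun _ => .var 1)
          (opTerm (n := 1) (PointedFun.cst c) fun _ => .var 2))) hL) hL).toClass hL).congr
      fun M => ⟨fun h x y z => h ![x, y, z], fun h v => h _ _ _⟩
  have h8 : L.AxiomatizableClass fun M : MetStr (sysLang S) =>
      ∀ b x y z, M.pre x y = 0 ∨ (M.fib b x z ≤ M.fib b y z ∧ M.fib b y z ≤ M.fib b x z) :=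
    .forall fun b => (((hL.eq_zero (hL.pre (0 : Fin 3) 1)).or
      ((hL.le (hL.fib b (.var 0) (.var 2)) (hL.fib b (.var 1) (.var 2))).and
        (hL.le (hL.fib b (.var 1) (.var 2)) (hL.fib b (.var 0) (.var 2))) hL) hL).toClass hL).congr
      fun M => ⟨fun h x y z => h ![x, y, z], fun h v => h _ _ _⟩
  have h9 : L.AxiomatizableClass fun M : MetStr (sysLang S) =>
      ∀ b z x, M.pre z x = 0 ∨ M.fib b x (M.g b z) = 1 :=
    .forall fun b => (((hL.eq_zero (hL.pre (0 : Fin 2) 1)).or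
      (hL.fib b (.var 1) (gTerm b 0)).eq_one hL).toClass hL).congr
      fun M => ⟨fun h x y => h ![x, y], fun h v => h _ _⟩
  have h10 : L.AxiomatizableClass fun M : MetStr (sysLang S) =>
      ∀ x y z, M.pre x y = 0 ∨ M.pre y z = 0 ∨ M.pre x z = 1 :=
    (((hL.eq_zero (hL.pre (0 : Fin 3) 1)).or ((hL.eq_zero (hL.pre 1 2)).or
      (hL.pre 0 2).eq_one hL) hL).toClass hL).congr
      fun M => ⟨fun h x y z => h ![x, y, z], fun h v => h _ _ _⟩
  have h11 : L.AxiomatizableClass fun M : MetStr (sysLang S) =>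
      ∀ x, M.rk 0 x = 0 ∨ M.pre x x = 1 :=
    (((hL.eq_zero (hL.rk 0 (0 : Fin 1))).or (hL.pre 0 0).eq_one hL).toClass hL).congr
      fun M => ⟨fun h x => h ![x], fun h v => h _⟩
  have h12 : L.AxiomatizableClass fun M : MetStr (sysLang S) =>
      ∀ n x, M.rk (n + 1) x ≤ M.rk n x :=
    .forall fun n => ((hL.le (hL.rk (n + 1) (0 : Fin 1)) (hL.rk n 0)).toClass hL).congr
      fun M => ⟨fun h x => h ![x], fun h v => h _⟩
  have h13 : L.AxiomatizableClass fun M : MetStr (sysLang S) =>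
      ∀ n x y, M.rk (n + 1) x = 0 ∨ M.step x y = 0 ∨ M.rk n y = 1 :=
    .forall fun n => (((hL.eq_zero (hL.rk (n + 1) (0 : Fin 2))).or
      ((hL.eq_zero (hL.step 0 1)).or (hL.rk n 1).eq_one hL) hL).toClass hL).congr
      fun M => ⟨fun h x y => h ![x, y], fun h v => h _ _⟩
  have h14 : L.AxiomatizableClass fun M : MetStr (sysLang S) => ∀ x y, M.step x y ≤ M.pre x y :=
    ((hL.le (hL.step (0 : Fin 2) 1) (hL.pre 0 1)).toClass hL).congr
      fun M => ⟨fun h x y => h ![x, y], fun h v => h _ _⟩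
  have h15 : L.AxiomatizableClass fun M : MetStr (sysLang S) => ∀ b x a, M.rk 1 x = 0 ∨
      M.fib b x a = 0 ∨ ⨆ y, min (M.step x y) (1 - dist (M.g b y) a) = 1 :=
    .forall fun b => (((hL.eq_zero (hL.rk 1 (0 : Fin 2))).or
      ((hL.eq_zero (hL.fib b (.var 0) (.var 1))).or
        (hL.iSup_option (hL.lukClosed.inf (hL.step (some (0 : Fin 2)) none)
          (hL.lukClosed.compl (hL.dist (gTerm b none) (.var (some 1)))))).eq_one hL)
        hL).toClass hL).congr
      fun M => ⟨fun h x y => h ![x, y], fun h v => h _ _⟩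
  have h16 : L.AxiomatizableClass fun M : MetStr (sysLang S) =>
      ∀ n, ∀ _ : Fin 0 → M, ⨆ x, M.rk n x = 1 :=
    .forall fun n => (hL.iSup_option (hL.rk n none)).eq_one.toClass hL
  have h17 : L.AxiomatizableClass fun M : MetStr (sysLang S) =>
      ∀ (n : ℕ) x z z', M.rk n x = 0 ∨ M.pre z x = 0 ∨ M.pre z' x = 0 ∨
      |dist (M.g true z) (M.g true z') - dist (M.g false z) (M.g false z')| ≤
        ((1 / (n + 1) : ℚ) : ℝ) :=
    .forall fun n => (((hL.eq_zero (hL.rk n (0 : Fin 3))).or ((hL.eq_zero (hL.pre 1 0)).or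
      ((hL.eq_zero (hL.pre 2 0)).or (hL.le_one_div (sub (hL.dist (gTerm true 1) (gTerm true 2))
        (hL.dist (gTerm false 1) (gTerm false 2))) n) hL) hL) hL).toClass hL).congr
      fun M => ⟨fun h x y z => h ![x, y, z], fun h v => h _ _ _⟩
  have h18 : L.AxiomatizableClass fun M : MetStr (sysLang S) =>
      ∀ (n : ℕ) (q : Σ n, (pointed S).Relations n) x (z : Fin q.1 → M), M.rk n x = 0 ∨
      (∃ i, M.pre (z i) x = 0) ∨
      |M.bpred q.2 (fun i => M.g true (z i)) - M.bpred q.2 (fun i => M.g false (z i))| ≤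
        ((1 / (n + 1) : ℚ) : ℝ) :=
    .forall fun n => .forall fun q => (((hL.eq_zero (hL.rk n none)).or
      ((Axiomatizable.exists_finite hL fun i => hL.eq_zero (hL.pre (some i) none)).or
        (hL.le_one_div (sub
          (hL.pred (baseSymb q.2) fun i => gTerm true (some i))
          (hL.pred (baseSymb q.2) fun i => gTerm false (some i)))
          n) hL) hL).toClass hL).congr
      fun M => ⟨fun h x t => h fun o => o.elim x t, fun h v => h _ _⟩
  have h19 : L.AxiomatizableClass fun M : MetStr (sysLang S) =>
      ∀ (n : ℕ) (q : Σ n, (pointed S).Functions n) x z' (z : Fin q.1 → M), M.rk n x = 0 ∨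
      (∃ i, M.pre (z i) x = 0) ∨ M.pre z' x = 0 ∨
      |dist (M.bop q.2 (fun i => M.g true (z i))) (M.g true z') -
        dist (M.bop q.2 (fun i => M.g false (z i))) (M.g false z')| ≤ ((1 / (n + 1) : ℚ) : ℝ) :=
    .forall fun n => .forall fun q => (((hL.eq_zero (hL.rk n none)).or
      ((Axiomatizable.exists_finite hL fun i => hL.eq_zero (hL.pre (some (some i)) none)).or
        ((hL.eq_zero (hL.pre (some none) none)).or
        (hL.le_one_div (sub
          (hL.dist (opTerm q.2 fun i => gTerm true (some (some i))) (gTerm true (some none)))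
          (hL.dist (opTerm q.2 fun i => gTerm false (some (some i))) (gTerm false (some none))))
          n) hL) hL) hL).toClass hL).congr
      fun M => ⟨fun h x z' t => h fun o => o.elim x fun o => o.elim z' t, fun h v => h _ _ _⟩
  refine (h1.and <| h2.and <| h3.and <| h4.and <| h5.and <| h6.and <| h7.and <| h8.and <|
    h9.and <| h10.and <| h11.and <| h12.and <| h13.and <| h14.and <| h15.and <| h16.and <|
    h17.and <| h18.and h19).congr fun M => ⟨?_, ?_⟩
  · rintro ⟨h1, h2, h3, h4, h5, h6, h7, h8, h9, h10, h11, h12, h13, h14, h15, h16, h17, h18, h19⟩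
    exact ⟨h1, h2, h3, h4, h5, h6, h7, h8, h9, h10, h11, h12, h13, h14, h15, h16, h17, h18, h19⟩
  · rintro ⟨h1, h2, h3, h4, h5, h6, h7, h8, h9, h10, h11, h12, h13, h14, h15, h16, h17, h18, h19⟩
    exact ⟨h1, h2, h3, h4, h5, h6, h7, h8, h9, h10, h11, h12, h13, h14, h15, h16, h17, h18, h19⟩

/-! ### The system of positions of a sequence of games -/

theorem IsSystem.hasFibers {M : MetStr (sysLang S)} (h : IsSystem M) : HasFibers M where
  zero_or_one := h.fib_or
  nonempty b x := by
    by_contra! hcon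
    have h1 := h.fib_nonempty b x
    have h0 : ∀ y, M.fib b x y = 0 := fun y => (h.fib_or b x y).resolve_right (hcon y)
    simp [h0] at h1
  closed b x n f t ht := by
    refine (h.fib_op b ⟨n, f⟩ x t).resolve_left ?_
    rintro ⟨i, hi⟩
    rw [ht i] at hi
    exact one_ne_zero hi

section Positions

variable (A : Bool → ℕ → MetStr S)

/-- A position, after at least one move, in a game with `k + 1` rounds and precision `1 / (k + 1)`
on the structures `A true k` and `A false k`, which the second player can survive. -/
structure Pos : Type u where
  k : ℕ
  l : List (A true k × A false k)
  ne_nil : l ≠ []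
  length_le : l.length ≤ k + 1
  win : Win (1 / (k + 1)) (A true k) (A false k) (k + 1 - l.length) l

variable {A}

/-- The position `y` extends the position `x`. -/
inductive Pos.Pre : Pos A → Pos A → Prop
  | mk {k : ℕ} {l l' : List (A true k × A false k)} (hl : l <:+ l') (h₁ h₂ h₃ h₁' h₂' h₃') :
    Pos.Pre ⟨k, l, h₁, h₂, h₃⟩ ⟨k, l', h₁', h₂', h₃'⟩

/-- The position `y` extends the position `x` by one round. -/
inductive Pos.Step : Pos A → Pos A → Prop
  | mk {k : ℕ} {l : List (A true k × A false k)} (e : A true k × A false k)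
    (h₁ h₂ h₃ h₁' h₂' h₃') : Pos.Step ⟨k, l, h₁, h₂, h₃⟩ ⟨k, e :: l, h₁', h₂', h₃'⟩

variable (A) in
/-- The pieces of the disjoint union of all structures `A b k` and one-point spaces for all
positions. -/
def piece : (ℕ × Bool) ⊕ Pos A → Type u
  | .inl p => A p.2 p.1
  | .inr _ => PUnit

instance : ∀ i, MetricSpace (piece A i)
  | .inl p => (A p.2 p.1).metric
  | .inr _ => inferInstanceAs (MetricSpace PUnit)

theorem piece_dist_le_one : ∀ (i) (x y : piece A i), dist x y ≤ 1
  | .inl p => (A p.2 p.1).dist_le_one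
  | .inr _ => fun _ _ => (dist_self (PUnit.unit : PUnit.{u + 1})).le.trans zero_le_one

variable (A) in
/-- The disjoint union of all structures `A b k` and one-point spaces for all positions, with
distance `1` between different pieces. Since this is the maximal distance, functions that are
constant on the pieces, or uniformly continuous with the same modulus on all of them, are uniformly
continuous. -/
structure SysCarrier : Type u where
  /-- The index of the piece. -/
  idx : (ℕ × Bool) ⊕ Pos A
  /-- The point of the piece. -/
  pt : piece A idx

namespace SysCarrier

open Classical in
instance : Dist (SysCarrier A) :=
  ⟨fun x y => if h : x.idx = y.idx then dist (h ▸ x.pt) y.pt else 1⟩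

theorem dist_mk (i : (ℕ × Bool) ⊕ Pos A) (a b : piece A i) :
    dist (⟨i, a⟩ : SysCarrier A) ⟨i, b⟩ = dist a b := dif_pos rfl

theorem dist_of_ne {x y : SysCarrier A} (h : x.idx ≠ y.idx) : dist x y = 1 := dif_neg h

theorem dist_mk_of_ne {i j : (ℕ × Bool) ⊕ Pos A} (h : i ≠ j) (a : piece A i) (b : piece A j) :
    dist (⟨i, a⟩ : SysCarrier A) ⟨j, b⟩ = 1 := dist_of_ne h

theorem dist_le_one (x y : SysCarrier A) : dist x y ≤ 1 := by
  by_cases h : x.idx = y.idx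
  · obtain ⟨i, a⟩ := x
    obtain ⟨j, b⟩ := y
    obtain rfl : i = j := h
    rw [dist_mk]
    exact piece_dist_le_one _ _ _
  · exact (dist_of_ne h).le

instance : MetricSpace (SysCarrier A) where
  dist_self := by
    rintro ⟨i, a⟩
    rw [dist_mk, dist_self]
  dist_comm := by
    rintro ⟨i, a⟩ ⟨j, b⟩
    by_cases h : i = j
    · subst h
      rw [dist_mk, dist_mk, dist_comm]
    · rw [dist_mk_of_ne h, dist_mk_of_ne (Ne.symm h)]
  dist_triangle := by
    rintro ⟨i, a⟩ ⟨j, b⟩ ⟨k, c⟩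
    have hn : ∀ x y : SysCarrier A, 0 ≤ dist x y := by
      rintro ⟨i, a⟩ ⟨j, b⟩
      by_cases h : i = j
      · subst h
        rw [dist_mk]
        exact dist_nonneg
      · rw [dist_mk_of_ne h]
        exact zero_le_one
    by_cases h : i = j
    · subst h
      by_cases h' : i = k
      · subst h'
        rw [dist_mk, dist_mk, dist_mk]
        exact dist_triangle _ _ _
      · rw [dist_mk_of_ne h' b c]
        linarith [dist_le_one (⟨i, a⟩ : SysCarrier A) ⟨k, c⟩, hn ⟨i, a⟩ ⟨i, b⟩]
    · rw [dist_mk_of_ne h a b]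
      linarith [dist_le_one (⟨i, a⟩ : SysCarrier A) ⟨k, c⟩, hn ⟨j, b⟩ ⟨k, c⟩]
  eq_of_dist_eq_zero := by
    rintro ⟨i, a⟩ ⟨j, b⟩ h
    by_cases h' : i = j
    · subst h'
      rw [dist_mk] at h
      rw [eq_of_dist_eq_zero h]
    · rw [dist_mk_of_ne h'] at h
      exact absurd h one_ne_zero

theorem fst_eq_of_dist_lt {x y : SysCarrier A} (h : dist x y < 1) : x.idx = y.idx := by
  by_contra hne
  rw [dist_of_ne hne] at h
  exact lt_irrefl _ h

/-- The inclusion of the structure `A p.2 p.1`. -/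
def inc (p : ℕ × Bool) (a : A p.2 p.1) : SysCarrier A := ⟨.inl p, a⟩

theorem dist_inc (p : ℕ × Bool) (a b : A p.2 p.1) : dist (inc p a) (inc p b) = dist a b :=
  dist_mk (.inl p) a b

theorem inc_injective (p : ℕ × Bool) : Function.Injective (inc (A := A) p) := fun a b h =>
  eq_of_dist_eq_zero (by rw [← dist_inc, h, dist_self])

theorem exists_inc {x : SysCarrier A} {p : ℕ × Bool} (h : x.idx = .inl p) : ∃ a, x = inc p a := by
  obtain ⟨i, a⟩ := x
  obtain rfl : i = .inl p := h
  exact ⟨a, rfl⟩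

theorem uniformContinuous_iff {Y : Type*} [PseudoMetricSpace Y] {n : ℕ}
    {f : (Fin n → SysCarrier A) → Y} : UniformContinuous f ↔ ∀ ε > 0, ∃ δ > 0, ∀ t t',
      (∀ i, dist (t i) (t' i) < δ) → dist (f t) (f t') < ε := by
  rw [Metric.uniformContinuous_iff]
  refine forall₂_congr fun ε _ => exists_congr fun δ => and_congr_right fun hδ => ?_
  exact forall₂_congr fun t t' => by rw [dist_pi_lt_iff hδ]

theorem uniformContinuous_of_fst {Y : Type*} [PseudoMetricSpace Y] {n : ℕ}
    {f : (Fin n → SysCarrier A) → Y}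
    (hf : ∀ t t', (∀ i, (t i).idx = (t' i).idx) → f t = f t') : UniformContinuous f := by
  refine uniformContinuous_iff.2 fun ε hε => ⟨1, one_pos, fun t t' h => ?_⟩
  rw [hf t t' fun i => fst_eq_of_dist_lt (h i), dist_self]
  exact hε

open Classical in
/-- The function that is `F p` on the tuples from the structure `A p.2 p.1`, and has the value `d`
at the tuples that do not belong to one of these structures. -/
def glue {Y : Type*} {n : ℕ} (F : ∀ p : ℕ × Bool, (Fin n → A p.2 p.1) → Y) (d : Y)
    (t : Fin n → SysCarrier A) : Y :=
  if h : ∃ q : (Σ p : ℕ × Bool, Fin n → A p.2 p.1), t = fun i => inc q.1 (q.2 i) then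
    F h.choose.1 h.choose.2
  else d

section Glue

variable {Y : Type*} {n : ℕ} {F : ∀ p : ℕ × Bool, (Fin (n + 1) → A p.2 p.1) → Y} {d : Y}

theorem glue_inc (p : ℕ × Bool) (s : Fin (n + 1) → A p.2 p.1) :
    glue F d (fun i => inc p (s i)) = F p s := by
  have h : ∃ q : (Σ p : ℕ × Bool, Fin (n + 1) → A p.2 p.1),
    (fun i => inc p (s i)) = fun i => inc q.1 (q.2 i) := ⟨⟨p, s⟩, rfl⟩
  have hd : glue F d (fun i => inc p (s i)) = F h.choose.1 h.choose.2 := dif_pos h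
  rw [hd]
  generalize hq : h.choose = q
  have hc : (fun i => inc p (s i)) = fun i => inc q.1 (q.2 i) := hq ▸ h.choose_spec
  obtain ⟨p', s'⟩ := q
  obtain rfl : p = p' := Sum.inl_injective (congrArg SysCarrier.idx (congrFun hc 0))
  have : s = s' := funext fun i => inc_injective p (congrFun hc i)
  rw [this]

theorem glue_of_not {t : Fin n → SysCarrier A} {F : ∀ p : ℕ × Bool, (Fin n → A p.2 p.1) → Y}
    (h : ¬ ∃ q : (Σ p : ℕ × Bool, Fin n → A p.2 p.1), t = fun i => inc q.1 (q.2 i)) :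
    glue F d t = d := dif_neg h

theorem uniformContinuous_glue [PseudoMetricSpace Y]
    (h : ∀ ε > 0, ∃ δ > 0, ∀ p s s', (∀ i, dist (s i) (s' i) < δ) →
      dist (F p s) (F p s') < ε) : UniformContinuous (glue F d) := by
  refine uniformContinuous_iff.2 fun ε hε => ?_
  obtain ⟨δ, hδ, h⟩ := h ε hε
  have key : ∀ (p : ℕ × Bool) (s : Fin (n + 1) → A p.2 p.1) (t' : Fin (n + 1) → SysCarrier A),
      (∀ i, dist (inc p (s i)) (t' i) < 1) → ∃ s' : Fin (n + 1) → A p.2 p.1,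
        t' = fun i => inc p (s' i) := by
    intro p s t' ht
    choose s' hs' using fun i => exists_inc (fst_eq_of_dist_lt (ht i)).symm
    exact ⟨s', funext hs'⟩
  refine ⟨min δ 1, lt_min hδ one_pos, fun t t' ht => ?_⟩
  by_cases h1 : ∃ q : (Σ p : ℕ × Bool, Fin (n + 1) → A p.2 p.1), t = fun i => inc q.1 (q.2 i)
  · obtain ⟨⟨p, s⟩, rfl⟩ := h1
    obtain ⟨s', rfl⟩ := key p s t' fun i => (ht i).trans_le (min_le_right _ _)
    rw [glue_inc, glue_inc]
    refine h p s s' fun i => ?_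
    rw [← dist_inc]
    exact (ht i).trans_le (min_le_left _ _)
  · by_cases h2 : ∃ q : (Σ p : ℕ × Bool, Fin (n + 1) → A p.2 p.1), t' = fun i => inc q.1 (q.2 i)
    · obtain ⟨⟨p, s⟩, rfl⟩ := h2
      obtain ⟨s', rfl⟩ := key p s t fun i => by
        rw [dist_comm]
        exact (ht i).trans_le (min_le_right _ _)
      exact absurd ⟨⟨p, s'⟩, rfl⟩ h1
    · rw [glue_of_not h1, glue_of_not h2, dist_self]
      exact hε

end Glue

/-- The number of the game that a piece belongs to. -/
def game : (ℕ × Bool) ⊕ Pos A → ℕ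
  | .inl p => p.1
  | .inr x => x.k

/-- The component of a pair with index `b`. -/
def comp {k : ℕ} (b : Bool) (e : A true k × A false k) : A b k :=
  match b with
  | true => e.1
  | false => e.2

/-- The component with index `b` of the last move at a position; for a piece that is not a position
this is an arbitrary point of the structure with index `b` of the same game. -/
def last (b : Bool) : (ℕ × Bool) ⊕ Pos A → SysCarrier A
  | .inl p => inc (p.1, b) (Classical.arbitrary (A b p.1))
  | .inr x => inc (x.k, b) (comp b (x.l.head x.ne_nil))

/-- At least `n` rounds are left. -/
def Rk (n : ℕ) : (ℕ × Bool) ⊕ Pos A → Prop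
  | .inl _ => False
  | .inr x => n ≤ x.k + 1 - x.l.length

end SysCarrier

open SysCarrier

/-- The truth value of a proposition. -/
def truth (P : Prop) : ℝ := open Classical in if P then 1 else 0

theorem truth_mem (P : Prop) : truth P ∈ Set.Icc (0 : ℝ) 1 := by
  unfold truth
  split_ifs <;> simp

theorem truth_or (P : Prop) : truth P = 0 ∨ truth P = 1 := by
  unfold truth
  split_ifs <;> simp

@[simp]
theorem truth_eq_one {P : Prop} : truth P = 1 ↔ P := by
  unfold truth
  split_ifs with h <;> simp [h]

@[simp]
theorem truth_eq_zero {P : Prop} : truth P = 0 ↔ ¬ P := by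
  unfold truth
  split_ifs with h <;> simp [h]

theorem truth_le_truth {P Q : Prop} (h : P → Q) : truth P ≤ truth Q := by
  unfold truth
  split_ifs with h1 h2
  · exact le_rfl
  · exact absurd (h h1) h2
  · exact zero_le_one
  · exact le_rfl

/-- The relation on positions given by `r`, extended to all pieces. -/
def onPos (r : Pos A → Pos A → Prop) : (ℕ × Bool) ⊕ Pos A → (ℕ × Bool) ⊕ Pos A → Prop
  | .inr x, .inr y => r x y
  | _, _ => False

/-- The interpretation of the predicates of `sysAux`. -/
def sysPred {n : ℕ} (R : SysRel n) (t : Fin n → SysCarrier A) : ℝ :=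
  match R with
  | .rk n => truth (Rk n (t 0).idx)
  | .fib b => truth ((t 1).idx = .inl (game (t 0).idx, b))
  | .pre => truth (onPos Pos.Pre (t 0).idx (t 1).idx)
  | .step => truth (onPos Pos.Step (t 0).idx (t 1).idx)

/-- The interpretation of the operations of `sysAux`. -/
def sysOp {n : ℕ} (f : SysFun n) (t : Fin n → SysCarrier A) : SysCarrier A :=
  match f with
  | .g b => last b (t 0).idx

/-- The system of positions of the games on the structures `A true k` and `A false k`. -/
def posSystem (Sg : Signature.{u}) (A : Bool → ℕ → MetStr Sg.lang)
    (hA : ∀ b k, Sg.IsStr (A b k)) : MetStr (sysLang Sg.lang) where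
  carrier := SysCarrier A
  nonempty := ⟨inc (0, true) (Classical.arbitrary (A true 0))⟩
  dist_le_one := SysCarrier.dist_le_one
  op f t := match f with
    | .inl f => glue (fun p s => inc p ((A p.2 p.1).toPointed.op f s))
        (inc (0, true) (Classical.arbitrary (A true 0))) t
    | .inr f => sysOp f t
  pred R t := match R with
    | .inl R => glue (fun p s => (A p.2 p.1).toPointed.pred R s) 0 t
    | .inr R => sysPred R t
  pred_mem R t := by
    rcases R with R | R
    · change glue _ _ _ ∈ _
      unfold glue
      split_ifs
      · exact MetStr.pred_mem _ _ _
      · simp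
    · cases R <;> exact truth_mem _
  uniformContinuous_op f := by
    rcases f with f | f
    · change UniformContinuous (glue _ _)
      have key : ∀ (ε : ℝ), 0 < ε → ∃ q : Set.Ioo (0 : ℚ) 1, ((q : ℚ) : ℝ) < ε := by
        intro ε hε
        obtain ⟨q, hq₀, hq⟩ := exists_rat_btwn (lt_min hε (zero_lt_one' ℝ))
        exact ⟨⟨q, by exact_mod_cast hq₀, by exact_mod_cast hq.trans_le (min_le_right _ _)⟩,
          hq.trans_le (min_le_left _ _)⟩
      cases f with
      | fn f =>
        refine uniformContinuous_glue fun ε hε => ?_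
        obtain ⟨q, hq⟩ := key ε hε
        refine ⟨((Sg.opMod f q : ℚ) : ℝ), by exact_mod_cast (Sg.opMod f q).2.1, fun p s s' h => ?_⟩
        exact (dist_inc p _ _).trans_lt (((hA _ _).1 f q s s' h).trans_lt hq)
      | cst c =>
        refine uniformContinuous_glue fun ε hε => ⟨1, one_pos, fun p s s' _ => ?_⟩
        exact (dist_inc p _ _).trans_lt ((dist_self ((A p.2 p.1).constVal c)).trans_lt hε)
    · cases f with
      | g b => exact uniformContinuous_of_fst fun t t' h => congrArg (last b) (h 0)
  uniformContinuous_pred R := by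
    rcases R with R | R
    · change UniformContinuous (glue _ _)
      cases R with
      | rel R =>
        refine uniformContinuous_glue fun ε hε => ?_
        obtain ⟨q, hq₀, hq⟩ := exists_rat_btwn (lt_min hε (zero_lt_one' ℝ))
        let q' : Set.Ioo (0 : ℚ) 1 :=
          ⟨q, by exact_mod_cast hq₀, by exact_mod_cast hq.trans_le (min_le_right _ _)⟩
        refine ⟨((Sg.predMod R q' : ℚ) : ℝ), by exact_mod_cast (Sg.predMod R q').2.1,
          fun p s s' h => ?_⟩
        exact ((hA _ _).2 R q' s s' h).trans_lt (hq.trans_le (min_le_left _ _))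
    · refine uniformContinuous_of_fst fun t t' h => ?_
      cases R with
      | rk n => exact congrArg (fun i => truth (Rk n i)) (h 0)
      | fib b => exact congrArg₂ (fun i j => truth (j = .inl (game i, b))) (h 0) (h 1)
      | pre => exact congrArg₂ (fun i j => truth (onPos Pos.Pre i j)) (h 0) (h 1)
      | step => exact congrArg₂ (fun i j => truth (onPos Pos.Step i j)) (h 0) (h 1)

end Positions

open SysCarrier

section PosSystem

variable {Sg : Signature.{u}} {A : Bool → ℕ → MetStr Sg.lang}

theorem exists_of_pre {i : (ℕ × Bool) ⊕ Pos A} {x : Pos A} (h : onPos Pos.Pre i (.inr x)) :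
    ∃ e ∈ x.l, ∀ b, last b i = inc (x.k, b) (comp b e) := by
  rcases i with p | z
  · exact h.elim
  · obtain ⟨hl, hne, -, -, -, -, -⟩ := (h : Pos.Pre z x)
    exact ⟨_, hl.subset (List.head_mem hne), fun b => rfl⟩

theorem game_eq_of_pre {i j : (ℕ × Bool) ⊕ Pos A} (h : onPos Pos.Pre i j) : game i = game j := by
  rcases i with p | z
  · exact h.elim
  · rcases j with p | x
    · exact h.elim
    · obtain ⟨⟩ := (h : Pos.Pre z x)
      rfl

theorem onPos_pre_trans {i j k : (ℕ × Bool) ⊕ Pos A} (h : onPos Pos.Pre i j)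
    (h' : onPos Pos.Pre j k) : onPos Pos.Pre i k := by
  rcases i with p | x
  · exact h.elim
  rcases j with p | y
  · exact h.elim
  rcases k with p | z
  · exact h'.elim
  obtain ⟨h₁⟩ := (h : Pos.Pre x y)
  obtain ⟨h₂⟩ := (h' : Pos.Pre _ z)
  exact .mk (h₁.trans h₂) _ _ _ _ _ _

theorem onPos_pre_of_step {i j : (ℕ × Bool) ⊕ Pos A} (h : onPos Pos.Step i j) :
    onPos Pos.Pre i j := by
  rcases i with p | x
  · exact h.elim
  rcases j with p | y
  · exact h.elim
  obtain ⟨e⟩ := (h : Pos.Step x y)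
  exact .mk (List.suffix_cons _ _) _ _ _ _ _ _

theorem rk_of_step {n : ℕ} {i j : (ℕ × Bool) ⊕ Pos A} (h : Rk (n + 1) i)
    (h' : onPos Pos.Step i j) : Rk n j := by
  rcases i with p | x
  · exact h.elim
  rcases j with p | y
  · exact h'.elim
  obtain ⟨e⟩ := (h' : Pos.Step x y)
  simp only [Rk, List.length_cons] at h ⊢
  omega

theorem last_idx (b : Bool) (i : (ℕ × Bool) ⊕ Pos A) : (last b i).idx = .inl (game i, b) := by
  rcases i with p | z <;> rfl

theorem exists_of_rk {n : ℕ} {i : (ℕ × Bool) ⊕ Pos A} (h : Rk n i) :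
    ∃ x : Pos A, i = .inr x ∧ n ≤ x.k + 1 - x.l.length := by
  rcases i with p | x
  · exact h.elim
  · exact ⟨x, rfl, h⟩

theorem Pos.close (x : Pos A) {n : ℕ} (h : n ≤ x.k + 1 - x.l.length) :
    Close ((1 / (n + 1) : ℚ) : ℝ) (A true x.k) (A false x.k) x.l := by
  have hl : 0 < x.l.length := List.length_pos_iff.2 x.ne_nil
  have hn : n ≤ x.k := by omega
  have hε : (1 / ((x.k : ℝ) + 1)) ≤ ((1 / (n + 1) : ℚ) : ℝ) := by
    push_cast
    exact one_div_le_one_div_of_le (by positivity) (by exact_mod_cast Nat.succ_le_succ hn)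
  obtain ⟨h₁, h₂, h₃⟩ := x.win.close
  exact ⟨fun e he e' he' => (h₁ e he e' he').trans hε, fun R e he => (h₂ R e he).trans hε,
    fun f e he e' he' => (h₃ f e he e' he').trans hε⟩

theorem iSup_eq_one {X : Type*} {f : X → ℝ} (h : ∀ y, f y ≤ 1) {x : X} (hx : f x = 1) :
    ⨆ y, f y = 1 := by
  have : Nonempty X := ⟨x⟩
  exact le_antisymm (ciSup_le h) (hx ▸ le_ciSup ⟨1, by rintro _ ⟨y, rfl⟩; exact h y⟩ x)

/-- The position `x` as an element of the system of positions. -/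
def Pos.elem (x : Pos A) : SysCarrier A := ⟨.inr x, PUnit.unit⟩

theorem exists_start (hwin : ∀ k : ℕ, Win (1 / ((k : ℝ) + 1)) (A true k) (A false k) (k + 1) [])
    (k : ℕ) : ∃ x : Pos A, x.k = k ∧ x.l.length = 1 := by
  obtain ⟨b, hb⟩ := (hwin k).2.1 (Classical.arbitrary _)
  exact ⟨⟨k, [(_, b)], by simp, by simp, hb⟩, rfl, rfl⟩

theorem Pos.exists_step (x : Pos A) (h : 1 ≤ x.k + 1 - x.l.length) (b : Bool) (a : A b x.k) :
    ∃ y : Pos A, Pos.Step x y ∧ last b (.inr y) = inc (x.k, b) a := by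
  obtain ⟨k, l, hne, hle, hwin⟩ := x
  obtain ⟨m, hm⟩ : ∃ m, k + 1 - l.length = m + 1 := ⟨_, (Nat.succ_pred_eq_of_pos h).symm⟩
  rw [hm] at hwin
  have hm' : k + 1 - (l.length + 1) = m := by omega
  have hle' : l.length + 1 ≤ k + 1 := by omega
  have key : ∀ e : A true k × A false k, Win (1 / (k + 1)) (A true k) (A false k) m (e :: l) →
      ∃ y : Pos A, Pos.Step ⟨k, l, hne, hle, hm ▸ hwin⟩ y ∧ ∀ b, last b (.inr y) =
        inc (k, b) (comp b e) := fun e he =>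
    ⟨⟨k, e :: l, List.cons_ne_nil _ _, hle', hm'.symm ▸ he⟩, .mk e _ _ _ _ _ _, fun b => rfl⟩
  cases b with
  | true =>
    obtain ⟨c, hc⟩ := hwin.2.1 a
    obtain ⟨y, h₁, h₂⟩ := key _ hc
    exact ⟨y, h₁, h₂ true⟩
  | false =>
    obtain ⟨c, hc⟩ := hwin.2.2 a
    obtain ⟨y, h₁, h₂⟩ := key _ hc
    exact ⟨y, h₁, h₂ false⟩

variable (hA : ∀ b k, Sg.IsStr (A b k))

theorem posSystem_bop (p : ℕ × Bool) {n : ℕ} (f : (pointed Sg.lang).Functions n)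
    (s : Fin n → A p.2 p.1) : (posSystem Sg A hA).bop f (fun i => inc p (s i)) =
      inc p ((A p.2 p.1).toPointed.op f s) := by
  cases (f : PointedFun Sg.lang n) with
  | fn f => exact glue_inc (F := fun p s => inc p ((A p.2 p.1).toPointed.op
      (PointedFun.fn f : (pointed Sg.lang).Functions _) s)) p s
  | cst c => exact glue_inc (F := fun p s => inc p ((A p.2 p.1).toPointed.op (cstSymb c) s)) p s

theorem posSystem_bpred (p : ℕ × Bool) {n : ℕ} (R : (pointed Sg.lang).Relations n)
    (s : Fin n → A p.2 p.1) : (posSystem Sg A hA).bpred R (fun i => inc p (s i)) =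
      (A p.2 p.1).toPointed.pred R s := by
  cases (R : PointedRel Sg.lang n) with
  | rel R => exact glue_inc (F := fun p s => (A p.2 p.1).toPointed.pred
      (PointedRel.rel R : (pointed Sg.lang).Relations _) s) p s

theorem posSystem_fib {b : Bool} {x y : SysCarrier A}
    (h : (posSystem Sg A hA).fib b x y ≠ 0) : ∃ a, y = inc (game x.idx, b) a :=
  exists_inc (not_not.1 fun hne => h (truth_eq_zero.2 hne))

theorem posSystem_fib_inc (b : Bool) (x : SysCarrier A) (a : A b (game x.idx)) :
    (posSystem Sg A hA).fib b x (inc (game x.idx, b) a) = 1 := truth_eq_one.2 rfl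

theorem truth_or_elim {P : Prop} {Q : Prop} (h : P → Q) : truth P = 0 ∨ Q := by
  by_cases hP : P
  · exact Or.inr (h hP)
  · exact Or.inl (truth_eq_zero.2 hP)

theorem isSystem_posSystem
    (hwin : ∀ k : ℕ, Win (1 / ((k : ℝ) + 1)) (A true k) (A false k) (k + 1) []) :
    IsSystem (posSystem Sg A hA) where
  fib_or _ _ _ := truth_or _
  rk_or _ _ := truth_or _
  pre_or _ _ := truth_or _
  step_or _ _ := truth_or _
  fib_nonempty b x := iSup_eq_one (fun _ => (truth_mem _).2)
    (posSystem_fib_inc hA b x (Classical.arbitrary _))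
  fib_op := by
    rintro b ⟨n, f⟩ x t
    by_cases h : ∃ i, (posSystem Sg A hA).fib b x (t i) = 0
    · exact Or.inl h
    · push Not at h
      choose s hs using fun i => posSystem_fib hA (h i)
      obtain rfl : t = _ := funext hs
      refine Or.inr ?_
      refine (congrArg ((posSystem Sg A hA).fib b x)
        (posSystem_bop hA (game x.idx, b) f s)).trans ?_
      exact posSystem_fib_inc hA b x _
  fib_cst b c x y z := by
    by_cases hy : (posSystem Sg A hA).fib b x y = 0
    · exact Or.inl hy
    by_cases hz : (posSystem Sg A hA).fib b x z = 0
    · exact Or.inr (Or.inl hz)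
    obtain ⟨a, rfl⟩ := posSystem_fib hA hy
    obtain ⟨a', rfl⟩ := posSystem_fib hA hz
    refine Or.inr (Or.inr ?_)
    rw [posSystem_bop hA (game x.idx, b) (n := 1) (cstSymb c) fun _ => a,
      posSystem_bop hA (game x.idx, b) (n := 1) (cstSymb c) fun _ => a']
    exact dist_self _
  pre_fib b x y z := truth_or_elim fun h => by
    have : (posSystem Sg A hA).fib b x z = (posSystem Sg A hA).fib b y z :=
      congrArg (fun k => truth (z.idx = .inl (k, b))) (game_eq_of_pre h)
    exact ⟨this.le, this.ge⟩
  pre_g b z x := truth_or_elim fun h => by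
    refine truth_eq_one.2 ?_
    have hg : game z.idx = game x.idx := game_eq_of_pre h
    exact (last_idx b z.idx).trans (congrArg (fun k => Sum.inl (k, b)) hg)
  pre_trans x y z := by
    refine truth_or_elim fun h => truth_or_elim fun h' => truth_eq_one.2 ?_
    exact onPos_pre_trans h h'
  pre_refl x := truth_or_elim fun h => by
    refine truth_eq_one.2 ?_
    obtain ⟨x', hx, -⟩ := exists_of_rk h
    change onPos Pos.Pre x.idx x.idx
    rw [hx]
    obtain ⟨⟩ := x'
    exact .mk (List.suffix_refl _) _ _ _ _ _ _
  rk_succ n x := truth_le_truth fun h => by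
    obtain ⟨x', hx, h⟩ := exists_of_rk h
    change Rk n x.idx
    rw [hx]
    exact (Nat.le_succ n).trans h
  rk_step n x y := by
    refine truth_or_elim fun h => truth_or_elim fun h' => truth_eq_one.2 ?_
    exact rk_of_step h h'
  step_pre x y := truth_le_truth onPos_pre_of_step
  forth b x a := by
    refine truth_or_elim fun h => ?_
    by_cases ha : (posSystem Sg A hA).fib b x a = 0
    · exact Or.inl ha
    refine Or.inr ?_
    obtain ⟨a, rfl⟩ := posSystem_fib hA ha
    obtain ⟨i, c⟩ := x
    obtain ⟨x, rfl, h⟩ := exists_of_rk (i := i) h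
    obtain ⟨y, hy, hya⟩ := x.exists_step h b a
    refine iSup_eq_one (x := y.elem) (fun z => (min_le_left _ _).trans (truth_mem _).2) ?_
    have h1 : (posSystem Sg A hA).step ⟨.inr x, c⟩ y.elem = 1 := truth_eq_one.2 hy
    have h2 : dist ((posSystem Sg A hA).g b y.elem) (inc (x.k, b) a) = 0 :=
      dist_eq_zero.2 hya
    exact (congrArg₂ (fun r s : ℝ => min r (1 - s)) h1 h2).trans (by simp)
  exists_rk n _ := by
    obtain ⟨x, hk, hl⟩ := exists_start hwin n
    refine iSup_eq_one (x := x.elem) (fun z => (truth_mem _).2) (truth_eq_one.2 ?_)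
    change n ≤ x.k + 1 - x.l.length
    omega
  close_dist n x z z' := by
    refine truth_or_elim fun h => truth_or_elim fun hz => truth_or_elim fun hz' => ?_
    obtain ⟨i, c⟩ := x
    obtain ⟨x, rfl, h⟩ := exists_of_rk (i := i) h
    obtain ⟨e, he, hez⟩ := exists_of_pre hz
    obtain ⟨e', he', hez'⟩ := exists_of_pre hz'
    refine (le_of_eq ?_).trans ((x.close h).dist e he e' he')
    have key : ∀ b, dist ((posSystem Sg A hA).g b z) ((posSystem Sg A hA).g b z') =
        dist (comp b e) (comp b e') := fun b =>
      (congrArg₂ dist (hez b) (hez' b)).trans (dist_inc (x.k, b) _ _)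
    exact congrArg₂ (fun r s : ℝ => |r - s|) (key true) (key false)
  close_pred n q x z := by
    refine truth_or_elim fun h => ?_
    by_cases hz : ∃ i, (posSystem Sg A hA).pre (z i) x = 0
    · exact Or.inl hz
    refine Or.inr ?_
    push Not at hz
    obtain ⟨i, c⟩ := x
    obtain ⟨x, rfl, h⟩ := exists_of_rk (i := i) h
    choose e he hez using fun i => exists_of_pre (not_not.1 fun hne => hz i (truth_eq_zero.2 hne))
    have key : ∀ b, (posSystem Sg A hA).bpred q.2 (fun i => (posSystem Sg A hA).g b (z i)) =
        (A b x.k).toPointed.pred q.2 fun i => comp b (e i) := fun b =>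
      (congrArg _ (funext fun i => hez i b)).trans (posSystem_bpred hA (x.k, b) q.2 _)
    rw [key, key]
    obtain ⟨n, R⟩ := q
    cases (R : PointedRel Sg.lang n) with
    | rel R => exact (x.close h).pred R e he
  close_op n q x z' z := by
    refine truth_or_elim fun h => ?_
    by_cases hz : ∃ i, (posSystem Sg A hA).pre (z i) x = 0
    · exact Or.inl hz
    refine Or.inr (truth_or_elim fun hz' => ?_)
    push Not at hz
    obtain ⟨i, c⟩ := x
    obtain ⟨x, rfl, h⟩ := exists_of_rk (i := i) h
    choose e he hez using fun i => exists_of_pre (not_not.1 fun hne => hz i (truth_eq_zero.2 hne))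
    obtain ⟨e', he', hez'⟩ := exists_of_pre hz'
    have key : ∀ b, dist ((posSystem Sg A hA).bop q.2 (fun i => (posSystem Sg A hA).g b (z i)))
        ((posSystem Sg A hA).g b z') =
          dist ((A b x.k).toPointed.op q.2 fun i => comp b (e i)) (comp b e') := fun b =>
      (congrArg₂ dist ((congrArg _ (funext fun i => hez i b)).trans
        (posSystem_bop hA (x.k, b) q.2 _)) (hez' b)).trans (dist_inc (x.k, b) _ _)
    refine (le_of_eq (congrArg₂ (fun r s : ℝ => |r - s|) (key true) (key false))).trans ?_
    obtain ⟨n, f⟩ := q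
    cases (f : PointedFun Sg.lang n) with
    | fn f => exact (x.close h).op f e he e' he'
    | cst c =>
      have := (x.close h).op c Fin.elim0 (fun i => i.elim0) e' he'
      rw [MetStr.op_eq_constVal, MetStr.op_eq_constVal] at this
      exact this

theorem isomorphic_fiber (h : HasFibers (posSystem Sg A hA)) (b : Bool) (x : SysCarrier A) :
    (A b (game x.idx)).toPointed.Isomorphic (h.str b x) := by
  let e : A b (game x.idx) → h.str b x := fun a =>
    ⟨inc (game x.idx, b) a, posSystem_fib_inc hA b x a⟩
  have he : Isometry e := Isometry.of_dist_eq fun a a' => dist_inc (game x.idx, b) a a'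
  have hs : Function.Surjective e := by
    rintro ⟨y, hy⟩
    obtain ⟨a, rfl⟩ := posSystem_fib hA (hy.trans_ne one_ne_zero)
    exact ⟨a, rfl⟩
  refine ⟨⟨Equiv.ofBijective e ⟨he.injective, hs⟩, he⟩, fun f a => ?_, fun R a => ?_⟩
  · exact Subtype.ext (posSystem_bop hA (game x.idx, b) f a).symm
  · exact (posSystem_bpred hA (game x.idx, b) R a).symm

theorem exists_rk_eq (hwin : ∀ k : ℕ, Win (1 / ((k : ℝ) + 1)) (A true k) (A false k) (k + 1) [])
    (k : ℕ) : ∃ x : SysCarrier A, game x.idx = k ∧ (posSystem Sg A hA).rk k x = 1 ∧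
      (posSystem Sg A hA).rk (k + 1) x = 0 := by
  obtain ⟨x, hk, hl⟩ := exists_start hwin k
  refine ⟨x.elem, hk, truth_eq_one.2 ?_, truth_eq_zero.2 fun h => ?_⟩
  · change k ≤ x.k + 1 - x.l.length
    omega
  · change k + 1 ≤ x.k + 1 - x.l.length at h
    omega

end PosSystem

/-- Given games of increasing length and precision in which the second player can survive, there is
a system of positions with elements of any exact finite rank whose fibers are the structures
of the games. -/
theorem exists_isSystem {Sg : Signature.{u}} (A : Bool → ℕ → MetStr Sg.lang)
    (hA : ∀ b k, Sg.IsStr (A b k))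
    (hwin : ∀ k : ℕ, Win (1 / ((k : ℝ) + 1)) (A true k) (A false k) (k + 1) []) :
    ∃ M : MetStr (sysLang Sg.lang), IsSystem M ∧ ∀ k, ∃ x : M, M.rk k x = 1 ∧
      M.rk (k + 1) x = 0 ∧ ∀ (h : HasFibers M) (b : Bool),
        (A b k).toPointed.Isomorphic (h.str b x) := by
  refine ⟨posSystem Sg A hA, isSystem_posSystem hA hwin, fun k => ?_⟩
  obtain ⟨x, rfl, h₁, h₂⟩ := exists_rk_eq hA hwin k
  exact ⟨x, h₁, h₂, fun h b => isomorphic_fiber hA h b x⟩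

/-! ### Positions from which infinitely many rounds can be played -/

theorem MetStr.Isomorphic.expandNull {M N : MetStr S} (h : M.Isomorphic N) {ν : Type u}
    (q : ν → Set.Icc (0 : ℝ) 1) : (M.expandNull q).Isomorphic (N.expandNull q) := by
  obtain ⟨e, hop, hpred⟩ := h
  refine ⟨e, ?_, ?_⟩
  · rintro n (f | f) a
    · exact hop f a
    · exact PEmpty.elim f
  · rintro n (R | r) a
    · exact hpred R a
    · rfl

theorem eq_of_forall_abs_sub_le {r s : ℝ} (h : ∀ n : ℕ, |r - s| ≤ ((1 / (n + 1) : ℚ) : ℝ)) :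
    r = s := by
  refine sub_eq_zero.1 (abs_nonpos_iff.1 (le_of_forall_pos_le_add fun ε hε => ?_))
  obtain ⟨n, hn⟩ := exists_nat_one_div_lt hε
  have h1 := h n
  push_cast at h1
  linarith

namespace ValuedLogic

variable {L : ValuedLogic.{u}}

theorem Axiomatizable.pullback_null {α β : Type} {ν ν' : Type u}
    {P : Pt (S.sum (nullLang ν)) α → Prop} (hP : L.Axiomatizable P) (i : S →ᴸ S')
    (hi : i.Injective) (g : ν → ν') (hg : Function.Injective g) (σ : α → β)
    (hσ : Function.Injective σ) :
    L.Axiomatizable fun p : Pt (S'.sum (nullLang ν')) β =>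
      P ⟨((p.1.reduct LHom.sumInl).reduct i).expandNull fun r => p.1.nullVal (newNull S' (g r)),
        fun a => p.2 (σ a)⟩ := by
  have hinj : (nullHom ((LHom.sumInl : S' →ᴸ S'.sum (nullLang ν')).comp i)
      fun r => newNull S' (g r)).Injective :=
    nullHom_injective (injective_comp LHom.sumInl_injective hi) (newNull_injective.comp hg)
      fun R r h => by cases h
  exact (hP.pullback _ hinj σ hσ).congr fun p =>
    hP.reduct_nullHom ((LHom.sumInl : S' →ᴸ S'.sum (nullLang ν')).comp i) _ p.1 _

end ValuedLogic

theorem IsSystem.rk_antitone {M : MetStr (sysLang S)} (h : IsSystem M) (x : M) :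
    Antitone fun n => M.rk n x := antitone_nat_of_succ_le fun n => h.rk_succ n x

theorem IsSystem.rk_eq_one_of_le {M : MetStr (sysLang S)} (h : IsSystem M) {x : M} {m n : ℕ}
    (hmn : m ≤ n) (hn : M.rk n x = 1) : M.rk m x = 1 := by
  refine (h.rk_or m x).resolve_left fun h0 => ?_
  have := h.rk_antitone x hmn
  simp only [hn, h0] at this
  linarith

section Rank

variable {ν : Type u} (F : Bool → ℕ → Pt ((sysLang S).sum (nullLang ν)) (Fin 1) → ℝ)

/-- The truth values `q (true, ·)` and `q (false, ·)` of the nullary predicates in the two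
structures belonging to the position `x` satisfy the conditions `F`, and they are close to each
other as long as many rounds are left. -/
structure Admissible (M : MetStr (sysLang S)) (q : Bool × ν → Set.Icc (0 : ℝ) 1) (x : M) :
    Prop where
  sat : ∀ b n, F b n ⟨M.expandNull fun v => q (b, v), fun _ => x⟩ = 1
  close : ∀ n, M.rk n x = 0 ∨
    ∀ v, |(q (true, v) : ℝ) - q (false, v)| ≤ ((1 / (n + 1) : ℚ) : ℝ)

open ValuedLogic

variable {F} {L : ValuedLogic.{u}}

theorem axiomatizable_admissible (hL : L.HasBasic) [Finite ν] (hF : ∀ b n, L.Definable (F b n)) :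
    L.Axiomatizable fun p : Pt ((sysLang S).sum (nullLang (Bool × ν))) (Fin 1) =>
      Admissible F (p.1.reduct LHom.sumInl) (fun r => p.1.nullVal (newNull (sysLang S) r))
        (p.2 0) := by
  have h1 : L.Axiomatizable fun p : Pt ((sysLang S).sum (nullLang (Bool × ν))) (Fin 1) =>
      ∀ b n, F b n ⟨(p.1.reduct LHom.sumInl).expandNull fun v =>
        p.1.nullVal (newNull (sysLang S) (b, v)), fun _ => p.2 0⟩ = 1 :=
    .forall (fun b => .forall (fun n =>
      ((hF b n).eq_one.pullback_null (LHom.id _) injective_id (fun v => (b, v))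
        (Prod.mk_right_injective b) id Function.injective_id).congr fun p => by
          rw [show (fun _ => p.2 0) = fun a => p.2 (id a) from
            funext fun a => congrArg p.2 (Subsingleton.elim _ _)]
          rfl) hL) hL
  have h2 : L.Axiomatizable fun p : Pt ((sysLang S).sum (nullLang (Bool × ν))) (Fin 1) =>
      ∀ n, (p.1.reduct LHom.sumInl).rk n (p.2 0) = 0 ∨
        ∀ v, |(p.1.nullVal (newNull (sysLang S) (true, v)) : ℝ) -
          p.1.nullVal (newNull (sysLang S) (false, v))| ≤ ((1 / (n + 1) : ℚ) : ℝ) := by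
    refine .forall (fun n => .or ((hL.eq_zero (hL.rk n (0 : Fin 1))).pullback LHom.sumInl
      LHom.sumInl_injective id Function.injective_id) (.forall (fun v => ?_) hL) hL) hL
    refine (hL.le_one_div (hL.lukClosed.absSub
      (hL.pred (newNull (sysLang S) (true, v)) fun i => i.elim0)
      (hL.pred (newNull (sysLang S) (false, v)) fun i => i.elim0)) n).congr fun p => ?_
    rw [p.1.pred_eq_nullVal, p.1.pred_eq_nullVal]
  exact (h1.and h2 hL).congr fun p => ⟨fun h => ⟨h.1, h.2⟩, fun h => ⟨h.1, h.2⟩⟩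

/-- From positions with arbitrarily large finite ranks one obtains, in another system, a position
from which infinitely many rounds can be played. In the two structures belonging to it,
the nullary predicates have the same truth values. Omitting types replaces compactness here: the
chain consists of admissible positions whose ranks do not decrease, and no `j` remains a bound. -/
theorem exists_infinite_rank {κ : Cardinal.{u}} (H : OmittingLogic L κ) [Finite S.Symbols]
    [Finite ν] (hF : ∀ b n, L.Definable (F b n)) (M₀ : MetStr (sysLang S)) (hM₀ : IsSystem M₀)
    (x₀ : ℕ → M₀) (q₀ : ℕ → Bool × ν → Set.Icc (0 : ℝ) 1)
    (hgood : ∀ k, Admissible F M₀ (q₀ k) (x₀ k)) (hrk : ∀ k, M₀.rk k (x₀ k) = 1) :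
    ∃ M : MetStr (sysLang S), IsSystem M ∧ ∃ (x : M) (q : ν → Set.Icc (0 : ℝ) 1),
      (∀ n, M.rk n x = 1) ∧ ∀ b n, F b n ⟨M.expandNull q, fun _ => x⟩ = 1 := by
  have hL := H.basic
  let K := ULift.{u} ℕ
  let S₁ := chainLang (sysLang S) K (Bool × ν) 1
  let i₀ : sysLang S →ᴸ S₁ := chainHom _ _ _ _
  have hi₀ : i₀.Injective := chainHom_injective _ _ _ _
  have hgoodAx := axiomatizable_admissible hL hF
  -- the theory of a system with constants for positions of all finite ranks
  let T : MetStr S₁ → Prop := fun N => IsSystem (N.reduct i₀) ∧ ∀ k : ℕ,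
    Admissible F (N.reduct i₀) (chainNull N (.up k)) (chainVal N (.up k) 0) ∧
      (N.reduct i₀).rk k (chainVal N (.up k) 0) = 1
  have hT : L.AxiomatizableClass T := by
    refine ((axiomatizableClass_isSystem hL).pullback i₀ hi₀).and (.forall fun k => .and ?_ ?_)
    · refine (hgoodAx.subst_null i₀ (chainNullSymb (sysLang S) 1 (ULift.up k))
        (chainConst (sysLang S) (Bool × ν) (ULift.up k)) (nullHom_injective hi₀ ?_ ?_) ?_ ?_)
      · intro r r' h
        exact congrArg Prod.snd (newNull_injective (Sum.inl_injective h))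
      · intro R r h
        cases Sum.inl_injective h
      · intro r r' h
        exact congrArg Prod.snd (newConst_injective h)
      · intro f r h
        cases h
    · refine ((hL.rk k (0 : Fin 1)).eq_one.subst i₀
        (chainConst (sysLang S) (Bool × ν) (ULift.up k)) (constLHom_injective hi₀ ?_ ?_))
      · intro r r' h
        exact congrArg Prod.snd (newConst_injective h)
      · intro f r h
        cases h
  -- ranks increase along the chain, and the positions of finite rank named by the constants
  -- provide the extensions
  let le : Pt (S₁.sum (nullLang ((Bool × ν) ⊕ (Bool × ν)))) (Fin 1 ⊕ Fin 1) → Prop := fun p =>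
    (Admissible F ((p.1.reduct LHom.sumInl).reduct i₀) (fun r => p.1.nullVal (newNull S₁ (.inl r)))
        (p.2 (.inl 0)) ∧
      Admissible F ((p.1.reduct LHom.sumInl).reduct i₀) (fun r => p.1.nullVal (newNull S₁ (.inr r)))
        (p.2 (.inr 0))) ∧
    ∀ n, ((p.1.reduct LHom.sumInl).reduct i₀).rk n (p.2 (.inl 0)) = 0 ∨
      ((p.1.reduct LHom.sumInl).reduct i₀).rk n (p.2 (.inr 0)) = 1
  have hle : L.Axiomatizable le := by
    refine .and (.and ?_ ?_ hL) (.forall (fun n => ?_) hL) hL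
    · exact hgoodAx.pullback_null i₀ hi₀ Sum.inl Sum.inl_injective Sum.inl Sum.inl_injective
    · exact hgoodAx.pullback_null i₀ hi₀ Sum.inr Sum.inr_injective Sum.inr Sum.inr_injective
    · exact (((hL.eq_zero (hL.rk n (Sum.inl 0))).or (hL.rk n (Sum.inr 0)).eq_one hL).pullback
        (α := Fin 1 ⊕ Fin 1) i₀ hi₀ id Function.injective_id).pullback LHom.sumInl
        LHom.sumInl_injective id Function.injective_id
  let avoid : ℕ → Pt (S₁.sum (nullLang (Bool × ν))) (Fin 0 ⊕ Fin 1) → Prop := fun j p =>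
    ((p.1.reduct LHom.sumInl).reduct i₀).rk j (p.2 (.inr 0)) = 0
  have havoid : ∀ j, L.Axiomatizable (avoid j) := fun j =>
    ((hL.eq_zero (hL.rk j (Sum.inr 0 : Fin 0 ⊕ Fin 1))).pullback i₀ hi₀ id
      Function.injective_id).pullback LHom.sumInl LHom.sumInl_injective id Function.injective_id
  let N₀ : MetStr S₁ := M₀.expandChain (fun k _ => x₀ k.down) fun k => q₀ k.down
  have hmodel : ∃ N : (Signature.of N₀).Str, T N.1 ∧ ∃ (x : Fin 1 → N.1)
      (q : Bool × ν → Set.Icc (0 : ℝ) 1), le ⟨N.1.expandNull (Sum.elim q q), Sum.elim x x⟩ :=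
    ⟨⟨N₀, Signature.isStr_of _⟩, ⟨hM₀, fun k => ⟨hgood k, hrk k⟩⟩, fun _ => x₀ 0, q₀ 0,
      ⟨hgood 0, hgood 0⟩, fun n => hM₀.rk_or n (x₀ 0)⟩
  have hext : ∀ N : (Signature.of N₀).Str, T N.1 → ∀ (x x' : Fin 1 → N.1)
      (q q' : Bool × ν → Set.Icc (0 : ℝ) 1),
      le ⟨N.1.expandNull (Sum.elim q q'), Sum.elim x x'⟩ →
      ∀ (j : ℕ) (a : Fin 0 → N.1), ∃ (y : Fin 1 → N.1) (s : Bool × ν → Set.Icc (0 : ℝ) 1),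
        le ⟨N.1.expandNull (Sum.elim s s), Sum.elim y y⟩ ∧
        (∀ (z : Fin 1 → N.1) (t : Bool × ν → Set.Icc (0 : ℝ) 1),
          le ⟨N.1.expandNull (Sum.elim t q), Sum.elim z x⟩ →
          le ⟨N.1.expandNull (Sum.elim t s), Sum.elim z y⟩) ∧
        ¬ avoid j ⟨N.1.expandNull s, Sum.elim a y⟩ := by
    rintro ⟨N, hN⟩ ⟨hsys, hc⟩ x x' q q' ⟨⟨hgx, -⟩, -⟩ j a
    by_cases hall : ∀ n, (N.reduct i₀).rk n (x 0) = 1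
    · refine ⟨x, q, ⟨⟨hgx, hgx⟩, fun n => hsys.rk_or n (x 0)⟩, fun z t h => h, ?_⟩
      exact fun h => one_ne_zero ((hall j).symm.trans h)
    · push Not at hall
      obtain ⟨m, hm⟩ := hall
      obtain ⟨hgc, hrc⟩ := hc (max m j)
      refine ⟨fun _ => chainVal N (.up (max m j)) 0, chainNull N (.up (max m j)),
        ⟨⟨hgc, hgc⟩, fun n => hsys.rk_or n _⟩, ?_, ?_⟩
      · rintro z t ⟨⟨hgz, -⟩, hzx⟩
        refine ⟨⟨hgz, hgc⟩, fun n => (hzx n).imp_right fun h => ?_⟩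
        refine hsys.rk_eq_one_of_le (le_max_of_le_left ?_) hrc
        by_contra! hmn
        exact hm (hsys.rk_eq_one_of_le hmn.le h)
      · exact fun h => one_ne_zero
          ((hsys.rk_eq_one_of_le (le_max_right m j) hrc).symm.trans h)
  obtain ⟨⟨N, _⟩, ⟨hsys, -⟩, c, q, hch, hch'⟩ := exists_generic_chain_null H.fin H.reg H.unc H.otp
    (Signature.of N₀) hT hle havoid hmodel hext
  choose β hβ using fun j => hch' j Fin.elim0
  obtain ⟨γ, hγ⟩ := exists_gt_of_countable H.reg H.unc (Set.countable_range β)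
  have hle' := fun j => hch _ _ (hγ _ ⟨j, rfl⟩)
  have hrkγ : ∀ n, (N.reduct i₀).rk n (c γ 0) = 1 := fun n => ((hle' n).2 n).resolve_left (hβ n)
  have hgγ : Admissible F (N.reduct i₀) (q γ) (c γ 0) := (hle' 0).1.2
  have hq : ∀ v, q γ (true, v) = q γ (false, v) := by
    intro v
    exact Subtype.ext (eq_of_forall_abs_sub_le fun n => (hgγ.close n).resolve_left
      (fun h => one_ne_zero ((hrkγ n).symm.trans h)) v)
  refine ⟨N.reduct i₀, hsys, c γ 0, fun v => q γ (true, v), hrkγ, ?_⟩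
  rintro (_ | _) n
  · exact (congrArg (fun r => F false n ⟨MetStr.expandNull (S := sysLang S)
      (MetStr.reduct (S' := S₁) N i₀) r, fun _ => c γ 0⟩) (funext hq)).trans (hgγ.sat false n)
  · exact hgγ.sat true n

end Rank

/-! ### A common model from a generic sequence of positions -/

open ValuedLogic

theorem ValuedLogic.Definable.eta_null {L : ValuedLogic.{u}} {α : Type} {ν : Type u}
    {F : Pt (S.sum (nullLang ν)) α → ℝ} (hF : L.Definable F) (N : MetStr (S.sum (nullLang ν)))
    (v : α → N) : F ⟨N, v⟩ =
      F ⟨(N.reduct LHom.sumInl).expandNull fun r => N.nullVal (newNull S r), v⟩ := by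
  refine hF.eq_of_iso (N := (N.reduct LHom.sumInl).expandNull fun r => N.nullVal (newNull S r))
    (IsometryEquiv.refl N) ?_ ?_ v
  · rintro n (f | e) a
    · rfl
    · exact PEmpty.elim e
  · rintro n (R | r) a
    · rfl
    · cases n with
      | zero => exact N.pred_eq_nullVal (newNull S r) a
      | succ n => exact PEmpty.elim r

theorem HasFibers.str_isomorphic {M : MetStr (sysLang S)} (h : HasFibers M) {b : Bool} {x y : M}
    (hxy : ∀ z, M.fib b x z = M.fib b y z) : (h.str b x).Isomorphic (h.str b y) := by
  have hset : {z | M.fib b x z = 1} = {z | M.fib b y z = 1} := by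
    ext z
    exact iff_of_eq (congrArg (· = 1) (hxy z))
  exact ⟨⟨Equiv.setCongr hset, fun _ _ => rfl⟩, fun _ _ => rfl, fun _ _ => rfl⟩

namespace IsSystem

variable {M : MetStr (sysLang S)} (h : IsSystem M)
include h

theorem fib_eq {x y : M} (hxy : M.pre x y = 1) (b : Bool) (z : M) :
    M.fib b x z = M.fib b y z := by
  obtain ⟨h1, h2⟩ := (h.pre_fib b x y z).resolve_left fun h0 => one_ne_zero (hxy.symm.trans h0)
  exact le_antisymm h1 h2

theorem pre_tr {x y z : M} (hxy : M.pre x y = 1) (hyz : M.pre y z = 1) : M.pre x z = 1 :=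
  ((h.pre_trans x y z).resolve_left fun h0 => one_ne_zero (hxy.symm.trans h0)).resolve_left
    fun h0 => one_ne_zero (hyz.symm.trans h0)

theorem pre_self {x : M} (hx : ∀ n, M.rk n x = 1) : M.pre x x = 1 :=
  (h.pre_refl x).resolve_left fun h0 => one_ne_zero ((hx 0).symm.trans h0)

theorem exists_forth {x : M} (hx : ∀ n, M.rk n x = 1) {b : Bool} {a : M} (ha : M.fib b x a = 1)
    {ε : ℝ} (hε : 0 < ε) :
    ∃ y, M.pre x y = 1 ∧ (∀ n, M.rk n y = 1) ∧ dist (M.g b y) a < ε := by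
  have h1 := ((h.forth b x a).resolve_left
    fun h0 => one_ne_zero ((hx 1).symm.trans h0)).resolve_left fun h0 => one_ne_zero (ha.symm.trans h0)
  obtain ⟨y, hy⟩ := exists_lt_of_lt_ciSup
    (show 1 - min ε 1 < ⨆ y, min (M.step x y) (1 - dist (M.g b y) a) by
      rw [h1]
      linarith [lt_min hε (zero_lt_one' ℝ)])
  obtain ⟨h2, h3⟩ := lt_min_iff.1 hy
  have h4 : M.step x y = 1 := (h.step_or x y).resolve_left fun h0 => by
    linarith [min_le_right ε 1]
  refine ⟨y, (h.pre_or x y).resolve_left fun h0 => ?_, fun n => ?_, ?_⟩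
  · linarith [h.step_pre x y]
  · exact ((h.rk_step n x y).resolve_left fun h0 => one_ne_zero ((hx _).symm.trans h0)).resolve_left
      fun h0 => one_ne_zero (h4.symm.trans h0)
  · linarith [min_le_left ε 1]

end IsSystem

/-- From a directed family of positions of infinite rank, one reads off two `S`-structures with
a common completion, provided that the points of the positions are dense. -/
theorem IsSystem.exists_common_completion {M : MetStr (sysLang S)} (h : IsSystem M)
    (hf : HasFibers M) (q : S.Relations 0 → Set.Icc (0 : ℝ) 1) (Z : Set M) (x : M)
    (hdir : ∀ {n : ℕ} (z : Fin n → M), (∀ i, z i ∈ Z) → ∃ y, (∀ n, M.rk n y = 1) ∧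
      ∀ i, M.pre (z i) y = 1)
    (hfib : ∀ b, ∀ z ∈ Z, M.fib b x (M.g b z) = 1)
    (hdense : ∀ b a, M.fib b x a = 1 → ∀ ε > 0, ∃ z ∈ Z, dist (M.g b z) a < ε) :
    ∃ C : MetStr S, ∀ b, ((hf.str b x).ofPointed q).IsCompletion C := by
  let pt : ∀ b, Z → (hf.str b x).ofPointed q := fun b z => ⟨M.g b z, hfib b z z.2⟩
  have hpt : ∀ b, DenseRange (pt b) := fun b => Metric.denseRange_iff.2 fun a ε hε => by
    obtain ⟨z, hz, hza⟩ := hdense b a.1 a.2 ε hε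
    exact ⟨⟨z, hz⟩, (dist_comm _ _).trans_lt hza⟩
  have hcons : ∀ {n : ℕ} (z : Fin n → Z) (z' : Z), ∃ y, (∀ n, M.rk n y = 1) ∧
      M.pre z' y = 1 ∧ ∀ i, M.pre (z i) y = 1 := by
    intro n z z'
    obtain ⟨y, hy, hzy⟩ := hdir (Fin.cons z'.1 fun i => (z i).1 : Fin (n + 1) → M)
      (Fin.cases z'.2 fun i => (z i).2)
    exact ⟨y, hy, hzy 0, fun i => hzy i.succ⟩
  have hne : ∀ {r : ℝ}, r = 1 → r ≠ 0 := fun h h0 => one_ne_zero (h.symm.trans h0)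
  have hdist : ∀ z z' : Z, dist (pt true z) (pt true z') = dist (pt false z) (pt false z') := by
    intro z z'
    obtain ⟨y, hy, hz', hz⟩ := hcons (fun _ : Fin 1 => z) z'
    exact eq_of_forall_abs_sub_le fun n => (((h.close_dist n y z z').resolve_left
      (hne (hy n))).resolve_left (hne (hz 0))).resolve_left (hne hz')
  have hop : ∀ {n : ℕ} (f : (pointed S).Functions n) (z : Fin n → Z) (z' : Z),
      dist (M.bop f fun i => M.g true (z i)) (M.g true z') =
        dist (M.bop f fun i => M.g false (z i)) (M.g false z') := by
    intro n f z z'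
    obtain ⟨y, hy, hz', hz⟩ := hcons z z'
    exact eq_of_forall_abs_sub_le fun n => (((h.close_op n ⟨_, f⟩ y z' fun i => z i).resolve_left
      (hne (hy n))).resolve_left (fun ⟨i, hi⟩ => hne (hz i) hi)).resolve_left (hne hz')
  have hcst : ∀ b (c : S.Functions 0) (a : hf.str b x) (z : Z),
      ((hf.str b x).op (cstSymb c) fun _ => a).1 = M.bop (cstSymb c) fun _ => M.g b z := by
    intro b c a z
    exact dist_eq_zero.1 (((h.fib_cst b c x a.1 (M.g b z)).resolve_left (hne a.2)).resolve_left
      (hne (hfib b z z.2)))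
  obtain ⟨C, h₁, h₂⟩ := MetStr.exists_common_completion ((hf.str true x).ofPointed q)
    ((hf.str false x).ofPointed q) (pt true) (pt false) (hpt true) (hpt false) hdist
    (by
      rintro (_ | n) R z
      · rfl
      · obtain ⟨y, hy, -, hz⟩ := hcons z (z 0)
        exact eq_of_forall_abs_sub_le fun m => ((h.close_pred m
          ⟨n + 1, (PointedRel.rel R : (pointed S).Relations _)⟩ y fun i => z i).resolve_left
            (hne (hy m))).resolve_left fun ⟨i, hi⟩ => hne (hz i) hi)
    (by
      rintro (_ | n) f z z'
      · refine Eq.trans ?_ ((hop (cstSymb f) (fun _ => z') z').trans ?_)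
        · exact congrArg (fun y => dist y (M.g true z')) (hcst true f _ z')
        · exact congrArg (fun y => dist y (M.g false z')) (hcst false f _ z').symm
      · exact hop (PointedFun.fn f : (pointed S).Functions _) z z')
  exact ⟨C, Bool.rec h₂ h₁⟩

/-- If two sentences have models between which the second player can survive games of any length
and precision, then they have a common model. A generic chain of positions of infinite rank, along
which the fibers stay the same and every point of a fiber is approximated by a move, determines
dense subsets of the two fibers that agree on atomic formulas; their common completion is a model
of both sentences. -/
theorem OmittingLogic.exists_common_model {L : ValuedLogic.{u}} {κ : Cardinal.{u}}
    (H : OmittingLogic L κ) (Sg : Signature.{u}) [Finite Sg.lang.Symbols]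
    (A : Bool → ℕ → MetStr Sg.lang) (hA : ∀ b k, Sg.IsStr (A b k))
    (hwin : ∀ k : ℕ, Win (1 / ((k : ℝ) + 1)) (A true k) (A false k) (k + 1) [])
    (χ : Bool → L.Sent Sg.lang) (hχ : ∀ b k, L.Holds (A b k) (χ b)) :
    ∃ C : MetStr Sg.lang, ∀ b, L.Holds C (χ b) := by
  have hL := H.basic
  have hfun : Finite (Sg.lang.Functions 0) :=
    Finite.of_injective (fun f => (Sum.inl ⟨0, f⟩ : Sg.lang.Symbols)) fun f g h => by simpa using h
  have hrel : Finite (Sg.lang.Relations 0) :=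
    Finite.of_injective (fun f => (Sum.inr ⟨0, f⟩ : Sg.lang.Symbols)) fun f g h => by simpa using h
  choose Θ hΘ₁ hΘ₂ using fun b => H.exists_pointed_sentences (χ b)
  choose F hF hFΘ using fun b n => H.rel.exists_definable (Θ b n) b
  -- the system of positions of the given games
  obtain ⟨M₀, hM₀, hx₀⟩ := exists_isSystem A hA hwin
  choose x₀ hrk₀ hrk₁ hiso using hx₀
  obtain ⟨M, hM, x, q, hx, hxF⟩ := exists_infinite_rank H hF M₀ hM₀ x₀
    (fun k r => (A r.1 k).nullVal r.2)
    (fun k => by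
      refine ⟨fun b n => ?_, fun n => ?_⟩
      · rw [hFΘ b n M₀ hM₀.hasFibers]
        refine Eq.trans ?_ (hΘ₁ b (A b k) (hχ b k) n)
        exact (L.val_iso _ _ _ ((hiso k hM₀.hasFibers b).expandNull _)).symm
      · by_cases hnk : n ≤ k
        · refine Or.inr fun v => ?_
          refine ((hwin k).close.pred v Fin.elim0 fun i => i.elim0).trans' (le_of_eq ?_) |>.trans ?_
          · rw [MetStr.pred_eq_nullVal, MetStr.pred_eq_nullVal]
          · push_cast
            exact one_div_le_one_div_of_le (by positivity) (by exact_mod_cast Nat.succ_le_succ hnk)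
        · refine Or.inl ((hM₀.rk_or n _).resolve_right fun h => ?_)
          exact one_ne_zero ((hM₀.rk_eq_one_of_le (Nat.succ_le_of_lt (not_le.1 hnk)) h).symm.trans
            (hrk₁ k)))
    hrk₀
  -- a generic sequence of positions from which infinitely many rounds can be played
  let ν := Sg.lang.Relations 0
  let S₂ : FirstOrder.Language.{u, u} := (sysLang Sg.lang).sum (nullLang ν)
  let ι : sysLang Sg.lang →ᴸ S₂ := LHom.sumInl
  have hι : ι.Injective := LHom.sumInl_injective
  let T : MetStr S₂ → Prop := fun N => IsSystem (N.reduct ι)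
  have hT : L.AxiomatizableClass T := (axiomatizableClass_isSystem hL).pullback ι hι
  let le : Pt S₂ (Fin 1 ⊕ Fin 1) → Prop := fun p =>
    (p.1.reduct ι).pre (p.2 (.inl 0)) (p.2 (.inr 0)) = 1 ∧
    (∀ n, (p.1.reduct ι).rk n (p.2 (.inl 0)) = 1) ∧
    (∀ n, (p.1.reduct ι).rk n (p.2 (.inr 0)) = 1) ∧
    ∀ b n, F b n ⟨p.1, fun i => p.2 (.inl i)⟩ = 1 ∧ F b n ⟨p.1, fun i => p.2 (.inr i)⟩ = 1
  have hle : L.Axiomatizable le := by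
    refine .and ?_ (.and ?_ (.and ?_ ?_ hL) hL) hL
    · exact (hL.pre (Sum.inl (0 : Fin 1)) (Sum.inr (0 : Fin 1))).eq_one.pullback ι hι id
        Function.injective_id
    · exact (Axiomatizable.forall (fun n => (hL.rk n (Sum.inl (0 : Fin 1) :
        Fin 1 ⊕ Fin 1)).eq_one) hL).pullback ι hι id Function.injective_id
    · exact (Axiomatizable.forall (fun n => (hL.rk n (Sum.inr (0 : Fin 1) :
        Fin 1 ⊕ Fin 1)).eq_one) hL).pullback ι hι id Function.injective_id
    · exact .forall (fun b => .forall (fun n =>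
        ((hF b n).rename Sum.inl Sum.inl_injective).eq_one.and
          ((hF b n).rename Sum.inr Sum.inr_injective).eq_one hL) hL) hL
  obtain ⟨e, he⟩ := exists_surjective_nat (Bool × ℕ)
  have hpos : ∀ j, (0 : ℝ) < ((1 / ((e j).2 + 1) : ℚ) : ℝ) := fun j => by positivity
  -- `avoid j` says that the point `a` of the fiber `b` stays at distance `1 / (m + 1)` from all
  -- moves before `y`, where `(b, m)` is the `j`-th pair
  let avoid : ℕ → Pt S₂ (Fin 1 ⊕ Fin 1) → Prop := fun j p =>
    (p.1.reduct ι).fib (e j).1 (p.2 (.inr 0)) (p.2 (.inl 0)) = 1 ∧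
    ∀ z : Fin 1 → p.1, ((1 / ((e j).2 + 1) : ℚ) : ℝ) ≤
      max (1 - (p.1.reduct ι).pre (z 0) (p.2 (.inr 0)))
        (dist ((p.1.reduct ι).g (e j).1 (z 0)) (p.2 (.inl 0)))
  have havoid : ∀ j, L.Axiomatizable (avoid j) := by
    intro j
    refine .and ?_ ?_ hL
    · exact (hL.fib (e j).1 (.var (Sum.inr (0 : Fin 1)))
        (.var (Sum.inl (0 : Fin 1)))).eq_one.pullback ι hι id Function.injective_id
    · refine Axiomatizable.forall_tuple (P := fun p : Pt S₂ ((Fin 1 ⊕ Fin 1) ⊕ Fin 1) =>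
        ((1 / ((e j).2 + 1) : ℚ) : ℝ) ≤
          max (1 - (p.1.reduct ι).pre (p.2 (.inr 0)) (p.2 (.inl (.inr 0))))
            (dist ((p.1.reduct ι).g (e j).1 (p.2 (.inr 0))) (p.2 (.inl (.inl 0))))) ?_ hL
      refine (hL.rat_le (hL.lukClosed.sup (hL.lukClosed.compl (hL.pre (Sum.inr (0 : Fin 1))
        (Sum.inl (Sum.inr (0 : Fin 1) : Fin 1 ⊕ Fin 1)))) (hL.dist (gTerm (e j).1 (Sum.inr 0))
          (.var (.inl (.inl 0)))))
        (show (0 : ℚ) ≤ 1 / ((e j).2 + 1) by positivity) ?_).pullback ι hι id Function.injective_id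
      rw [div_le_one (by positivity)]
      linarith [(Nat.cast_nonneg (e j).2 : (0 : ℚ) ≤ (e j).2)]
  -- positions before each other have the same fibers, so relativized sentences agree on them
  have hFfib : ∀ (N : MetStr S₂), T N → ∀ y y' : N, (N.reduct ι).pre y y' = 1 → ∀ b n,
      F b n ⟨N, fun _ => y⟩ = F b n ⟨N, fun _ => y'⟩ := by
    intro N hN y y' hyy b n
    rw [(hF b n).eta_null, (hF b n).eta_null]
    refine (hFΘ b n (N.reduct ι) hN.hasFibers _ y).trans (Eq.trans ?_
      (hFΘ b n (N.reduct ι) hN.hasFibers _ y').symm)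
    exact L.val_iso _ _ _ ((hN.hasFibers.str_isomorphic (hN.fib_eq hyy b)).expandNull _)
  have hmodel : ∃ N : (Signature.of (M.expandNull q)).Str, T N.1 ∧ ∃ x : Fin 1 → N.1,
      le ⟨N.1, Sum.elim x x⟩ :=
    ⟨⟨M.expandNull q, Signature.isStr_of _⟩, hM, fun _ => x, hM.pre_self hx, hx, hx,
      fun b n => ⟨hxF b n, hxF b n⟩⟩
  have hext : ∀ N : (Signature.of (M.expandNull q)).Str, T N.1 → ∀ x x' : Fin 1 → N.1,
      le ⟨N.1, Sum.elim x x'⟩ → ∀ (j : ℕ) (a : Fin 1 → N.1), ∃ y : Fin 1 → N.1,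
        le ⟨N.1, Sum.elim y y⟩ ∧
        (∀ z : Fin 1 → N.1, le ⟨N.1, Sum.elim z x⟩ → le ⟨N.1, Sum.elim z y⟩) ∧
        ¬ avoid j ⟨N.1, Sum.elim a y⟩ := by
    rintro ⟨N, hN⟩ hTN x x' ⟨-, hx, -, hxF⟩ j a
    replace hxF : ∀ b n, F b n ⟨N, x⟩ = 1 := fun b n => (hxF b n).1
    by_cases ha : (MetStr.reduct (S' := S₂) N ι).fib (e j).1 (x 0) (a 0) = 1
    · obtain ⟨y, hxy, hy, hya⟩ := hTN.exists_forth hx ha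
        (ε := ((1 / ((e j).2 + 1) : ℚ) : ℝ)) (by positivity)
      have hyF : ∀ b n, F b n ⟨N, fun _ => y⟩ = 1 := fun b n => by
        rw [← hFfib N hTN _ _ hxy, ← hxF b n]
        exact congrArg (fun v => F b n ⟨N, v⟩)
          (funext fun i => congrArg x (Subsingleton.elim _ _))
      have hyy := hTN.pre_self hy
      refine ⟨fun _ => y, ⟨hyy, hy, hy, fun b n => ⟨hyF b n, hyF b n⟩⟩, ?_, ?_⟩
      · rintro z ⟨hzx, hz, -, hzF⟩
        exact ⟨hTN.pre_tr hzx hxy, hz, hy, fun b n => ⟨(hzF b n).1, hyF b n⟩⟩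
      · rintro ⟨-, hav⟩
        refine absurd (hav fun _ => y) (not_le.2 (max_lt ?_ hya))
        exact (sub_eq_zero.2 hyy.symm).trans_lt (hpos j)
    · exact ⟨x, ⟨hTN.pre_self hx, hx, hx, fun b n => ⟨hxF b n, hxF b n⟩⟩, fun z h => h,
        fun h => ha h.1⟩
  obtain ⟨⟨N, _⟩, hTN, c, hch, hch'⟩ := exists_generic_chain H.fin H.reg H.unc H.otp
    (Signature.of (M.expandNull q)) hT hle havoid hmodel hext
  let N' : MetStr (sysLang Sg.lang) := MetStr.reduct (S' := S₂) N ι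
  have hN' : IsSystem N' := hTN
  have hgt : ∀ β, ∃ γ, β < γ := fun β => by
    obtain ⟨γ, hγ⟩ := exists_gt_of_countable H.reg H.unc (Set.countable_singleton β)
    exact ⟨γ, hγ β rfl⟩
  have hrk : ∀ β n, N'.rk n (c β 0) = 1 := fun β => by
    obtain ⟨γ, hγ⟩ := hgt β
    exact (hch β γ hγ).2.1
  have hcF : ∀ β b n, F b n ⟨N, c β⟩ = 1 := fun β b n => by
    obtain ⟨γ, hγ⟩ := hgt β
    exact ((hch β γ hγ).2.2.2 b n).1
  obtain ⟨β₀, -⟩ := hch' 0 fun _ => Classical.arbitrary _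
  have hfib : ∀ β b z, N'.fib b (c β 0) z = N'.fib b (c β₀ 0) z := by
    intro β b z
    rcases lt_trichotomy β β₀ with h | rfl | h
    · exact hN'.fib_eq (hch _ _ h).1 b z
    · rfl
    · exact (hN'.fib_eq (hch _ _ h).1 b z).symm
  let q' : ν → Set.Icc (0 : ℝ) 1 := fun r => MetStr.nullVal (S := S₂) N (newNull _ r)
  obtain ⟨C, hC⟩ := hN'.exists_common_completion hN'.hasFibers q'
    {z | ∃ β, N'.pre z (c β 0) = 1} (c β₀ 0)
    (by
      intro n z hz
      choose β hβ using hz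
      obtain ⟨γ, hγ⟩ := exists_gt_of_countable H.reg H.unc (Set.countable_range β)
      exact ⟨c γ 0, hrk γ, fun i => hN'.pre_tr (hβ i) (hch _ _ (hγ _ ⟨i, rfl⟩)).1⟩)
    (by
      rintro b z ⟨β, hz⟩
      rw [← hfib β]
      exact (hN'.pre_g b z _).resolve_left fun h0 => one_ne_zero (hz.symm.trans h0))
    (by
      intro b a ha ε hε
      obtain ⟨m, hm⟩ := exists_nat_one_div_lt hε
      obtain ⟨j, hj⟩ := he (b, m)
      obtain ⟨β, hβ⟩ := hch' j fun _ => a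
      have hfa : N'.fib (e j).1 (c β 0) a = 1 := by
        rw [hfib β, hj]
        exact ha
      obtain ⟨z, hz⟩ := not_forall.1 fun h => hβ ⟨hfa, h⟩
      obtain ⟨h1, h2⟩ := max_lt_iff.1 (not_le.1 hz)
      replace h1 : 1 - N'.pre (z 0) (c β 0) < ((1 / ((e j).2 + 1) : ℚ) : ℝ) := h1
      replace h2 : dist (N'.g (e j).1 (z 0)) a < ((1 / ((e j).2 + 1) : ℚ) : ℝ) := h2
      rw [hj] at h1 h2
      push_cast at h1 h2
      refine ⟨z 0, ⟨β, (hN'.pre_or _ _).resolve_left fun h0 => ?_⟩, h2.trans hm⟩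
      have : (1 : ℝ) / (m + 1) ≤ 1 := by
        rw [div_le_one (by positivity)]
        linarith [(Nat.cast_nonneg m : (0 : ℝ) ≤ m)]
      linarith)
  refine ⟨C, fun b => (H.comp _ _ _ (hC b) (χ b)).1 (hΘ₂ b _ q' ?_ fun n => ?_)⟩
  · intro f y z
    have hne : ∀ w : Fin 1 → hN'.hasFibers.str b (c β₀ 0), N'.fib b (c β₀ 0) (w 0).1 ≠ 0 :=
      fun w h0 => one_ne_zero ((w 0).2.symm.trans h0)
    have hw : ∀ w : Fin 1 → hN'.hasFibers.str b (c β₀ 0), w = fun _ => w 0 := fun w =>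
      funext fun i => congrArg w (Subsingleton.elim _ _)
    rw [hw y, hw z]
    exact Subtype.ext (dist_eq_zero.1 (((hN'.fib_cst b f (c β₀ 0) (y 0).1 (z 0).1).resolve_left
      (hne y)).resolve_left (hne z)))
  · refine (hFΘ b n N' hN'.hasFibers q' (c β₀ 0)).symm.trans ?_
    refine Eq.trans ?_ (hcF β₀ b n)
    refine ((hF b n).eta_null (S := sysLang Sg.lang) N _).symm.trans ?_
    exact congrArg (fun v => F b n ⟨N, v⟩)
      (funext fun i => congrArg (c β₀) (Subsingleton.elim _ _))

/-! ### Uniform approximation by formulas of basic continuous logic -/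

variable {L : ValuedLogic.{u}} {κ : Cardinal.{u}}

/-- The classes `φ ≥ s` and `φ ≤ r`, for `r < s`, are separated by the values of finitely many
sentences of basic continuous logic. -/
theorem OmittingLogic.exists_finite_separation (H : OmittingLogic L κ) (Sg : Signature.{u})
    [Finite Sg.lang.Symbols] (φ : L.Sent Sg.lang) {r s : ℚ} (hr : 0 ≤ r) (hrs : r < s)
    (hs : s ≤ 1) : ∃ Θ : Set (Formula Sg.lang 0), Θ.Finite ∧ ∃ δ > 0, ∀ M N : Sg.Str,
      (∀ θ ∈ Θ, |θ.val M.1 Fin.elim0 - θ.val N.1 Fin.elim0| ≤ δ) →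
        (s : ℝ) ≤ L.val φ M.1 → (r : ℝ) < L.val φ N.1 := by
  by_contra! hcon
  choose Θ hΘ δ hδ hwin using fun k : ℕ =>
    Formula.exists_finite_win (S := Sg.lang) (ε := 1 / ((k : ℝ) + 1)) (by positivity) (k + 1) 0
  choose M N hMN hM hN using fun k => hcon (Θ k) (hΘ k) (δ k) (hδ k)
  obtain ⟨cs, hcs⟩ := (H.basic.conn Sg.lang).2 s (hr.trans hrs.le) hs
  obtain ⟨cr, hcr⟩ := (H.basic.conn Sg.lang).2 r hr (hrs.le.trans hs)
  obtain ⟨χ₁, hχ₁⟩ := (H.basic.conn Sg.lang).1 cs φ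
  obtain ⟨χ₀, hχ₀⟩ := (H.basic.conn Sg.lang).1 φ cr
  have h₁ : ∀ K, L.Holds K χ₁ ↔ (s : ℝ) ≤ L.val φ K := fun K => by
    rw [Holds, hχ₁, hcs, lukImp_eq_one_iff]
  have h₀ : ∀ K, L.Holds K χ₀ ↔ L.val φ K ≤ r := fun K => by
    rw [Holds, hχ₀, hcr, lukImp_eq_one_iff]
  obtain ⟨C, hC⟩ := H.exists_common_model Sg (fun b k => bif b then (M k).1 else (N k).1)
    (by
      rintro (_ | _) k
      · exact (N k).2
      · exact (M k).2)
    (fun k => hwin k _ _ _ _ (hMN k) [] (by simp)) (fun b => bif b then χ₁ else χ₀)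
    (by
      rintro (_ | _) k
      · exact (h₀ _).2 (hN k)
      · exact (h₁ _).2 (hM k))
  have h1 := (h₁ C).1 (hC true)
  have h2 := (h₀ C).1 (hC false)
  have h3 : (r : ℝ) < s := by exact_mod_cast hrs
  linarith

/-- The separation of `φ ≥ s` from `φ ≤ r` by a single sentence: `ψ` is the maximum of bump
functions of the values of `Θ`, centered at those points `p` of a finite grid that are close to the values of
`Θ` in some structure with `φ ≥ s`. -/
theorem OmittingLogic.exists_separating_formula (H : OmittingLogic L κ) (Sg : Signature.{u})
    [Finite Sg.lang.Symbols] (φ : L.Sent Sg.lang) {r s : ℚ} (hr : 0 ≤ r) (hrs : r < s)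
    (hs : s ≤ 1) : ∃ ψ : Formula Sg.lang 0, ∀ M : Sg.Str,
      ((s : ℝ) ≤ L.val φ M.1 → ψ.val M.1 Fin.elim0 = 1) ∧
        (L.val φ M.1 ≤ r → ψ.val M.1 Fin.elim0 = 0) := by
  obtain ⟨Θ, hΘ, δ, hδ, hsep⟩ := H.exists_finite_separation Sg φ hr hrs hs
  have := hΘ.to_subtype
  have hLC := Formula.lukClosed (S := Sg.lang) (n := 0)
  obtain ⟨m, hm⟩ := exists_nat_one_div_lt (show 0 < δ / 3 by linarith)
  have hm1 : (1 / (m + 1 : ℕ) : ℝ) < δ / 3 := by push_cast; exact hm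
  -- the distance of the values of `Θ` to the points of a finite grid
  have hgrid : ∀ (p : Θ → Fin (m + 1 + 1)), ∃ D : Pt Sg.lang (Fin 0) → ℝ,
      Formula.IsTruthFunction D ∧ ∀ x (ρ : ℝ), 0 ≤ ρ → (D x ≤ ρ ↔
        ∀ θ : Θ, |θ.1.val x.1 x.2 - (((p θ : ℕ) / (m + 1 : ℕ) : ℚ) : ℝ)| ≤ ρ) := fun p =>
    hLC.exists_finite_max _ fun θ => hLC.absSub (Formula.isTruthFunction_val θ.1)
      (hLC.const _ (by positivity) (by
        rw [div_le_one (by positivity)]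
        exact_mod_cast Nat.lt_succ_iff.1 (p θ).2))
  choose D hD hDle using hgrid
  obtain ⟨n, hn⟩ := exists_nat_gt (3 / δ)
  have hnδ : 1 ≤ n * (δ / 3) := by
    have : 3 < n * δ := by rwa [div_lt_iff₀ hδ] at hn
    linarith
  let P := {p : Θ → Fin (m + 1 + 1) // ∃ M : Sg.Str, (s : ℝ) ≤ L.val φ M.1 ∧
    D p ⟨M.1, Fin.elim0⟩ ≤ 1 / (m + 1 : ℕ)}
  have hterm : ∀ p : P, Formula.IsTruthFunction fun x : Pt Sg.lang (Fin 0) =>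
      1 - min (n * max (D p.1 x - ((1 / (m + 1 : ℕ) : ℚ) : ℝ)) 0) 1 := fun p =>
    hLC.compl (hLC.truncMul (hLC.truncSub (hD p.1) (hLC.const _ (by positivity) (by
      rw [div_le_one (by positivity)]
      push_cast
      linarith [(Nat.cast_nonneg m : (0 : ℚ) ≤ m)]))) n)
  obtain ⟨G, ⟨ψ, hψ⟩, hGle⟩ := hLC.exists_finite_max _ hterm
  have hGI := fun x => hψ x ▸ ψ.val_mem x.1 x.2
  refine ⟨ψ, fun M => ⟨fun hM => ?_, fun hM => ?_⟩⟩
  · have hval := hψ ⟨M.1, Fin.elim0⟩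
    refine hval.trans (le_antisymm (hGI _).2 ?_)
    choose p hp using fun θ : Θ =>
      Formula.exists_grid m.succ_pos (θ.1.val_mem M.1 Fin.elim0)
    have hDp : D p ⟨M.1, Fin.elim0⟩ ≤ 1 / (m + 1 : ℕ) := (hDle p _ _ (by positivity)).2 hp
    have h1 := (hGle ⟨M.1, Fin.elim0⟩ _ (hGI _).1).1 le_rfl ⟨p, M, hM, hDp⟩
    have h2 : max (D p ⟨M.1, Fin.elim0⟩ - ((1 / (m + 1 : ℕ) : ℚ) : ℝ)) 0 = 0 := by
      refine max_eq_right ?_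
      push_cast at hDp ⊢
      linarith
    simp only [h2, mul_zero] at h1
    rw [min_eq_left zero_le_one] at h1
    linarith
  · have hval := hψ ⟨M.1, Fin.elim0⟩
    refine hval.trans (le_antisymm ((hGle _ 0 le_rfl).2 ?_) (hGI _).1)
    rintro ⟨p, N, hN, hNp⟩
    have h1 : 2 * δ / 3 < D p ⟨M.1, Fin.elim0⟩ := by
      by_contra! hle
      refine absurd hM (not_le.2 (hsep N M (fun θ hθ => ?_) hN))
      have h2 := (hDle p _ _ (by positivity)).1 hNp ⟨θ, hθ⟩
      have h3 := (hDle p _ _ (by positivity)).1 hle ⟨θ, hθ⟩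
      dsimp only at h2 h3
      rw [abs_le] at h2 h3 ⊢
      constructor <;> linarith [h2.1, h2.2, h3.1, h3.2]
    have h2 : δ / 3 ≤ max (D p ⟨M.1, Fin.elim0⟩ - ((1 / (m + 1 : ℕ) : ℚ) : ℝ)) 0 := by
      refine le_max_of_le_left ?_
      push_cast at hm1 ⊢
      linarith
    have h3 : 1 ≤ n * max (D p ⟨M.1, Fin.elim0⟩ - ((1 / (m + 1 : ℕ) : ℚ) : ℝ)) 0 :=
      hnδ.trans (mul_le_mul_of_nonneg_left h2 (Nat.cast_nonneg n))
    rw [min_eq_right h3, sub_self]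

/-- The approximation is `max_j min(ψ_j, (j + 1) / (m + 1))`, where `ψ_j` separates
`φ ≥ (j + 1) / (m + 1)` from `φ ≤ j / (m + 1)`. -/
theorem OmittingLogic.exists_approx_of_finite (H : OmittingLogic L κ) (Sg : Signature.{u})
    [Finite Sg.lang.Symbols] (φ : L.Sent Sg.lang) {ε : ℝ} (hε : 0 < ε) :
    ∃ ψ : Formula Sg.lang 0, ∀ M : Sg.Str,
      |L.val φ M.1 - ψ.val M.1 Fin.elim0| ≤ ε := by
  have hLC := Formula.lukClosed (S := Sg.lang) (n := 0)
  obtain ⟨m, hm⟩ := exists_nat_one_div_lt hε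
  have hm0 : (0 : ℝ) < (m : ℝ) + 1 := by positivity
  have hm0' : (0 : ℚ) < (m : ℚ) + 1 := by positivity
  have hj1 : ∀ j : Fin (m + 1), ((j : ℕ) + 1 : ℚ) / (m + 1) ≤ 1 := fun j => by
    rw [div_le_one hm0']
    exact_mod_cast j.2
  choose ψ hψ using fun j : Fin (m + 1) => H.exists_separating_formula Sg φ
    (r := (j : ℕ) / (m + 1)) (s := ((j : ℕ) + 1) / (m + 1)) (by positivity)
    (by gcongr; linarith) (hj1 j)
  obtain ⟨G, ⟨χ, hχ⟩, hGle⟩ := hLC.exists_finite_max _ fun j : Fin (m + 1) =>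
    hLC.inf (Formula.isTruthFunction_val (ψ j)) (hLC.const _ (by positivity) (hj1 j))
  have hGI := fun x => hχ x ▸ χ.val_mem x.1 x.2
  refine ⟨χ, fun M => ?_⟩
  rw [hχ ⟨M.1, Fin.elim0⟩]
  refine le_trans ?_ hm.le
  have hφ := L.val_mem φ M.1
  have hup : G ⟨M.1, Fin.elim0⟩ ≤ L.val φ M.1 + 1 / (m + 1) := by
    refine (hGle _ _ (add_nonneg hφ.1 (by positivity))).2 fun j => ?_
    by_cases hj : L.val φ M.1 ≤ (((j : ℕ) / (m + 1) : ℚ) : ℝ)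
    · refine (min_le_left _ _).trans (((hψ j M).2 hj).le.trans ?_)
      exact add_nonneg hφ.1 (by positivity)
    · refine (min_le_right _ _).trans ?_
      push_cast at hj ⊢
      rw [add_div]
      linarith
  have hlow : L.val φ M.1 ≤ G ⟨M.1, Fin.elim0⟩ + 1 / (m + 1) := by
    have h1 : L.val φ M.1 * (m + 1) ≤ ⌊L.val φ M.1 * (m + 1)⌋₊ + 1 := (Nat.lt_floor_add_one _).le
    have h2 := Nat.floor_le (mul_nonneg hφ.1 hm0.le)
    have h3 : L.val φ M.1 * (m + 1) ≤ m + 1 := mul_le_of_le_one_left hm0.le hφ.2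
    rcases hk : ⌊L.val φ M.1 * (m + 1)⌋₊ with _ | k
    · rw [hk, Nat.cast_zero, zero_add, ← le_div_iff₀ hm0] at h1
      linarith [(hGI ⟨M.1, Fin.elim0⟩).1]
    · rw [hk] at h1 h2
      have hkm : k < m + 1 := by
        have : ((k + 1 : ℕ) : ℝ) ≤ (m + 1 : ℕ) := by
          push_cast at h2 ⊢
          linarith
        exact_mod_cast this
      have hs : ((((k : ℕ) + 1) / (m + 1) : ℚ) : ℝ) ≤ L.val φ M.1 := by
        push_cast at h2 ⊢
        rwa [div_le_iff₀ hm0]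
      have h4 := (hGle ⟨M.1, Fin.elim0⟩ _ (hGI _).1).1 le_rfl ⟨k, hkm⟩
      rw [(hψ ⟨k, hkm⟩ M).1 hs, min_eq_right (by exact_mod_cast hj1 ⟨k, hkm⟩)] at h4
      rw [← le_div_iff₀ hm0, add_div] at h1
      push_cast at h1 h4
      linarith
  rw [abs_le]
  constructor <;> linarith

theorem OmittingLogic.exists_approx (H : OmittingLogic L κ) (Sg : Signature.{u})
    (φ : L.Sent Sg.lang) {ε : ℝ} (hε : 0 < ε) : ∃ ψ : cl.Sent Sg.lang, ∀ M : Sg.Str,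
      |L.val φ M.1 - cl.val ψ M.1| ≤ ε := by
  obtain ⟨S₀, i, φ₀, hfin, hi, hφ⟩ := H.fin _ φ
  let Sg₀ : Signature.{u} := ⟨S₀, fun f => Sg.opMod (i.onFunction f),
    fun R => Sg.predMod (i.onRelation R)⟩
  have : Finite Sg₀.lang.Symbols := hfin
  obtain ⟨ψ, hψ⟩ := H.exists_approx_of_finite Sg₀ φ₀ hε
  refine ⟨cl.map i hi ψ, fun M => ?_⟩
  have hval : cl.val (cl.map i hi ψ) M.1 = Formula.val (M.1.reduct i) ψ Fin.elim0 :=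
    cl.val_map i hi ψ M.1
  rw [hφ, hval]
  exact hψ ⟨M.1.reduct i, fun f => M.2.1 (i.onFunction f), fun R => M.2.2 (i.onRelation R)⟩

/-- Uniform approximation gives the inclusion of topologies that is not assumed. -/
theorem OmittingLogic.logicalTopology_eq (H : OmittingLogic L κ) (hext : L.Extends cl)
    (Sg : Signature.{u}) : L.logicalTopology Sg = cl.logicalTopology Sg := by
  refine le_antisymm (fun U hU => hext Sg U hU) (le_generateFrom ?_)
  rintro _ ⟨T, rfl⟩
  let T' : Set (cl.Sent Sg.lang) := {ψ | ∀ M : Sg.Str, L.Models M.1 T → cl.val ψ M.1 = 1}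
  have hT : L.Mod Sg T = cl.Mod Sg T' := by
    ext M
    refine ⟨fun hM ψ hψ => hψ M hM, fun hM φ hφ => ?_⟩
    refine le_antisymm (L.val_mem φ M.1).2 (le_of_forall_pos_le_add fun ε hε => ?_)
    obtain ⟨q, hq₀, hq⟩ := exists_rat_btwn (show (0 : ℝ) < min (ε / 2) 1 by positivity)
    obtain ⟨ψ, hψ⟩ := H.exists_approx Sg φ hq₀
    have hq1 := hq.trans_le (min_le_right _ _)
    have h0 : 0 ≤ 1 - q := sub_nonneg.2 (by exact_mod_cast hq1.le)
    have h1 : 1 - q ≤ 1 := sub_le_self _ (by exact_mod_cast hq₀.le)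
    have hval : ∀ N : MetStr Sg.lang, cl.val (Formula.imp (.const (1 - q) h0 h1) ψ) N = 1 ↔
        ((1 - q : ℚ) : ℝ) ≤ cl.val ψ N := fun N => lukImp_eq_one_iff
    have hmem : Formula.imp (.const (1 - q) h0 h1) ψ ∈ T' := fun N hN => by
      rw [hval]
      have h2 := (abs_le.1 (hψ N)).2
      rw [show L.val φ N.1 = 1 from hN φ hφ] at h2
      push_cast
      linarith
    have h2 := (hval M.1).1 (hM _ hmem)
    have h3 := (abs_le.1 (hψ M)).1
    push_cast at h2
    linarith [hq.trans_le (min_le_left _ _)]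
  rw [hT]
  exact TopologicalSpace.GenerateOpen.basic _ ⟨T', rfl⟩

end MetricLogic

end

theorem theorem4 (L : MetricLogic.ValuedLogic.{u})
    (hatom : L.HasAtomicSentences)
    (hconn : L.ClosedUnderBasicConnectives)
    (hex : L.ClosedUnderExists)
    (hfin : L.FiniteOccurrence)
    (hrel : L.PermitsRelativization)
    (hcomp : L.EquivalentToCompletions)
    (hext : L.Extends MetricLogic.cl)
    (κ : Cardinal.{u}) (hreg : κ.IsRegular) (hunc : Cardinal.aleph0 < κ)
    (hOTP : L.OmittingTypesProperty κ) :
    (∀ Sg : MetricLogic.Signature.{u}, Sg.lang.card < κ →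
      L.logicalTopology Sg = MetricLogic.cl.logicalTopology Sg) ∧
    (∀ (Sg : MetricLogic.Signature.{u}) (φ : L.Sent Sg.lang) (ε : ℝ), 0 < ε →
      ∃ ψ : MetricLogic.cl.Sent Sg.lang, ∀ M : Sg.Str,
        |L.val φ M.1 - MetricLogic.cl.val ψ M.1| ≤ ε) :=
  have H : MetricLogic.OmittingLogic L κ :=
    ⟨⟨hatom, hconn, hex⟩, hfin, hrel, hcomp, hreg, hunc, hOTP⟩
  ⟨fun Sg _ => H.logicalTopology_eq hext Sg, fun Sg φ _ hε => H.exists_approx Sg φ hε⟩
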